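/- Let $\kappa=\pm1$ and let $M_\kappa$ be the three-dimensional space form $S^3$ ($\kappa=1$) or $H^3$ ($\kappa=-1$), with its canonical orientation. Let $\mathcal G_\kappa$ be the four-dimensional manifold of oriented complete geodesics $[\gamma]$ of $M_\kappa$ ($\gamma$ of unit speed, up to translation of the parameter). The tangent space $T_{[\gamma]}\mathcal G_\kappa$ is identified with the space of Jacobi fields $J$ along $\gamma$ with $J\perp\gamma'$: the velocity of $s\mapsto[\gamma_s]$ corresponds to the component orthogonal to $\gamma'$ of the variation field of $\gamma_s$. Endow $\mathcal G_\kappa$ with the Kähler structure $(g_K,\mathcal J)$, $$g_K(I,J)=\langle I,J\rangle+\kappa\,\langle I',J'\rangle,\qquad \mathcal J(J)=\gamma'\times J,$$ and let $\omega_K=g_K(\mathcal J\,\cdot,\cdot)$. Let $S\subset M_\kappa$ be a compact connected smooth embedded surface that is strictly convex (for each $p\in S$ the complete totally geodesic surface tangent to $S$ at $p$ meets $S$ only at $p$) and quadratically convex (its shape operator is definite at every point). Let $n$ be the inward unit normal field of $S$ and $iu=n(p)\times u$ for $u\in T_pS$. Let $\mathcal M\cong T^1S$ be the hypersurface of oriented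 geodesics $[\gamma_u]$ tangent to $S$ ($u\in T^1S$, $\gamma_u$ the geodesic with initial velocity $u$), and let $\mathcal U$ be the set of oriented geodesics that do not intersect $S$ and, if $\kappa=1$, are not one of the great circles contained in a linear plane $T_pS\subset\mathbb R^4$, $p\in S$. For $u\in T^1S$ and $t\in\mathbb R$ let $u_t$ be the parallel transport of $u$ along $\gamma_{iu}$ from $0$ to $t$, and put $$F(u,t)=[\gamma_{u_t}]\in\mathcal G_\kappa .$$ Then for every $u\in T^1S$ there is exactly one $g_K$-unit vector $N(u)\in T_{[\gamma_u]}\mathcal G_\kappa$ (that is, $g_K(N(u),N(u))=1$) which is $g_K$-orthogonal to $T_{[\gamma_u]}\mathcal M$ and points outwards (towards $\mathcal U$), and $$F(u,t)=\Gamma_{\mathcal J(N(u))}(t)\qquad\text{for all } t\in\mathbb R,$$ where $\Gamma_\xi$ denotes the geodesic of $(\mathcal G_\kappa,g_K)$ with initial velocity $\xi$; that is, $t\mapsto F(u,t)$ is a $g_K$-geodesic with initial velocity $\mathcal J(N(u))$. Moreover $\mathcal J(N(u))$ spans the characteristic line of $\mathcal M$ at $[\gamma_u]$, the kernel of the restriction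 of $\omega_K$ to $T_{[\gamma_u]}\mathcal M$. -/

import Mathlib

open Set Filter Topology
open scoped ContDiff

noncomputable section

namespace GeodesicBilliard

/-! ### The space form `M_κ`, `κ = ±1`, as a quadric in `ℝ⁴` -/

/-- The vector space `ℝ⁴` with coordinates `x 0, x 1, x 2, x 3`. -/
abbrev E4 : Type := Fin 4 → ℝ

/-- The symmetric bilinear form `κ x₀y₀ + x₁y₁ + x₂y₂ + x₃y₃` on `ℝ⁴`. Its restriction to the
tangent spaces of the space form is the Riemannian metric of the space form. -/
def bil (κ : ℝ) (x y : E4) : ℝ := κ * x 0 * y 0 + x 1 * y 1 + x 2 * y 2 + x 3 * y 3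

/-- The space form `M_κ`: the connected component of `e₀` in
`{x | κ x₀² + x₁² + x₂² + x₃² = κ}`, i.e. `S³` for `κ = 1` and the upper sheet of the
hyperboloid (hyperbolic space) for `κ = -1`. -/
def spaceForm (κ : ℝ) : Set E4 := {x | bil κ x x = κ ∧ (κ = -1 → 0 < x 0)}

/-- The cross product `a × b` on the oriented tangent space `T_p M_κ`, determined by
`⟨a × b, c⟩ = det (p, a, b, c)`; thus `e₁ × e₂ = e₃` at `p = e₀`. -/
def cross (κ : ℝ) (p a b : E4) : E4 := fun i =>
  (if i = 0 then κ else 1) * Matrix.det (Matrix.of ![p, a, b, Pi.single i 1])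

/-- `c_κ`: cosine for `κ = 1`, hyperbolic cosine for `κ = -1`. -/
def cK (κ r : ℝ) : ℝ := if κ = 1 then Real.cos r else Real.cosh r

/-- `s_κ`: sine for `κ = 1`, hyperbolic sine for `κ = -1`. -/
def sK (κ r : ℝ) : ℝ := if κ = 1 then Real.sin r else Real.sinh r

/-- The unit tangent bundle `T¹M_κ`: pairs (foot point, unit tangent vector). -/
def unitTangentBundle (κ : ℝ) : Set (E4 × E4) :=
  {q | q.1 ∈ spaceForm κ ∧ bil κ q.1 q.2 = 0 ∧ bil κ q.2 q.2 = 1}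

/-- The unit speed geodesic of `M_κ` with initial point `q.1` and initial velocity `q.2`. -/
def geod (κ : ℝ) (q : E4 × E4) (r : ℝ) : E4 := cK κ r • q.1 + sK κ r • q.2

/-- The velocity of `geod κ q`, see `hasDerivAt_geod`. -/
def geodVel (κ : ℝ) (q : E4 × E4) (r : ℝ) : E4 := (-(κ * sK κ r)) • q.1 + cK κ r • q.2

/-- The covariant derivative in `M_κ` of a vector field `W` along a curve `γ`: the orthogonal
projection of the derivative `W'` in `ℝ⁴` to the tangent space of `M_κ`. Recall that
`⟨γ, γ⟩ = κ` and `1 / κ = κ`. -/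
def covDeriv (κ : ℝ) (γ W : ℝ → E4) (t : ℝ) : E4 :=
  deriv W t - (κ * bil κ (deriv W t) (γ t)) • γ t

/-- Parallel transport of the vector `x` along the geodesic `geod κ q` between `0` and `t`: the
component of `x` along the geodesic goes to the corresponding multiple of its velocity, and the
orthogonal component is constant in `ℝ⁴`. See `covDeriv_parallelTransport`. -/
def parallelTransport (κ : ℝ) (q : E4 × E4) (t : ℝ) (x : E4) : E4 :=
  x + bil κ x q.2 • (geodVel κ q t - q.2)

theorem hasDerivAt_cK {κ : ℝ} (hκ : κ = 1 ∨ κ = -1) (r : ℝ) :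
    HasDerivAt (cK κ) (-(κ * sK κ r)) r := by
  rcases hκ with rfl | rfl
  · have h : cK 1 = Real.cos := by funext x; simp [cK]
    rw [h]; simpa [sK] using Real.hasDerivAt_cos r
  · have h : cK (-1) = Real.cosh := by funext x; simp [cK]; norm_num
    rw [h]
    have h2 : sK (-1) r = Real.sinh r := by simp [sK]; norm_num
    rw [h2]; simpa using Real.hasDerivAt_cosh r

theorem hasDerivAt_sK {κ : ℝ} (hκ : κ = 1 ∨ κ = -1) (r : ℝ) :
    HasDerivAt (sK κ) (cK κ r) r := by
  rcases hκ with rfl | rfl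
  · have h : sK 1 = Real.sin := by funext x; simp [sK]
    rw [h]; simpa [cK] using Real.hasDerivAt_sin r
  · have h : sK (-1) = Real.sinh := by funext x; simp [sK]; norm_num
    rw [h]
    have h2 : cK (-1) r = Real.cosh r := by simp [cK]; norm_num
    rw [h2]; exact Real.hasDerivAt_sinh r

theorem hasDerivAt_geod {κ : ℝ} (hκ : κ = 1 ∨ κ = -1) (q : E4 × E4) (r : ℝ) :
    HasDerivAt (geod κ q) (geodVel κ q r) r :=
  ((hasDerivAt_cK hκ r).smul_const q.1).add ((hasDerivAt_sK hκ r).smul_const q.2)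

theorem hasDerivAt_geodVel {κ : ℝ} (hκ : κ = 1 ∨ κ = -1) (q : E4 × E4) (r : ℝ) :
    HasDerivAt (geodVel κ q) (-κ • geod κ q r) r := by
  have h1 := (((hasDerivAt_sK hκ r).const_mul κ).neg).smul_const q.1
  have h2 := (hasDerivAt_cK hκ r).smul_const q.2
  refine (h1.add h2).congr_deriv ?_
  simp only [geod, smul_add, smul_smul]
  congr 1 <;> congr 1 <;> ring

/-- Along a geodesic, the parallel transport of a vector starts at that vector and has zero
covariant derivative. -/
theorem covDeriv_parallelTransport {κ : ℝ} (hκ : κ = 1 ∨ κ = -1) (q : E4 × E4)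
    (hq : ∀ t, bil κ (geod κ q t) (geod κ q t) = κ) (x : E4) :
    parallelTransport κ q 0 x = x ∧
      ∀ t, covDeriv κ (geod κ q) (fun s => parallelTransport κ q s x) t = 0 := by
  constructor
  · simp [parallelTransport, geodVel, sK, cK]
  · intro t
    have h : HasDerivAt (fun s => parallelTransport κ q s x)
        (bil κ x q.2 • (-κ • geod κ q t)) t := by
      have := (((hasDerivAt_geodVel hκ q t).sub_const q.2).const_smul (bil κ x q.2)).const_add x
      exact this
    have hb : ∀ (a : ℝ) (y z : E4), bil κ (a • y) z = a * bil κ y z := by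
      intro a y z; simp only [bil, Pi.smul_apply, smul_eq_mul]; ring
    have hk : κ * κ = 1 := by rcases hκ with rfl | rfl <;> norm_num
    rw [covDeriv, h.deriv, hb, hb, hq t, smul_smul, ← sub_smul]
    have : bil κ x q.2 * -κ - κ * (bil κ x q.2 * (-κ * κ)) = 0 := by
      linear_combination (bil κ x q.2 * κ) * hk
    rw [this, zero_smul]

/-! ### The space of oriented geodesics -/

/-- Two unit speed geodesics are equivalent if they differ by a translation of the parameter. -/
def geodSetoid (κ : ℝ) : Setoid (unitTangentBundle κ) where
  r q q' := ∃ τ : ℝ, ∀ t, geod κ q' t = geod κ q (t + τ)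
  iseqv :=
    { refl := fun _ => ⟨0, fun t => by rw [add_zero]⟩
      symm := by
        rintro q q' ⟨τ, h⟩
        exact ⟨-τ, fun t => by rw [h, neg_add_cancel_right]⟩
      trans := by
        rintro q q' q'' ⟨τ, h⟩ ⟨τ', h'⟩
        exact ⟨τ' + τ, fun t => by rw [h', h, add_assoc]⟩ }

/-- The space `𝒢_κ` of oriented geodesics of `M_κ`. -/
def OrientedGeodesic (κ : ℝ) : Type := Quotient (geodSetoid κ)

/-- The oriented geodesic `[γ_q]` determined by a unit tangent vector `q`. -/
def toGeodesic {κ : ℝ} (q : unitTangentBundle κ) : OrientedGeodesic κ :=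
  Quotient.mk (geodSetoid κ) q

/-- The Jacobi fields along `γ = geod κ q` orthogonal to `γ'`; they form the tangent space
`T_[γ] 𝒢_κ`. -/
def IsNormalJacobi (κ : ℝ) (q : unitTangentBundle κ) (J : ℝ → E4) : Prop :=
  ContDiff ℝ ∞ J ∧ ∀ r,
    bil κ (geod κ q r) (J r) = 0 ∧ bil κ (geodVel κ q r) (J r) = 0 ∧
      covDeriv κ (geod κ q) (covDeriv κ (geod κ q) J) r + κ • J r = 0

/-- The Jacobi field `d/ds|_{s₀} γ_{φ(s)}` of a variation by unit speed geodesics. -/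
def variationField {κ : ℝ} (φ : ℝ → unitTangentBundle κ) (s₀ r : ℝ) : E4 :=
  deriv (fun s => geod κ (φ s) r) s₀

/-- The component `J^N = J - ⟨J, γ'⟩ γ'` of a vector field along `γ = geod κ q`. -/
def normalPart {κ : ℝ} (q : unitTangentBundle κ) (J : ℝ → E4) (r : ℝ) : E4 :=
  J r - bil κ (J r) (geodVel κ q r) • geodVel κ q r

/-- The curve `c` in `𝒢_κ` is smooth near `t₀`, passes at time `t₀` through `[γ_q]`, and its
velocity there is the element `J` of `T_[γ_q] 𝒢_κ`, a Jacobi field along `γ_q`. -/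
def HasVelocity {κ : ℝ} (c : ℝ → OrientedGeodesic κ) (t₀ : ℝ) (q : unitTangentBundle κ)
    (J : ℝ → E4) : Prop :=
  ∃ φ : ℝ → unitTangentBundle κ,
    (∀ᶠ s in 𝓝 t₀, ContDiffAt ℝ ∞ (fun s' => (φ s' : E4 × E4)) s) ∧
    (∀ᶠ s in 𝓝 t₀, c s = toGeodesic (φ s)) ∧ φ t₀ = q ∧
    J = normalPart q (variationField φ t₀)

/-- The metric `g_K(I, J) = ⟨I, J⟩ + κ ⟨I', J'⟩` on `T_[γ_q] 𝒢_κ` (the right hand side is constant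
along the geodesic). -/
def gK {κ : ℝ} (q : unitTangentBundle κ) (I J : ℝ → E4) : ℝ :=
  bil κ (I 0) (J 0) +
    κ * bil κ (covDeriv κ (geod κ q) I 0) (covDeriv κ (geod κ q) J 0)

/-- The complex structure `𝒥(J) = γ' × J` on `T_[γ_q] 𝒢_κ`. -/
def complexStructure {κ : ℝ} (q : unitTangentBundle κ) (J : ℝ → E4) : ℝ → E4 :=
  fun r => cross κ (geod κ q r) (geodVel κ q r) (J r)

/-- The fundamental form `ω_K(I, J) = g_K(𝒥 I, J)`. -/
def omegaK {κ : ℝ} (q : unitTangentBundle κ) (I J : ℝ → E4) : ℝ :=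
  gK q (complexStructure q I) J

/-! ### Geodesics of the pseudo-Riemannian manifold `(𝒢_κ, g_K)` -/

/-- For a map `φ` into the unit tangent bundle, the derivative at `x` in the direction `h` of
`x ↦ [γ_{φ(x)}]`, as a Jacobi field along `γ_{φ(x)}`. -/
def paramDeriv {κ : ℝ} (φ : (Fin 4 → ℝ) → unitTangentBundle κ) (x h : Fin 4 → ℝ) : ℝ → E4 :=
  normalPart (φ x) (variationField (fun s => φ (x + s • h)) 0)

/-- `x ↦ [γ_{φ(x)}]` is a local parametrization (the inverse of a chart) of the four dimensional
manifold `𝒢_κ` on the open set `Ω`: it is smooth (having a smooth lift `φ` to the unit tangent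
bundle), injective, and has injective differential. -/
def IsLocalParam {κ : ℝ} (Ω : Set (Fin 4 → ℝ)) (φ : (Fin 4 → ℝ) → unitTangentBundle κ) : Prop :=
  IsOpen Ω ∧ ContDiffOn ℝ ∞ (fun x => (φ x : E4 × E4)) Ω ∧
    InjOn (fun x => toGeodesic (φ x)) Ω ∧
    ∀ x ∈ Ω, ∀ h : Fin 4 → ℝ, h ≠ 0 → paramDeriv φ x h ≠ 0

/-- The matrix `(g_ij)` of `g_K` in the coordinates given by `φ`. -/
def metricMatrix {κ : ℝ} (φ : (Fin 4 → ℝ) → unitTangentBundle κ) (x : Fin 4 → ℝ) :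
    Matrix (Fin 4) (Fin 4) ℝ :=
  Matrix.of fun i j =>
    gK (φ x) (paramDeriv φ x (Pi.single i 1)) (paramDeriv φ x (Pi.single j 1))

/-- The partial derivative `∂_m g_ij`. -/
def metricPartial {κ : ℝ} (φ : (Fin 4 → ℝ) → unitTangentBundle κ) (x : Fin 4 → ℝ)
    (m i j : Fin 4) : ℝ :=
  fderiv ℝ (fun y => metricMatrix φ y i j) x (Pi.single m 1)

/-- The Christoffel symbols `Γ^k_ij` of the Levi-Civita connection of `g_K` in the coordinates
given by `φ`. -/
def christoffel {κ : ℝ} (φ : (Fin 4 → ℝ) → unitTangentBundle κ) (x : Fin 4 → ℝ)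
    (k i j : Fin 4) : ℝ :=
  (1 / 2) * ∑ l, (metricMatrix φ x)⁻¹ k l *
    (metricPartial φ x i j l + metricPartial φ x j i l - metricPartial φ x l i j)

/-- The curve `c : ℝ → 𝒢_κ` is a geodesic of `g_K`: around every time it is smooth and satisfies
the geodesic equation in local coordinates. -/
def IsGeodesicGK {κ : ℝ} (c : ℝ → OrientedGeodesic κ) : Prop :=
  ∀ t₀ : ℝ, ∃ (Ω : Set (Fin 4 → ℝ)) (φ : (Fin 4 → ℝ) → unitTangentBundle κ)
    (x : ℝ → Fin 4 → ℝ), IsLocalParam Ω φ ∧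
    ∀ᶠ t in 𝓝 t₀, x t ∈ Ω ∧ ContDiffAt ℝ ∞ x t ∧ c t = toGeodesic (φ (x t)) ∧
      ∀ k, deriv (deriv x) t k +
        ∑ i, ∑ j, christoffel φ (x t) k i j * deriv x t i * deriv x t j = 0

/-! ### Convex surfaces -/

/-- `S` is a compact connected smooth embedded surface of `M_κ`: near each of its points it is the
zero set in `M_κ` of a smooth function with nonzero differential on the tangent space of `M_κ`. -/
def IsCompactSurface (κ : ℝ) (S : Set E4) : Prop :=
  S ⊆ spaceForm κ ∧ IsCompact S ∧ IsConnected S ∧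
    ∀ p ∈ S, ∃ (V : Set E4) (f : E4 → ℝ), IsOpen V ∧ p ∈ V ∧ ContDiffOn ℝ ∞ f V ∧
      (∃ w, bil κ p w = 0 ∧ fderiv ℝ f p w ≠ 0) ∧
      ∀ x ∈ V, x ∈ S ↔ x ∈ spaceForm κ ∧ f x = 0

/-- `σ` is (near `0`) a smooth curve in `S` with `σ(0) = p`. -/
def IsCurveIn (S : Set E4) (p : E4) (σ : ℝ → E4) : Prop :=
  (∀ᶠ s in 𝓝 (0 : ℝ), ContDiffAt ℝ ∞ σ s ∧ σ s ∈ S) ∧ σ 0 = p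

/-- The tangent space `T_pS`: the velocities at `p` of smooth curves in `S`. -/
def tangentPlane (S : Set E4) (p : E4) : Set E4 := {x | ∃ σ, IsCurveIn S p σ ∧ deriv σ 0 = x}

/-- The complete totally geodesic surface of `M_κ` tangent to `S` at `p`: the union of the
geodesics tangent to `S` at `p`. -/
def tangentGeodesicSurface (κ : ℝ) (S : Set E4) (p : E4) : Set E4 :=
  {x | ∃ v ∈ tangentPlane S p, bil κ v v = 1 ∧ ∃ t, x = geod κ (p, v) t}

/-- Strict convexity: each tangent totally geodesic surface meets `S` only at the point of
tangency. -/
def StrictlyConvex (κ : ℝ) (S : Set E4) : Prop :=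
  ∀ p ∈ S, S ∩ tangentGeodesicSurface κ S p = {p}

/-- `ν` is the inward unit normal of the strictly convex surface `S` at `p`: a unit vector of
`T_p M_κ` orthogonal to `T_pS` and pointing to the side of the tangent totally geodesic surface
`{x ∈ M_κ | ⟨ν, x⟩ = 0}` on which `S` lies. -/
def IsInwardNormal (κ : ℝ) (S : Set E4) (p ν : E4) : Prop :=
  bil κ p ν = 0 ∧ bil κ ν ν = 1 ∧ (∀ x ∈ tangentPlane S p, bil κ ν x = 0) ∧
    ∀ x ∈ S, 0 ≤ bil κ ν x

open Classical in
/-- The inward unit normal vector field `n` of `S`. (It exists and is unique for compact connected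
strictly convex surfaces; the value `0` is never used for those.) -/
def inwardNormal (κ : ℝ) (S : Set E4) (p : E4) : E4 :=
  if h : ∃ ν, IsInwardNormal κ S p ν then h.choose else 0

/-- The value `⟨A_p x, x⟩`, `x = σ'(0)`, `p = σ(0)`, of the quadratic form of the shape operator
`A_p x = -∇_x n`, for a curve `σ` in `S`. -/
def shapeForm (κ : ℝ) (S : Set E4) (σ : ℝ → E4) : ℝ :=
  bil κ (-(covDeriv κ σ (fun s => inwardNormal κ S (σ s)) 0)) (deriv σ 0)

/-- Quadratic convexity: the shape operator is definite at every point. -/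
def QuadraticallyConvex (κ : ℝ) (S : Set E4) : Prop :=
  ∀ p ∈ S, (∀ σ, IsCurveIn S p σ → deriv σ 0 ≠ 0 → 0 < shapeForm κ S σ) ∨
    (∀ σ, IsCurveIn S p σ → deriv σ 0 ≠ 0 → shapeForm κ S σ < 0)

/-! ### The outer billiard -/

/-- The unit tangent bundle `T¹S` of the surface. -/
def unitTangentSurface (κ : ℝ) (S : Set E4) : Set (unitTangentBundle κ) :=
  {u | (u : E4 × E4).1 ∈ S ∧ (u : E4 × E4).2 ∈ tangentPlane S (u : E4 × E4).1}

/-- The billiard table `𝒰`: the oriented geodesics not intersecting `S`; for `κ = 1`, those in the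
Gauss image of `S` (great circles contained in some `T_pS ⊆ ℝ⁴`) are also removed. -/
def billiardTable (κ : ℝ) (S : Set E4) : Set (OrientedGeodesic κ) :=
  {ℓ | ∃ q : unitTangentBundle κ, toGeodesic q = ℓ ∧ (∀ t, geod κ q t ∉ S) ∧
    (κ = 1 → ¬ ∃ p ∈ S, ∀ t, geod κ q t ∈ tangentPlane S p)}

/-- The tangent space at `[γ_u]` of the hypersurface `ℳ ≅ T¹S` of geodesics tangent to `S`, as a
set of Jacobi fields along `γ_u`: the velocities of the curves `s ↦ [γ_{w(s)}]` with `w` a smooth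
curve in `T¹S` and `w(0) = u`. -/
def tangentSpaceM {κ : ℝ} (S : Set E4) (u : unitTangentBundle κ) : Set (ℝ → E4) :=
  {K | ∃ w : ℝ → unitTangentBundle κ,
    (∀ᶠ s in 𝓝 (0 : ℝ), ContDiffAt ℝ ∞ (fun s' => (w s' : E4 × E4)) s ∧
      w s ∈ unitTangentSurface κ S) ∧
    w 0 = u ∧ K = normalPart u (variationField w 0)}

/-- `ξ` is the outward unit normal vector at `[γ_u]` of the hypersurface `ℳ` of `(𝒢_κ, g_K)`:
outward means towards the billiard table `𝒰`. -/
def IsOutwardUnitNormal {κ : ℝ} (S : Set E4) (u : unitTangentBundle κ) (ξ : ℝ → E4) : Prop :=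
  IsNormalJacobi κ u ξ ∧ gK u ξ ξ = 1 ∧ (∀ K ∈ tangentSpaceM S u, gK u ξ K = 0) ∧
    ∃ c : ℝ → OrientedGeodesic κ, HasVelocity c 0 u ξ ∧
      ∀ᶠ s in 𝓝[>] (0 : ℝ), c s ∈ billiardTable κ S

/-- The vector `iu = n(p) × u` in `T_pS`, together with its foot point `p`. -/
def rotated {κ : ℝ} (S : Set E4) (u : unitTangentBundle κ) : E4 × E4 :=
  ((u : E4 × E4).1,
    cross κ (u : E4 × E4).1 (inwardNormal κ S (u : E4 × E4).1) (u : E4 × E4).2)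

/-- The vector `u_t`, with its foot point: the parallel transport of `u` along `γ_{iu}` between `0`
and `t`. -/
def transported {κ : ℝ} (S : Set E4) (u : unitTangentBundle κ) (t : ℝ) : E4 × E4 :=
  (geod κ (rotated S u) t, parallelTransport κ (rotated S u) t (u : E4 × E4).2)

open Classical in
/-- The map `F(u, t) = [γ_{u_t}]` defining the outer billiard on `𝒢_κ`. (For `u ∈ T¹S`, `u_t` is
always a unit tangent vector of `M_κ` and the second alternative does not occur.) -/
def billiardF {κ : ℝ} (S : Set E4) (u : unitTangentBundle κ) (t : ℝ) : OrientedGeodesic κ :=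
  if h : transported S u t ∈ unitTangentBundle κ then toGeodesic ⟨transported S u t, h⟩
  else toGeodesic u

end GeodesicBilliard

end

namespace GeodesicBilliard

/-! ### Algebra of the form `bil` -/

/-! Everything is computed in `ℝ⁴` in the frame `(p, n, v, w)`, where `u = (p, v)`, `n` is the
inward normal and `w = iu = n × v`; it is orthonormal for `bil κ`. A normal Jacobi field is
orthogonal to `γ` and `γ'`, hence so is its derivative, and the Jacobi equation becomes `J'' = -κ J`
in `ℝ⁴`. So `J = c_κ A + s_κ B` with `A, B` in the span of `n` and `w`
(`IsNormalJacobi.exists_eq_jac`). In these terms `g_K` is `⟨A, A'⟩ + κ ⟨B, B'⟩`, and `𝒥` applies the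
quarter turn `w ↦ n`, `n ↦ -w` to both `A` and `B`.

The tangent space of `ℳ` consists of the pairs `A = a w`, `B = b w + d n` with `a, b, d` arbitrary
(`mem_tangentSpaceM_iff`). Here `b` comes from turning `v` inside `T_pS`, and `d` from moving the
foot point along `v`, which works because the second fundamental form does not vanish on `v`. The
`g_K`-unit normals are therefore `A = ±n`, `B = 0`, and `𝒥` sends `(-n, 0)` to `(w, 0)`. On `Tℳ` one
finds `ω_K = κ (b d' - d b')`, whose kernel is the line `b = d = 0`, spanned by `(w, 0)`.

The sign of the normal is the part that needs the global shape of `S`. Strict convexity and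
connectedness put `S` on one side of each tangent totally geodesic surface
(`IsLocalSurface.one_side`), which gives a smooth inward normal. Pushing the foot point along `-n`
frees the geodesic from `S` (`eventually_mem_billiardTable`), whereas every curve with velocity `(n,
0)` consists, for small positive times, of geodesics that cut `S`, by an intermediate value argument
(`not_velocity_inward`).

Since `v ⊥ w`, parallel transport along `γ_w` leaves `v` unchanged in `ℝ⁴`. Hence `F(u, t)` is the
geodesic through `γ_w(t)` with direction `v`, and its velocity at `0` is `(w, 0)`. In the
coordinates `chart` it is the `y 0` axis. The metric coefficients do not depend on `y 0`, and `g_00`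
is critical along this axis, so `Γ^k_00 = 0` there and the axis is a geodesic. Geometrically, it is
an orbit of a one-parameter group of isometries through critical points of the length of the Killing
field. -/

theorem bil_comm (κ : ℝ) (x y : E4) : bil κ x y = bil κ y x := by
  simp only [bil]; ring

theorem bil_add_left (κ : ℝ) (x y z : E4) : bil κ (x + y) z = bil κ x z + bil κ y z := by
  simp only [bil, Pi.add_apply]; ring

theorem bil_add_right (κ : ℝ) (x y z : E4) : bil κ x (y + z) = bil κ x y + bil κ x z := by
  simp only [bil, Pi.add_apply]; ring

theorem bil_sub_left (κ : ℝ) (x y z : E4) : bil κ (x - y) z = bil κ x z - bil κ y z := by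
  simp only [bil, Pi.sub_apply]; ring

theorem bil_sub_right (κ : ℝ) (x y z : E4) : bil κ x (y - z) = bil κ x y - bil κ x z := by
  simp only [bil, Pi.sub_apply]; ring

theorem bil_smul_left (κ a : ℝ) (x y : E4) : bil κ (a • x) y = a * bil κ x y := by
  simp only [bil, Pi.smul_apply, smul_eq_mul]; ring

theorem bil_smul_right (κ a : ℝ) (x y : E4) : bil κ x (a • y) = a * bil κ x y := by
  simp only [bil, Pi.smul_apply, smul_eq_mul]; ring

theorem bil_neg_left (κ : ℝ) (x y : E4) : bil κ (-x) y = -bil κ x y := by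
  simp only [bil, Pi.neg_apply]; ring

theorem bil_neg_right (κ : ℝ) (x y : E4) : bil κ x (-y) = -bil κ x y := by
  simp only [bil, Pi.neg_apply]; ring

theorem bil_zero_left (κ : ℝ) (x : E4) : bil κ 0 x = 0 := by simp [bil]

theorem bil_zero_right (κ : ℝ) (x : E4) : bil κ x 0 = 0 := by simp [bil]

theorem kappa_sq {κ : ℝ} (hκ : κ = 1 ∨ κ = -1) : κ * κ = 1 := by
  rcases hκ with rfl | rfl <;> norm_num

theorem hasDerivAt_bil {κ : ℝ} {x y : ℝ → E4} {x' y' : E4} {s : ℝ}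
    (hx : HasDerivAt x x' s) (hy : HasDerivAt y y' s) :
    HasDerivAt (fun s => bil κ (x s) (y s)) (bil κ x' (y s) + bil κ (x s) y') s := by
  have hx := hasDerivAt_pi.1 hx
  have hy := hasDerivAt_pi.1 hy
  simp only [bil]
  refine ((((((hx 0).const_mul κ).mul (hy 0)).add ((hx 1).mul (hy 1))).add
    ((hx 2).mul (hy 2))).add ((hx 3).mul (hy 3))).congr_deriv ?_
  ring

theorem ContDiffAt.bil {κ : ℝ} {F : Type*} [NormedAddCommGroup F] [NormedSpace ℝ F]
    {x y : F → E4} {s : F} (hx : ContDiffAt ℝ ∞ x s) (hy : ContDiffAt ℝ ∞ y s) :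
    ContDiffAt ℝ ∞ (fun s => bil κ (x s) (y s)) s := by
  unfold GeodesicBilliard.bil
  fun_prop

theorem continuous_bil (κ : ℝ) (x : E4) : Continuous (fun y => bil κ x y) := by
  unfold bil
  fun_prop

/-! ### The cross product -/

theorem cross_zero_apply (κ : ℝ) (p a b : E4) : cross κ p a b 0 =
    -κ * (p 1 * (a 2 * b 3 - a 3 * b 2) - p 2 * (a 1 * b 3 - a 3 * b 1)
      + p 3 * (a 1 * b 2 - a 2 * b 1)) := by
  simp [cross, Matrix.det_succ_row_zero, Fin.sum_univ_succ, Fin.succAbove, Pi.single_apply]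
  ring

theorem cross_one_apply (κ : ℝ) (p a b : E4) : cross κ p a b 1 =
    p 0 * (a 2 * b 3 - a 3 * b 2) - p 2 * (a 0 * b 3 - a 3 * b 0)
      + p 3 * (a 0 * b 2 - a 2 * b 0) := by
  simp [cross, Matrix.det_succ_row_zero, Fin.sum_univ_succ, Fin.succAbove, Pi.single_apply]
  ring

theorem cross_two_apply (κ : ℝ) (p a b : E4) : cross κ p a b 2 =
    -(p 0 * (a 1 * b 3 - a 3 * b 1) - p 1 * (a 0 * b 3 - a 3 * b 0)
      + p 3 * (a 0 * b 1 - a 1 * b 0)) := by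
  simp [cross, Matrix.det_succ_row_zero, Fin.sum_univ_succ, Fin.succAbove, Pi.single_apply]
  ring

theorem cross_three_apply (κ : ℝ) (p a b : E4) : cross κ p a b 3 =
    p 0 * (a 1 * b 2 - a 2 * b 1) - p 1 * (a 0 * b 2 - a 2 * b 0)
      + p 2 * (a 0 * b 1 - a 1 * b 0) := by
  simp [cross, Matrix.det_succ_row_zero, Fin.sum_univ_succ, Fin.succAbove, Pi.single_apply]
  ring

theorem E4_ext {x y : E4} (h0 : x 0 = y 0) (h1 : x 1 = y 1) (h2 : x 2 = y 2) (h3 : x 3 = y 3) :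
    x = y := by
  funext i; fin_cases i <;> assumption

theorem cross_add_right (κ : ℝ) (p a b c : E4) :
    cross κ p a (b + c) = cross κ p a b + cross κ p a c := by
  apply E4_ext <;>
  simp only [cross_zero_apply, cross_one_apply, cross_two_apply, cross_three_apply,
    Pi.add_apply] <;> ring

theorem cross_smul_right (κ r : ℝ) (p a b : E4) :
    cross κ p a (r • b) = r • cross κ p a b := by
  apply E4_ext <;>
  simp only [cross_zero_apply, cross_one_apply, cross_two_apply, cross_three_apply,
    Pi.smul_apply, smul_eq_mul] <;> ring

/-- The cross product depends only on the bivector spanned by its first two arguments. -/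
theorem cross_plane (κ c s c' s' : ℝ) (p a b : E4) :
    cross κ (c • p + s • a) (s' • p + c' • a) b = (c * c' - s * s') • cross κ p a b := by
  apply E4_ext <;>
  simp only [cross_zero_apply, cross_one_apply, cross_two_apply, cross_three_apply,
    Pi.add_apply, Pi.smul_apply, smul_eq_mul] <;> ring

theorem bil_cross_self_left (κ : ℝ) (hκ : κ = 1 ∨ κ = -1) (p a b : E4) :
    bil κ p (cross κ p a b) = 0 := by
  rcases hκ with rfl | rfl <;>
  simp only [bil, cross_zero_apply, cross_one_apply, cross_two_apply, cross_three_apply] <;> ring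

theorem bil_cross_self_mid (κ : ℝ) (hκ : κ = 1 ∨ κ = -1) (p a b : E4) :
    bil κ a (cross κ p a b) = 0 := by
  rcases hκ with rfl | rfl <;>
  simp only [bil, cross_zero_apply, cross_one_apply, cross_two_apply, cross_three_apply] <;> ring

theorem bil_cross_self_right (κ : ℝ) (hκ : κ = 1 ∨ κ = -1) (p a b : E4) :
    bil κ b (cross κ p a b) = 0 := by
  rcases hκ with rfl | rfl <;>
  simp only [bil, cross_zero_apply, cross_one_apply, cross_two_apply, cross_three_apply] <;> ring

/-- Cauchy–Binet: up to the factor `κ`, the right-hand side is the Gram determinant of `p, a, b`. -/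
theorem bil_cross_cross (κ : ℝ) (hκ : κ = 1 ∨ κ = -1) (p a b : E4) :
    bil κ (cross κ p a b) (cross κ p a b) = κ *
      (bil κ p p * (bil κ a a * bil κ b b - bil κ a b ^ 2)
        - bil κ p a * (bil κ p a * bil κ b b - bil κ a b * bil κ p b)
        + bil κ p b * (bil κ p a * bil κ a b - bil κ a a * bil κ p b)) := by
  rcases hκ with rfl | rfl <;>
  simp only [bil, cross_zero_apply, cross_one_apply, cross_two_apply, cross_three_apply] <;> ring

/-- The triple product `b × (a × b)` of vectors in the orthogonal complement of `p`. -/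
theorem cross_cross (κ : ℝ) (hκ : κ = 1 ∨ κ = -1) {p a b : E4} (hp : bil κ p p = κ)
    (ha : bil κ p a = 0) (hb : bil κ p b = 0) :
    cross κ p b (cross κ p a b) = bil κ b b • a - bil κ a b • b := by
  have key : cross κ p b (cross κ p a b) = κ •
      ((bil κ p p * bil κ b b - bil κ p b ^ 2) • a - (bil κ p p * bil κ a b - bil κ p a * bil κ p b) • b
        + (bil κ a b * bil κ p b - bil κ b b * bil κ p a) • p) := by
    rcases hκ with rfl | rfl <;> apply E4_ext <;>
    simp only [bil, cross_zero_apply, cross_one_apply, cross_two_apply, cross_three_apply,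
      Pi.add_apply, Pi.sub_apply, Pi.smul_apply, smul_eq_mul] <;> ring
  rw [key, hp, ha, hb]
  have hk := kappa_sq hκ
  funext i
  simp only [Pi.add_apply, Pi.sub_apply, Pi.smul_apply, smul_eq_mul]
  linear_combination (bil κ b b * a i - bil κ a b * b i) * hk

theorem cross_swap (κ : ℝ) (p a b : E4) : cross κ p a b = -cross κ p b a := by
  apply E4_ext <;>
  simp only [cross_zero_apply, cross_one_apply, cross_two_apply, cross_three_apply,
    Pi.neg_apply] <;> ring

/-! ### Orthonormal frames -/

/-- `(p, n, v, w)` is an orthonormal frame for `bil κ` with `bil κ p p = κ`. -/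
structure IsFrame (κ : ℝ) (p n v w : E4) : Prop where
  pp : bil κ p p = κ
  pn : bil κ p n = 0
  pv : bil κ p v = 0
  pw : bil κ p w = 0
  nn : bil κ n n = 1
  nv : bil κ n v = 0
  nw : bil κ n w = 0
  vv : bil κ v v = 1
  vw : bil κ v w = 0
  ww : bil κ w w = 1

theorem isFrame_cross {κ : ℝ} (hκ : κ = 1 ∨ κ = -1) {p n v : E4} (pp : bil κ p p = κ)
    (pn : bil κ p n = 0) (pv : bil κ p v = 0) (nn : bil κ n n = 1) (nv : bil κ n v = 0)
    (vv : bil κ v v = 1) : IsFrame κ p n v (cross κ p n v) where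
  pp := pp
  pn := pn
  pv := pv
  pw := bil_cross_self_left κ hκ p n v
  nn := nn
  nv := nv
  nw := bil_cross_self_mid κ hκ p n v
  vv := vv
  vw := bil_cross_self_right κ hκ p n v
  ww := by
    rw [bil_cross_cross κ hκ, pp, pn, pv, nn, nv, vv]
    linear_combination kappa_sq hκ

namespace IsFrame

variable {κ : ℝ} {p n v w : E4}

theorem np (h : IsFrame κ p n v w) : bil κ n p = 0 := by rw [bil_comm, h.pn]
theorem vp (h : IsFrame κ p n v w) : bil κ v p = 0 := by rw [bil_comm, h.pv]
theorem wp (h : IsFrame κ p n v w) : bil κ w p = 0 := by rw [bil_comm, h.pw]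
theorem vn (h : IsFrame κ p n v w) : bil κ v n = 0 := by rw [bil_comm, h.nv]
theorem wn (h : IsFrame κ p n v w) : bil κ w n = 0 := by rw [bil_comm, h.nw]
theorem wv (h : IsFrame κ p n v w) : bil κ w v = 0 := by rw [bil_comm, h.vw]

/-- If `M` has rows `p, n, v, w` and `D = diag(κ, 1, 1, 1)`, the frame relations read `M D Mᵀ = D`,
so `M` is invertible; the four hypotheses say `M D x = 0`. -/
theorem eq_zero (h : IsFrame κ p n v w) (hκ : κ = 1 ∨ κ = -1) {x : E4} (hp : bil κ p x = 0)
    (hn : bil κ n x = 0) (hv : bil κ v x = 0) (hw : bil κ w x = 0) : x = 0 := by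
  have hk : κ ≠ 0 := by rcases hκ with rfl | rfl <;> norm_num
  let M : Matrix (Fin 4) (Fin 4) ℝ := Matrix.of ![p, n, v, w]
  let D : Matrix (Fin 4) (Fin 4) ℝ := Matrix.diagonal ![κ, 1, 1, 1]
  have hbil : ∀ a b : E4, a ⬝ᵥ (D.mulVec b) = bil κ a b := by
    intro a b
    simp [D, dotProduct, Fin.sum_univ_succ, Matrix.mulVec_diagonal, bil]
    ring
  have hMD : M * D * M.transpose = D := by
    ext i j
    have : (M * D * M.transpose) i j = bil κ (![p, n, v, w] i) (![p, n, v, w] j) := by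
      rw [← hbil, Matrix.mul_assoc]
      simp only [M, Matrix.mul_apply, dotProduct, Matrix.mulVec, Matrix.transpose_apply,
        Matrix.of_apply]
    rw [this]
    fin_cases i <;> fin_cases j <;>
      simp [D, h.pp, h.pn, h.pv, h.pw, h.nn, h.nv, h.nw, h.vv, h.vw, h.ww,
        h.np, h.vp, h.wp, h.vn, h.wn, h.wv]
  have hD : D.det = κ := by simp [D, Fin.prod_univ_succ]
  have hM : M.det ≠ 0 := by
    intro h0
    have := congrArg Matrix.det hMD
    rw [Matrix.det_mul, Matrix.det_mul, h0, hD] at this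
    apply hk; rw [← this]; ring
  have h1 : D.mulVec x = 0 := by
    apply Matrix.eq_zero_of_mulVec_eq_zero hM
    funext i
    have : M.mulVec (D.mulVec x) i = bil κ (![p, n, v, w] i) x := hbil _ _
    rw [this]
    fin_cases i <;> simpa
  exact Matrix.eq_zero_of_mulVec_eq_zero (by rw [hD]; exact hk) h1

theorem ext (h : IsFrame κ p n v w) (hκ : κ = 1 ∨ κ = -1) {x y : E4}
    (hp : bil κ p x = bil κ p y) (hn : bil κ n x = bil κ n y) (hv : bil κ v x = bil κ v y)
    (hw : bil κ w x = bil κ w y) : x = y := by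
  rw [← sub_eq_zero]
  apply h.eq_zero hκ <;> rw [bil_sub_right, sub_eq_zero] <;> assumption

end IsFrame

/-! ### The space form -/

/-- Vectors orthogonal to a point of the quadric are spacelike. -/
theorem bil_self_pos {κ : ℝ} (hκ : κ = 1 ∨ κ = -1) {p x : E4} (hp : bil κ p p = κ)
    (hx : bil κ p x = 0) (h0 : x ≠ 0) : 0 < bil κ x x := by
  have hne : 0 < x 0 ^ 2 + x 1 ^ 2 + x 2 ^ 2 + x 3 ^ 2 := by
    by_contra hcon
    apply h0
    have e0 := sq_nonneg (x 0)
    have e1 := sq_nonneg (x 1)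
    have e2 := sq_nonneg (x 2)
    have e3 := sq_nonneg (x 3)
    apply E4_ext <;> simp only [Pi.zero_apply] <;> apply pow_eq_zero_iff (two_ne_zero) |>.1 <;>
      linarith
  rcases hκ with rfl | rfl
  · simp only [bil]; nlinarith
  · simp only [bil] at *
    -- Cauchy–Schwarz for the spatial parts; together with `p` timelike and `x ⊥ p` it excludes `⟨x,
    -- x⟩ ≤ 0`.
    have c : (p 1 * x 1 + p 2 * x 2 + p 3 * x 3) ^ 2 ≤
        (p 1 ^ 2 + p 2 ^ 2 + p 3 ^ 2) * (x 1 ^ 2 + x 2 ^ 2 + x 3 ^ 2) := by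
      nlinarith [sq_nonneg (p 1 * x 2 - p 2 * x 1), sq_nonneg (p 1 * x 3 - p 3 * x 1),
        sq_nonneg (p 2 * x 3 - p 3 * x 2)]
    have e : p 1 * x 1 + p 2 * x 2 + p 3 * x 3 = p 0 * x 0 := by linarith
    have e2 : p 1 ^ 2 + p 2 ^ 2 + p 3 ^ 2 = p 0 ^ 2 - 1 := by linarith
    rw [e, e2] at c
    have hX : 0 ≤ x 1 ^ 2 + x 2 ^ 2 + x 3 ^ 2 := by positivity
    have hp0 : 1 ≤ p 0 ^ 2 := by nlinarith [sq_nonneg (p 1), sq_nonneg (p 2), sq_nonneg (p 3)]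
    by_contra hcon
    have h1 : x 1 ^ 2 + x 2 ^ 2 + x 3 ^ 2 ≤ x 0 ^ 2 := by linarith
    have h2 : (p 0 ^ 2 - 1) * (x 1 ^ 2 + x 2 ^ 2 + x 3 ^ 2) ≤ (p 0 ^ 2 - 1) * x 0 ^ 2 :=
      mul_le_mul_of_nonneg_left h1 (by linarith)
    nlinarith

/-! ### The functions `c_κ`, `s_κ` and the geodesics they define. -/

theorem cK_one (r : ℝ) : cK 1 r = Real.cos r := by simp [cK]
theorem sK_one (r : ℝ) : sK 1 r = Real.sin r := by simp [sK]
theorem cK_neg_one (r : ℝ) : cK (-1) r = Real.cosh r := by simp [cK]; norm_num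
theorem sK_neg_one (r : ℝ) : sK (-1) r = Real.sinh r := by simp [sK]; norm_num
theorem cK_zero (κ : ℝ) : cK κ 0 = 1 := by simp [cK]
theorem sK_zero (κ : ℝ) : sK κ 0 = 0 := by simp [sK]

theorem cK_sq_add {κ : ℝ} (hκ : κ = 1 ∨ κ = -1) (r : ℝ) : cK κ r ^ 2 + κ * sK κ r ^ 2 = 1 := by
  rcases hκ with rfl | rfl
  · rw [cK_one, sK_one]; linarith [Real.sin_sq_add_cos_sq r]
  · rw [cK_neg_one, sK_neg_one]; linarith [Real.cosh_sq r]

theorem contDiff_cK (κ : ℝ) : ContDiff ℝ ∞ (cK κ) := by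
  by_cases h : κ = 1
  · have : cK κ = Real.cos := by funext r; simp [cK, h]
    rw [this]; exact Real.contDiff_cos
  · have : cK κ = Real.cosh := by funext r; simp [cK, h]
    rw [this]; exact Real.contDiff_cosh

theorem contDiff_sK (κ : ℝ) : ContDiff ℝ ∞ (sK κ) := by
  by_cases h : κ = 1
  · have : sK κ = Real.sin := by funext r; simp [sK, h]
    rw [this]; exact Real.contDiff_sin
  · have : sK κ = Real.sinh := by funext r; simp [sK, h]
    rw [this]; exact Real.contDiff_sinh

theorem geod_zero (κ : ℝ) (q : E4 × E4) : geod κ q 0 = q.1 := by simp [geod, cK_zero, sK_zero]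

theorem geodVel_zero (κ : ℝ) (q : E4 × E4) : geodVel κ q 0 = q.2 := by
  simp [geodVel, cK_zero, sK_zero]

/-- Geodesics starting in the space form stay there. -/
theorem geod_mem_spaceForm {κ : ℝ} (hκ : κ = 1 ∨ κ = -1) {p v : E4} (hp : p ∈ spaceForm κ)
    (hv : bil κ p v = 0) (hvv : bil κ v v = 1) (r : ℝ) :
    cK κ r • p + sK κ r • v ∈ spaceForm κ := by
  refine ⟨?_, ?_⟩
  · simp only [bil_add_left, bil_add_right, bil_smul_left, bil_smul_right, hp.1, hv, hvv,
      bil_comm κ v p]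
    rcases hκ with rfl | rfl
    · linear_combination cK_sq_add (Or.inl rfl) r
    · linear_combination -(cK_sq_add (Or.inr rfl) r : cK (-1) r ^ 2 + -1 * sK (-1) r ^ 2 = 1)
  · rintro rfl
    have h0 := hp.2 rfl
    have h1 := hp.1
    simp only [bil] at h1 hv hvv
    have c : (p 1 * v 1 + p 2 * v 2 + p 3 * v 3) ^ 2 ≤
        (p 1 ^ 2 + p 2 ^ 2 + p 3 ^ 2) * (v 1 ^ 2 + v 2 ^ 2 + v 3 ^ 2) := by
      nlinarith [sq_nonneg (p 1 * v 2 - p 2 * v 1), sq_nonneg (p 1 * v 3 - p 3 * v 1),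
        sq_nonneg (p 2 * v 3 - p 3 * v 2)]
    have e : p 1 * v 1 + p 2 * v 2 + p 3 * v 3 = p 0 * v 0 := by linarith
    have e2 : p 1 ^ 2 + p 2 ^ 2 + p 3 ^ 2 = p 0 ^ 2 - 1 := by linarith
    have e3 : v 1 ^ 2 + v 2 ^ 2 + v 3 ^ 2 = v 0 ^ 2 + 1 := by linarith
    rw [e, e2, e3] at c
    -- The geodesic stays on the upper sheet because both `|v₀| < p₀` and `|sinh r| < cosh r`, so
    -- the first term of `cosh r p₀ + sinh r v₀` dominates.
    have hlt : |v 0| < p 0 := abs_lt_of_sq_lt_sq (by nlinarith) h0.le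
    have hc : |Real.sinh r| < Real.cosh r :=
      abs_lt_of_sq_lt_sq (by linarith [Real.cosh_sq r]) (Real.cosh_pos r).le
    simp only [Pi.add_apply, Pi.smul_apply, smul_eq_mul, cK_neg_one, sK_neg_one]
    have h5 : |Real.sinh r * v 0| < Real.cosh r * p 0 := by
      rw [abs_mul]
      exact mul_lt_mul'' hc hlt (abs_nonneg _) (abs_nonneg _)
    linarith [(abs_lt.1 h5).1]

/-! ### Local defining functions of a surface -/

/-- `f` is a local defining function of the surface `S` near `p`, and `ν` is a smooth extension of
the unit normal field of `S` on the side on which `f` is positive. -/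
structure IsLocalSurface (κ : ℝ) (S : Set E4) (ν : E4 → E4) (f : E4 → ℝ) (p : E4) : Prop where
  mem_iff : ∀ᶠ x in 𝓝 p, x ∈ S ↔ x ∈ spaceForm κ ∧ f x = 0
  smooth : ∀ᶠ x in 𝓝 p, ContDiffAt ℝ ∞ f x
  smooth_normal : ∀ᶠ x in 𝓝 p, ContDiffAt ℝ ∞ ν x
  normal : ∀ᶠ x in 𝓝 p, x ∈ spaceForm κ → bil κ x (ν x) = 0 ∧ bil κ (ν x) (ν x) = 1 ∧
    ∃ l > 0, ∀ w, bil κ x w = 0 → fderiv ℝ f x w = l * bil κ (ν x) w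

theorem IsLocalSurface.neg {κ : ℝ} {S : Set E4} {ν : E4 → E4} {f : E4 → ℝ} {p : E4}
    (h : IsLocalSurface κ S ν f p) :
    IsLocalSurface κ S (fun x => -ν x) (fun x => -f x) p where
  mem_iff := by
    filter_upwards [h.mem_iff] with x hx
    rw [hx, neg_eq_zero]
  smooth := by
    filter_upwards [h.smooth] with x hx
    exact hx.neg
  smooth_normal := by
    filter_upwards [h.smooth_normal] with x hx
    exact hx.neg
  normal := by
    filter_upwards [h.normal] with x hx hxS
    obtain ⟨h1, h2, l, hl, h3⟩ := hx hxS
    refine ⟨by rw [bil_neg_right, h1, neg_zero], by rw [bil_neg_left, bil_neg_right, h2, neg_neg],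
      l, hl, fun w hw => ?_⟩
    rw [fderiv_fun_neg, bil_neg_left]
    simp [h3 w hw]

theorem IsLocalSurface.eventually {κ : ℝ} {S : Set E4} {ν : E4 → E4} {f : E4 → ℝ} {p : E4}
    (h : IsLocalSurface κ S ν f p) : ∀ᶠ x in 𝓝 p, IsLocalSurface κ S ν f x := by
  filter_upwards [h.mem_iff.eventually_nhds, h.smooth.eventually_nhds,
    h.smooth_normal.eventually_nhds, h.normal.eventually_nhds] with x h1 h2 h3 h4
  exact ⟨h1, h2, h3, h4⟩

theorem IsCompactSurface.exists_isLocalSurface {κ : ℝ} (hκ : κ = 1 ∨ κ = -1) {S : Set E4}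
    (hS : IsCompactSurface κ S) {p : E4} (hp : p ∈ S) :
    ∃ ν f, IsLocalSurface κ S ν f p := by
  have hk := kappa_sq hκ
  obtain ⟨V, f, hV, hpV, hf, ⟨w, hpw, hw⟩, hmem⟩ := hS.2.2.2 p hp
  have hVp : ∀ᶠ x in 𝓝 p, x ∈ V := hV.mem_nhds hpV
  have hfs : ∀ x ∈ V, ContDiffAt ℝ ∞ f x := fun x hx => hf.contDiffAt (hV.mem_nhds hx)
  -- `g` is the gradient of `f` for `bil κ` (the factor `κ` is `1 / κ`). Below, `G` is its component
  -- tangent to the quadric, and the normalization of `G` is the normal field, defined in a full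
  -- neighbourhood in `ℝ⁴`.
  let g : E4 → E4 := fun x i => (if i = 0 then κ else 1) * fderiv ℝ f x (Pi.single i 1)
  have hgb : ∀ x w, bil κ (g x) w = fderiv ℝ f x w := by
    intro x w
    have e : w = ∑ i, w i • (Pi.single i 1 : E4) := by
      conv_lhs => rw [pi_eq_sum_univ' w]
    rw [e, map_sum]
    simp only [map_smul, smul_eq_mul, ← e]
    simp [Fin.sum_univ_succ, bil, g]
    linear_combination (w 0 * fderiv ℝ f x (Pi.single 0 1)) * hk
  have hgs : ∀ x ∈ V, ContDiffAt ℝ ∞ g x := by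
    intro x hx
    refine contDiffAt_pi.2 fun i => contDiffAt_const.mul ?_
    exact ((hfs x hx).fderiv_right (m := ∞) (by simp)).clm_apply contDiffAt_const
  let G : E4 → E4 := fun x => g x - (κ * bil κ (g x) x) • x
  have hGs : ∀ x ∈ V, ContDiffAt ℝ ∞ G x := fun x hx =>
    (hgs x hx).sub ((contDiffAt_const.mul (ContDiffAt.bil (hgs x hx) contDiffAt_id)).smul
      contDiffAt_id)
  have hGw : ∀ x w, bil κ x w = 0 → bil κ (G x) w = fderiv ℝ f x w := by
    intro x w hx
    rw [bil_sub_left, bil_smul_left, hx, hgb, mul_zero, sub_zero]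
  have hGx : ∀ x ∈ spaceForm κ, bil κ x (G x) = 0 := by
    intro x hx
    rw [bil_sub_right, bil_smul_right, hx.1, bil_comm κ x]
    linear_combination -bil κ (g x) x * hk
  have hpS := hS.1 hp
  have hG0 : 0 < bil κ (G p) (G p) := by
    refine bil_self_pos hκ hpS.1 (hGx p hpS) fun h0 => hw ?_
    rw [← hGw p w hpw, h0, bil_zero_left]
  have hGpos : ∀ᶠ x in 𝓝 p, 0 < bil κ (G x) (G x) :=
    (ContDiffAt.bil (hGs p hpV) (hGs p hpV)).continuousAt.eventually (lt_mem_nhds hG0)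
  refine ⟨fun x => (√(bil κ (G x) (G x)))⁻¹ • G x, f, ?_, ?_, ?_, ?_⟩
  · filter_upwards [hVp] with x hx using hmem x hx
  · filter_upwards [hVp] with x hx using hfs x hx
  · filter_upwards [hVp, hGpos] with x hx hpos
    exact (((ContDiffAt.bil (hGs x hx) (hGs x hx)).sqrt hpos.ne').inv
      (Real.sqrt_pos.2 hpos).ne').smul (hGs x hx)
  · filter_upwards [hVp, hGpos] with x hx hpos hxS
    have hs := Real.sqrt_pos.2 hpos
    refine ⟨by rw [bil_smul_right, hGx x hxS, mul_zero], ?_, _, hs, ?_⟩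
    · rw [bil_smul_left, bil_smul_right, ← mul_assoc, ← mul_inv, Real.mul_self_sqrt hpos.le,
        inv_mul_cancel₀ hpos.ne']
    · intro w hw
      rw [bil_smul_left, hGw x w hw, mul_inv_cancel_left₀ hs.ne']

/-- A chart of a surface around one of its points, as the restriction of a local diffeomorphism of
`ℝ⁴` to a plane. -/
theorem IsLocalSurface.exists_chart {κ : ℝ} (hκ : κ = 1 ∨ κ = -1) {S : Set E4} {ν : E4 → E4}
    {f : E4 → ℝ} {p : E4} (h : IsLocalSurface κ S ν f p) (hS : S ⊆ spaceForm κ) (hp : p ∈ S) :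
    ∃ Ψ Φ : E4 → E4, (∀ᶠ w in 𝓝 0, ContDiffAt ℝ ∞ Ψ w) ∧ HasFDerivAt Ψ (ContinuousLinearMap.id ℝ E4) 0 ∧
      ContinuousAt Φ p ∧ Φ p = 0 ∧ Ψ 0 = p ∧
      (∀ᶠ w in 𝓝 0, bil κ p w = 0 → bil κ (ν p) w = 0 → Ψ w ∈ S) ∧
      (∀ᶠ x in 𝓝 p, Ψ (Φ x) = x ∧ (x ∈ S → bil κ p (Φ x) = 0 ∧ bil κ (ν p) (Φ x) = 0)) ∧
      ∀ᶠ w in 𝓝 0, Φ (Ψ w) = w := by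
  have hk := kappa_sq hκ
  have hpM := hS hp
  obtain ⟨pn, nn, l, hl, hdf⟩ := h.normal.self_of_nhds hpM
  have hfp := h.smooth.self_of_nhds
  set n := ν p with hn
  have np : bil κ n p = 0 := by rw [bil_comm, pn]
  -- `h1` cuts out the quadric and `h2` the surface inside it. They are scaled and combined so that
  -- their differentials at `p` are `⟨p, ·⟩` and `⟨n, ·⟩`. Hence replacing the `p` and `n`
  -- components of `x` by `h1 x` and `h2 x` gives a map `Φ` with `dΦ_p = id` that sends `S` into the
  -- plane orthogonal to `p` and `n`.
  let h1 : E4 → ℝ := fun x => (bil κ x x - κ) / 2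
  let h2 : E4 → ℝ := fun x => f x / l - (κ * fderiv ℝ f p p / l) * h1 x
  let Φ : E4 → E4 := fun x =>
    x - (κ * bil κ p x) • p - bil κ n x • n + (κ * h1 x) • p + h2 x • n
  have hf0 : f p = 0 := (h.mem_iff.self_of_nhds.1 hp).2
  have h1p : h1 p = 0 := by simp [h1, hpM.1]
  have h2p : h2 p = 0 := by simp [h2, h1p, hf0]
  have hΦp : Φ p = 0 := by
    simp only [Φ, h1p, h2p, hpM.1, np, hk]; simp
  have hdiv : ∀ (g : E4 → ℝ) (c : ℝ) (x : E4), ContDiffAt ℝ ∞ g x →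
      ContDiffAt ℝ ∞ (fun x => g x / c) x := fun g c x hg => by simpa only [div_eq_mul_inv] using hg.mul contDiffAt_const
  have h1s : ∀ x, ContDiffAt ℝ ∞ h1 x := fun x =>
    hdiv _ _ _ ((ContDiffAt.bil contDiffAt_id contDiffAt_id).sub contDiffAt_const)
  have h2s : ∀ x, ContDiffAt ℝ ∞ f x → ContDiffAt ℝ ∞ h2 x := fun x hx =>
    (hdiv _ _ _ hx).sub (contDiffAt_const.mul (h1s x))
  have hΦx : ∀ x, ContDiffAt ℝ ∞ f x → ContDiffAt ℝ ∞ Φ x := fun x hx =>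
    ((((contDiffAt_id.sub ((contDiffAt_const.mul
      (ContDiffAt.bil contDiffAt_const contDiffAt_id)).smul contDiffAt_const)).sub
      ((ContDiffAt.bil contDiffAt_const contDiffAt_id).smul contDiffAt_const)).add
      ((contDiffAt_const.mul (h1s x)).smul contDiffAt_const))).add ((h2s x hx).smul contDiffAt_const)
  have hΦs : ContDiffAt ℝ ∞ Φ p := hΦx p hfp
  have hdΦ : HasFDerivAt Φ ((ContinuousLinearEquiv.refl ℝ E4 : E4 ≃L[ℝ] E4) : E4 →L[ℝ] E4) p := by
    have hd := (hΦs.differentiableAt (by simp)).hasFDerivAt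
    suffices he : fderiv ℝ Φ p = ContinuousLinearMap.id ℝ E4 by rw [he] at hd; exact hd
    ext1 w
    have hline : HasDerivAt (fun s : ℝ => p + s • w) w 0 := by
      simpa using ((hasDerivAt_id (0 : ℝ)).smul_const w).const_add p
    have e0 : p + (0 : ℝ) • w = p := by simp
    have hA : HasDerivAt (fun s : ℝ => Φ (p + s • w)) (fderiv ℝ Φ p w) 0 := by
      rw [← e0] at hd
      have := hd.comp_hasDerivAt (0 : ℝ) hline
      rwa [e0] at this
    have hf' : HasDerivAt (fun s : ℝ => f (p + s • w)) (fderiv ℝ f p w) 0 := by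
      have hd := (hfp.differentiableAt (by simp)).hasFDerivAt
      rw [← e0] at hd
      have := hd.comp_hasDerivAt (0 : ℝ) hline
      rwa [e0] at this
    have hb := fun a => hasDerivAt_bil (κ := κ) (hasDerivAt_const (0 : ℝ) a) hline
    have h1' : HasDerivAt (fun s : ℝ => h1 (p + s • w)) (bil κ p w) 0 := by
      refine (((hasDerivAt_bil (κ := κ) hline hline).sub_const κ).div_const 2).congr_deriv ?_
      rw [e0, bil_comm κ w p]; ring
    have h2' := (hf'.div_const l).sub (h1'.const_mul (κ * fderiv ℝ f p p / l))
    have hB := ((((hline.sub (((hb p).const_mul κ).smul_const p)).sub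
      ((hb n).smul_const n)).add ((h1'.const_mul κ).smul_const p))).add (h2'.smul_const n)
    rw [hA.unique hB]
    have hw : fderiv ℝ f p w = l * bil κ n w + κ * bil κ p w * fderiv ℝ f p p := by
      have e : w = (w - (κ * bil κ p w) • p) + (κ * bil κ p w) • p := by simp
      conv_lhs => rw [e]
      rw [map_add, map_smul, smul_eq_mul, hdf, bil_sub_right, bil_smul_right, np]
      · ring
      · rw [bil_sub_right, bil_smul_right, hpM.1]
        linear_combination -bil κ p w * hk
    have hc : fderiv ℝ f p w / l - κ * fderiv ℝ f p p / l * bil κ p w = bil κ n w := by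
      rw [hw]; field_simp; ring
    rw [hc]
    funext i
    simp [bil_zero_left]
    ring
  have hinf : (∞ : WithTop ℕ∞) ≠ 0 := by simp
  have hst := hΦs.hasStrictFDerivAt' hdΦ hinf
  let Ψ := hΦs.localInverse hdΦ hinf
  have hΨ0 : Ψ 0 = p := by
    have := hΦs.localInverse_apply_image hdΦ hinf
    rwa [hΦp] at this
  have hΨc : Tendsto Ψ (𝓝 0) (𝓝 p) := by
    have := (hΦs.to_localInverse hdΦ hinf).continuousAt.tendsto
    rwa [hΦs.localInverse_apply_image hdΦ hinf, hΦp] at this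
  -- Smoothness is needed near `0`, not only at `0`: invertibility of `dΦ` is an open condition, so
  -- the inverse function theorem applies at all nearby points.
  have hΨs : ∀ᶠ w in 𝓝 0, ContDiffAt ℝ ∞ Ψ w := by
    have hc : ContinuousAt (fderiv ℝ Φ) p :=
      (hΦs.fderiv_right (m := ∞) (by simp)).continuousAt
    have hinv := hc.tendsto.eventually
      (by rw [hdΦ.fderiv]; exact ContinuousLinearEquiv.nhds (ContinuousLinearEquiv.refl ℝ E4))
    have ht := (hΦs.toOpenPartialHomeomorph Φ hdΦ hinf).open_target.mem_nhds
      (hΦs.image_mem_toOpenPartialHomeomorph_target hdΦ hinf)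
    rw [hΦp] at ht
    filter_upwards [hΨc.eventually h.smooth, hΨc.eventually hinv, ht] with w hw ⟨e, he⟩ hwt
    have hwΦ := hΦx _ hw
    refine (hΦs.toOpenPartialHomeomorph Φ hdΦ hinf).contDiffAt_symm (f₀' := e) hwt ?_ hwΦ
    rw [he]
    exact (hwΦ.differentiableAt (by simp)).hasFDerivAt
  have hright : ∀ᶠ w in 𝓝 0, Φ (Ψ w) = w := by
    have := hst.eventually_right_inverse
    rwa [hΦp] at this
  have hpΦ : ∀ x, bil κ p (Φ x) = h1 x := by
    intro x
    simp only [Φ, bil_add_right, bil_sub_right, bil_smul_right, hpM.1, pn]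
    linear_combination (h1 x - bil κ p x) * hk
  have hnΦ : ∀ x, bil κ n (Φ x) = h2 x := by
    intro x
    simp only [Φ, bil_add_right, bil_sub_right, bil_smul_right, np, nn]
    ring
  refine ⟨Ψ, Φ, hΨs, ?_, hΦs.continuousAt, hΦp, hΨ0, ?_, ?_, hright⟩
  · have := hst.to_localInverse
    rw [hΦp] at this
    exact this.hasFDerivAt
  · have hsgn : ∀ᶠ x : E4 in 𝓝 p, κ = -1 → 0 < x 0 := by
      by_cases hm : κ = -1
      · filter_upwards [(continuous_apply 0).continuousAt.eventually (lt_mem_nhds (hpM.2 hm))]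
          with x hx _ using hx
      · exact Eventually.of_forall fun x hx => absurd hx hm
    filter_upwards [hright, hΨc.eventually h.mem_iff, hΨc.eventually hsgn] with w hw hm hs hpw hnw
    have e1 : h1 (Ψ w) = 0 := by rw [← hpΦ, hw, hpw]
    have e2 : h2 (Ψ w) = 0 := by rw [← hnΦ, hw, hnw]
    refine hm.2 ⟨⟨?_, hs⟩, ?_⟩
    · simp only [h1] at e1; linarith
    · simp only [h2, e1, mul_zero, sub_zero, div_eq_zero_iff, hl.ne', or_false] at e2
      exact e2
  · filter_upwards [hst.eventually_left_inverse, h.mem_iff] with x hx hm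
    refine ⟨hx, fun hxS => ?_⟩
    obtain ⟨hx1, hx2⟩ := hm.1 hxS
    have e1 : h1 x = 0 := by simp [h1, hx1.1]
    rw [hpΦ, hnΦ]
    refine ⟨e1, ?_⟩
    simp [h2, e1, hx2]

/-- The chart carries the line `s ↦ s • w` of the tangent plane to a curve in `S`, with the same
velocity since the chart has identity differential at `0`. -/
theorem IsLocalSurface.exists_curve {κ : ℝ} (hκ : κ = 1 ∨ κ = -1) {S : Set E4} {ν : E4 → E4}
    {f : E4 → ℝ} {p : E4} (h : IsLocalSurface κ S ν f p) (hS : S ⊆ spaceForm κ) (hp : p ∈ S)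
    {w : E4} (hpw : bil κ p w = 0) (hnw : bil κ (ν p) w = 0) :
    ∃ σ, IsCurveIn S p σ ∧ HasDerivAt σ w 0 := by
  obtain ⟨Ψ, Φ, hs, hd, -, -, h0, hmem, -, -⟩ := h.exists_chart hκ hS hp
  have hl : Tendsto (fun s : ℝ => s • w) (𝓝 0) (𝓝 0) := by
    have : Continuous (fun s : ℝ => s • w) := by fun_prop
    simpa using this.tendsto 0
  refine ⟨fun s => Ψ (s • w), ⟨?_, by simp [h0]⟩, ?_⟩
  · filter_upwards [hl.eventually hmem, hl.eventually hs] with s h1 h2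
    refine ⟨?_, h1 (by rw [bil_smul_right, hpw, mul_zero]) (by rw [bil_smul_right, hnw, mul_zero])⟩
    exact h2.comp s (by fun_prop)
  · have hline : HasDerivAt (fun s : ℝ => s • w) w 0 := by
      simpa using (hasDerivAt_id (0 : ℝ)).smul_const w
    have e0 : (0 : ℝ) • w = 0 := zero_smul ℝ w
    rw [← e0] at hd
    exact hd.comp_hasDerivAt (0 : ℝ) hline

theorem IsCurveIn.hasDerivAt {S : Set E4} {p : E4} {σ : ℝ → E4} (h : IsCurveIn S p σ) :
    HasDerivAt σ (deriv σ 0) 0 :=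
  (h.1.self_of_nhds.1.differentiableAt (by simp)).hasDerivAt

/-- The velocity of a curve in the space form is orthogonal to the foot point. -/
theorem bil_deriv_eq_zero {κ : ℝ} {σ : ℝ → E4} {w : E4} {s : ℝ}
    (h : ∀ᶠ t in 𝓝 s, σ t ∈ spaceForm κ) (hd : HasDerivAt σ w s) : bil κ (σ s) w = 0 := by
  have h1 := hasDerivAt_bil (κ := κ) hd hd
  have h2 : HasDerivAt (fun t => bil κ (σ t) (σ t)) 0 s :=
    (hasDerivAt_const s κ).congr_of_eventuallyEq (h.mono fun t ht => ht.1)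
  have := h1.unique h2
  rw [bil_comm κ w] at this
  linarith

/-- One direction differentiates the two equations of `S` along a curve, the other is
`exists_curve`. From here on tangent planes are handled by linear equations. -/
theorem IsLocalSurface.mem_tangentPlane_iff {κ : ℝ} (hκ : κ = 1 ∨ κ = -1) {S : Set E4}
    {ν : E4 → E4} {f : E4 → ℝ} {p : E4} (h : IsLocalSurface κ S ν f p) (hS : S ⊆ spaceForm κ)
    (hp : p ∈ S) (w : E4) :
    w ∈ tangentPlane S p ↔ bil κ p w = 0 ∧ bil κ (ν p) w = 0 := by
  constructor
  · rintro ⟨σ, hσ, rfl⟩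
    have hd := hσ.hasDerivAt
    have hpw : bil κ p (deriv σ 0) = 0 := by
      have := bil_deriv_eq_zero (κ := κ) (hσ.1.mono fun s hs => hS hs.2) hd
      rwa [hσ.2] at this
    refine ⟨hpw, ?_⟩
    obtain ⟨-, -, l, hl, hdf⟩ := h.normal.self_of_nhds (hS hp)
    have hf := (h.smooth.self_of_nhds.differentiableAt (by simp)).hasFDerivAt
    rw [← hσ.2] at hf
    have h1 := hf.comp_hasDerivAt (0 : ℝ) hd
    have hc : Tendsto σ (𝓝 0) (𝓝 p) := by
      have := hd.continuousAt.tendsto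
      rwa [hσ.2] at this
    have h2 : HasDerivAt (f ∘ σ) 0 0 :=
      (hasDerivAt_const (0 : ℝ) (0 : ℝ)).congr_of_eventuallyEq (by
        filter_upwards [hσ.1, hc.eventually h.mem_iff] with s hs hm
        exact (hm.1 hs.2).2)
    have := h1.unique h2
    rw [hσ.2, hdf _ hpw] at this
    exact (mul_eq_zero.1 this).resolve_left hl.ne'
  · rintro ⟨h1, h2⟩
    obtain ⟨σ, hσ, hd⟩ := h.exists_curve hκ hS hp h1 h2
    exact ⟨σ, hσ, hd.deriv⟩

/-! ### The inward normal field -/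

/-- Two linear conditions on `ℝ⁴`, padded with zero rows to a singular square matrix, have a common
nonzero solution; orthogonality to `p` makes it spacelike. -/
theorem exists_unit_orthogonal {κ : ℝ} (hκ : κ = 1 ∨ κ = -1) {p : E4} (hp : bil κ p p = κ)
    (n : E4) : ∃ v, bil κ p v = 0 ∧ bil κ n v = 0 ∧ bil κ v v = 1 := by
  let D : E4 → E4 := fun x => ![κ * x 0, x 1, x 2, x 3]
  let M : Matrix (Fin 4) (Fin 4) ℝ := Matrix.of ![D p, D n, 0, 0]
  have hM : M.det = 0 := Matrix.det_eq_zero_of_row_eq_zero 3 (by intro j; simp [M])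
  obtain ⟨x, hx0, hx⟩ := Matrix.exists_mulVec_eq_zero_iff.2 hM
  have hb : ∀ a, D a ⬝ᵥ x = bil κ a x := by
    intro a
    simp [D, dotProduct, Fin.sum_univ_succ, bil]
    ring
  have h0 : bil κ p x = 0 := by
    rw [← hb]; exact congrFun hx 0
  have h1 : bil κ n x = 0 := by
    rw [← hb]; exact congrFun hx 1
  have hpos := bil_self_pos hκ hp h0 hx0
  refine ⟨(√(bil κ x x))⁻¹ • x, by rw [bil_smul_right, h0, mul_zero],
    by rw [bil_smul_right, h1, mul_zero], ?_⟩
  rw [bil_smul_left, bil_smul_right, ← mul_assoc, ← mul_inv, Real.mul_self_sqrt hpos.le,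
    inv_mul_cancel₀ hpos.ne']

/-- Points of hyperbolic space have negative Lorentzian product. -/
theorem bil_neg_of_mem_spaceForm {p x : E4} (hp : p ∈ spaceForm (-1)) (hx : x ∈ spaceForm (-1)) :
    bil (-1) p x < 0 := by
  have hp0 := hp.2 rfl
  have hx0 := hx.2 rfl
  have h1 := hp.1
  have h2 := hx.1
  simp only [bil] at *
  have c : (p 1 * x 1 + p 2 * x 2 + p 3 * x 3) ^ 2 ≤
      (p 1 ^ 2 + p 2 ^ 2 + p 3 ^ 2) * (x 1 ^ 2 + x 2 ^ 2 + x 3 ^ 2) := by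
    nlinarith [sq_nonneg (p 1 * x 2 - p 2 * x 1), sq_nonneg (p 1 * x 3 - p 3 * x 1),
      sq_nonneg (p 2 * x 3 - p 3 * x 2)]
  have e2 : p 1 ^ 2 + p 2 ^ 2 + p 3 ^ 2 = p 0 ^ 2 - 1 := by linarith
  have e3 : x 1 ^ 2 + x 2 ^ 2 + x 3 ^ 2 = x 0 ^ 2 - 1 := by linarith
  rw [e2, e3] at c
  have hp1 : 1 ≤ p 0 ^ 2 := by nlinarith [sq_nonneg (p 1), sq_nonneg (p 2), sq_nonneg (p 3)]
  have hx1 : 1 ≤ x 0 ^ 2 := by nlinarith [sq_nonneg (x 1), sq_nonneg (x 2), sq_nonneg (x 3)]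
  have : |p 1 * x 1 + p 2 * x 2 + p 3 * x 3| < p 0 * x 0 :=
    abs_lt_of_sq_lt_sq (by nlinarith) (by positivity)
  linarith [(abs_lt.1 this).2]

theorem exists_cK_sK {κ α β : ℝ} (hκ : κ = 1 ∨ κ = -1) (h : α ^ 2 + κ * β ^ 2 = 1) (hβ : 0 ≤ β)
    (hα : κ = -1 → 0 < α) : ∃ t, cK κ t = α ∧ sK κ t = β := by
  rcases hκ with rfl | rfl
  · refine ⟨Real.arccos α, ?_, ?_⟩
    · rw [cK_one, Real.cos_arccos] <;> nlinarith
    · rw [sK_one, Real.sin_arccos, show 1 - α ^ 2 = β ^ 2 by linarith, Real.sqrt_sq hβ]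
  · refine ⟨Real.arsinh β, ?_, ?_⟩
    · rw [cK_neg_one, Real.cosh_arsinh, show 1 + β ^ 2 = α ^ 2 by linarith,
        Real.sqrt_sq (hα rfl).le]
    · rw [sK_neg_one, Real.sinh_arsinh]

/-- A point of a strictly convex surface on the totally geodesic surface orthogonal to `n` at `p`
is equal to `p`. -/
theorem StrictlyConvex.eq_of_bil_eq_zero {κ : ℝ} (hκ : κ = 1 ∨ κ = -1) {S : Set E4}
    (hconv : StrictlyConvex κ S) (hS : S ⊆ spaceForm κ) {p n : E4} (hp : p ∈ S)
    (pn : bil κ p n = 0)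
    (hT : ∀ w, bil κ p w = 0 → bil κ n w = 0 → w ∈ tangentPlane S p) {x : E4} (hx : x ∈ S)
    (hnx : bil κ n x = 0) : x = p := by
  have hk := kappa_sq hκ
  have hpM := hS hp
  have hxM := hS hx
  suffices hmem : x ∈ tangentGeodesicSurface κ S p by
    have : x ∈ ({p} : Set E4) := hconv p hp ▸ ⟨hx, hmem⟩
    exact this
  -- Split `x = α p + y` with `y` tangent to `S` at `p`; the equation of the quadric becomes `α² + κ
  -- ⟨y, y⟩ = 1`, so `α` and `|y|` are values `c_κ t`, `s_κ t`.
  set α := κ * bil κ p x with hα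
  set y := x - α • p with hy
  have hpy : bil κ p y = 0 := by
    rw [hy, bil_sub_right, bil_smul_right, hpM.1, hα]
    linear_combination -bil κ p x * hk
  have hny : bil κ n y = 0 := by
    rw [hy, bil_sub_right, bil_smul_right, hnx, bil_comm κ n, pn]; ring
  have hyy : α ^ 2 + κ * bil κ y y = 1 := by
    have e : x = α • p + y := by simp [hy]
    have h1 := hxM.1
    rw [e, bil_add_left, bil_add_right, bil_add_right, bil_smul_left, bil_smul_left,
      bil_smul_right, bil_smul_right, hpM.1, bil_comm κ y p, hpy] at h1
    linear_combination κ * h1 + (1 - α ^ 2) * hk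
  have hα0 : κ = -1 → 0 < α := by
    rintro rfl
    have := bil_neg_of_mem_spaceForm hpM hxM
    rw [hα]; linarith
  -- For `y = 0` any unit tangent direction serves.
  obtain ⟨v, hv, hvv, e⟩ : ∃ v, (bil κ p v = 0 ∧ bil κ n v = 0) ∧ bil κ v v = 1 ∧
      y = √(bil κ y y) • v := by
    by_cases h0 : y = 0
    · obtain ⟨v, h1, h2, h3⟩ := exists_unit_orthogonal hκ hpM.1 n
      exact ⟨v, ⟨h1, h2⟩, h3, by simp [h0, bil_zero_left]⟩
    · have hpos := bil_self_pos hκ hpM.1 hpy h0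
      refine ⟨(√(bil κ y y))⁻¹ • y, ⟨by rw [bil_smul_right, hpy, mul_zero],
        by rw [bil_smul_right, hny, mul_zero]⟩, ?_, ?_⟩
      · rw [bil_smul_left, bil_smul_right, ← mul_assoc, ← mul_inv, Real.mul_self_sqrt hpos.le,
          inv_mul_cancel₀ hpos.ne']
      · rw [smul_inv_smul₀ (Real.sqrt_pos.2 hpos).ne']
  have hyy0 : 0 ≤ bil κ y y := by
    by_cases h0 : y = 0
    · rw [h0, bil_zero_left]
    · exact (bil_self_pos hκ hpM.1 hpy h0).le
  obtain ⟨t, ht1, ht2⟩ := exists_cK_sK (κ := κ) (α := α) (β := √(bil κ y y)) hκ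
    (by rw [Real.sq_sqrt hyy0]; exact hyy) (Real.sqrt_nonneg _) hα0
  refine ⟨v, hT v hv.1 hv.2, hvv, t, ?_⟩
  rw [geod, ht1, ht2, ← e, hy]
  simp

/-- The surface `S` lies on one side of each of its tangent totally geodesic surfaces. -/
theorem IsLocalSurface.one_side {κ : ℝ} (hκ : κ = 1 ∨ κ = -1) {S : Set E4} {ν : E4 → E4}
    {f : E4 → ℝ} {p : E4} (h : IsLocalSurface κ S ν f p) (hS : IsCompactSurface κ S)
    (hconv : StrictlyConvex κ S) (hp : p ∈ S) :
    (∃ y ∈ S, bil κ (ν p) y ≠ 0) ∧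
    ((∀ x ∈ S, 0 ≤ bil κ (ν p) x) ∨ ∀ x ∈ S, bil κ (ν p) x ≤ 0) := by
  have hpM := hS.1 hp
  obtain ⟨Ψ, Φ, hs, -, hΦc, hΦp, h0, hmem, hleft, hright⟩ := h.exists_chart hκ hS.1 hp
  obtain ⟨pn, nn, -⟩ := h.normal.self_of_nhds hpM
  have hzero : ∀ x ∈ S, bil κ (ν p) x = 0 → x = p := fun x hx hnx =>
    hconv.eq_of_bil_eq_zero hκ hS.1 hp pn
      (fun w h1 h2 => (h.mem_tangentPlane_iff hκ hS.1 hp w).2 ⟨h1, h2⟩) hx hnx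
  set n := ν p with hn
  obtain ⟨v, pv, nv, vv⟩ := exists_unit_orthogonal hκ hpM.1 n
  have F := isFrame_cross hκ hpM.1 pn pv nn nv vv
  set w := cross κ p n v with hw
  obtain ⟨ε, hε, hball⟩ := Metric.eventually_nhds_iff.1
    (hmem.and (hright.and (hs.mono fun x hx => hx.continuousAt)))
  set C := ‖v‖ + ‖w‖ + 1 with hC
  have hC0 : 0 < C := by positivity
  -- Polar coordinates on the tangent plane: the punctured disc is the image of the connected set
  -- `(0, ε / C) × ℝ`. The constant `C` converts the radius into a bound for the norm of `ℝ⁴`.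
  let L : ℝ × ℝ → E4 := fun q => q.1 • (Real.cos q.2 • v + Real.sin q.2 • w)
  have hLc : Continuous L := by fun_prop
  have hLn : ∀ q : ℝ × ℝ, q ∈ Ioo 0 (ε / C) ×ˢ (univ : Set ℝ) → dist (L q) 0 < ε := by
    rintro ⟨r, θ⟩ ⟨⟨hr0, hr1⟩, -⟩
    simp only [L, dist_zero_right, norm_smul, Real.norm_eq_abs, abs_of_pos hr0]
    have : ‖Real.cos θ • v + Real.sin θ • w‖ ≤ ‖v‖ + ‖w‖ := by
      refine (norm_add_le _ _).trans (add_le_add ?_ ?_)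
      · rw [norm_smul]
        exact mul_le_of_le_one_left (norm_nonneg _) (Real.abs_cos_le_one θ)
      · rw [norm_smul]
        exact mul_le_of_le_one_left (norm_nonneg _) (Real.abs_sin_le_one θ)
    calc r * ‖Real.cos θ • v + Real.sin θ • w‖ ≤ r * C := by
          apply mul_le_mul_of_nonneg_left _ hr0.le
          linarith
      _ < ε / C * C := mul_lt_mul_of_pos_right hr1 hC0
      _ = ε := div_mul_cancel₀ _ hC0.ne'
  have hLp : ∀ q, bil κ p (L q) = 0 := by
    intro q; simp [L, bil_smul_right, bil_add_right, F.pv, F.pw]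
  have hLn' : ∀ q, bil κ n (L q) = 0 := by
    intro q; simp [L, bil_smul_right, bil_add_right, F.nv, F.nw]
  have hLL : ∀ q, bil κ (L q) (L q) = q.1 ^ 2 := by
    intro q
    simp only [L, bil_smul_right, bil_add_right, bil_smul_left, bil_add_left, F.vv, F.vw, F.wv,
      F.ww]
    linear_combination q.1 ^ 2 * Real.cos_sq_add_sin_sq q.2
  set Q : Set (ℝ × ℝ) := Ioo 0 (ε / C) ×ˢ (univ : Set ℝ) with hQ
  set A : Set E4 := (fun q => Ψ (L q)) '' Q with hA
  have hQc : IsPreconnected Q := isPreconnected_Ioo.prod isPreconnected_univ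
  have hAc : IsPreconnected A := by
    refine hQc.image _ fun q hq => ContinuousAt.continuousWithinAt ?_
    exact ContinuousAt.comp (f := L) (g := Ψ) (hball (hLn q hq)).2.2 hLc.continuousAt
  -- On the punctured neighbourhood `A` of `p` in `S`, strict convexity forbids zeros of `⟨n, ·⟩`;
  -- as `A` is connected, the sign there is constant.
  have hAS : ∀ x ∈ A, x ∈ S ∧ bil κ n x ≠ 0 := by
    rintro x ⟨q, hq, rfl⟩
    obtain ⟨h1, h2, -⟩ := hball (hLn q hq)
    have hxS := h1 (hLp q) (hLn' q)
    refine ⟨hxS, fun hx0 => ?_⟩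
    have h3 := hzero _ hxS hx0
    rw [h3, hΦp] at h2
    have := hLL q
    rw [← h2, bil_zero_left] at this
    exact (pow_pos hq.1.1 2).ne this
  -- The polar coordinates of a nearby point are the modulus and argument of the complex number
  -- formed by its `v` and `w` coordinates in the chart.
  have hnbhd : ∀ᶠ x in 𝓝 p, x ∈ S → x ≠ p → x ∈ A := by
    have hΦ2 : Tendsto (fun x => √(bil κ (Φ x) (Φ x))) (𝓝 p) (𝓝 0) := by
      have hc : Continuous (fun y : E4 => √(bil κ y y)) := by unfold bil; fun_prop
      have := (hc.tendsto 0).comp (hΦp ▸ hΦc.tendsto)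
      simpa [bil_zero_left, Function.comp_def] using this
    filter_upwards [hleft, hΦ2.eventually (gt_mem_nhds (div_pos hε hC0))] with x hx hr hxS hxp
    obtain ⟨hx1, hx2⟩ := hx
    obtain ⟨h1, h2⟩ := hx2 hxS
    have hne : Φ x ≠ 0 := fun hz => hxp (by rw [← hx1, hz, h0])
    have hpos := bil_self_pos hκ hpM.1 h1 hne
    let z : ℂ := ⟨bil κ v (Φ x), bil κ w (Φ x)⟩
    have hΦx : Φ x = bil κ v (Φ x) • v + bil κ w (Φ x) • w := by
      apply F.ext hκ <;>
        simp [bil_add_right, bil_smul_right, F.pv, F.pw, F.nv, F.nw, F.vv, F.vw, F.wv, F.ww, h1, h2]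
    have hz : ‖z‖ = √(bil κ (Φ x) (Φ x)) := by
      rw [Complex.norm_def, Complex.normSq_apply]
      congr 1
      conv_rhs => rw [hΦx]
      simp only [z, bil_add_left, bil_add_right, bil_smul_right, bil_smul_left, F.vv, F.vw,
        F.wv, F.ww]
      ring
    refine ⟨(‖z‖, z.arg), ⟨⟨?_, ?_⟩, mem_univ _⟩, ?_⟩
    · change 0 < ‖z‖
      rw [hz]; exact Real.sqrt_pos.2 hpos
    · change ‖z‖ < _
      rw [hz]; exact hr
    · have : L (‖z‖, z.arg) = Φ x := by
        simp only [L, smul_add, smul_smul, Complex.norm_mul_cos_arg, Complex.norm_mul_sin_arg]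
        exact hΦx.symm
      simp only [this, hx1]
  have hgc := continuous_bil κ n
  -- If `⟨m, ·⟩` is positive on `S` near `p` except at `p`, the open sets `{⟨m, ·⟩ < 0}` and `{⟨m,
  -- ·⟩ > 0} ∪ W`, with `W` a small neighbourhood of `p`, cover `S` and are disjoint on it.
  -- Connectedness leaves no room for negative values. It is applied to `n` and to `-n`.
  have main : ∀ m : E4, (∀ x ∈ S, bil κ m x = 0 → x = p) → (∀ x ∈ A, 0 < bil κ m x) →
      bil κ m p = 0 → ∀ x ∈ S, 0 ≤ bil κ m x := by
    intro m hm hmA hmp x hx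
    by_contra hneg
    push Not at hneg
    obtain ⟨W, hWsub, hWo, hpW⟩ := eventually_nhds_iff.1 hnbhd
    have hmc := continuous_bil κ m
    obtain ⟨y, hyS, hy1, hy2⟩ := hS.2.2.1.isPreconnected {y | bil κ m y < 0}
      ({y | 0 < bil κ m y} ∪ W) (isOpen_lt hmc continuous_const)
      ((isOpen_lt continuous_const hmc).union hWo)
      (by
        intro y hy
        rcases lt_trichotomy (bil κ m y) 0 with h1 | h1 | h1
        · exact Or.inl h1
        · right; right; rw [hm y hy h1]; exact hpW
        · exact Or.inr (Or.inl h1))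
      ⟨x, hx, hneg⟩ ⟨p, hp, Or.inr hpW⟩
    have hy1' : bil κ m y < 0 := hy1
    rcases hy2 with hy2 | hy2
    · exact lt_asymm hy1' hy2
    · by_cases hyp : y = p
      · rw [hyp, hmp] at hy1'; exact lt_irrefl _ hy1'
      · exact lt_asymm hy1' (hmA y (hWsub y hy2 hyS hyp))
  have np : bil κ n p = 0 := F.np
  have hane : ∃ a, a ∈ A := ⟨_, (ε / C / 2, 0), ⟨⟨half_pos (div_pos hε hC0), half_lt_self (div_pos hε hC0)⟩,
    mem_univ _⟩, rfl⟩
  obtain ⟨a, ha⟩ := hane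
  refine ⟨⟨a, hAS a ha⟩, ?_⟩
  have hpre := hAc.image _ hgc.continuousOn
  rcases lt_or_gt_of_ne (hAS a ha).2 with hlt | hgt
  · right
    have := main (-n) (fun x hx hx0 => hzero x hx (by rwa [bil_neg_left, neg_eq_zero] at hx0))
      (fun x hx => by
        rw [bil_neg_left, neg_pos]
        by_contra hcon
        push Not at hcon
        obtain ⟨y, hy, hy0⟩ := hpre.Icc_subset ⟨a, ha, rfl⟩ ⟨x, hx, rfl⟩ ⟨hlt.le, hcon⟩
        exact (hAS y hy).2 hy0)
      (by rw [bil_neg_left, np, neg_zero])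
    intro x hx
    have := this x hx
    rw [bil_neg_left] at this
    linarith
  · left
    refine main n hzero (fun x hx => ?_) np
    by_contra hcon
    push Not at hcon
    obtain ⟨y, hy, hy0⟩ := hpre.Icc_subset ⟨x, hx, rfl⟩ ⟨a, ha, rfl⟩ ⟨hcon, hgt.le⟩
    exact (hAS y hy).2 hy0

/-- Near each of its points, a strictly convex surface has a local defining function that is
positive on the inner side, and `inwardNormal` is a smooth unit normal field. -/
theorem exists_inwardNormal {κ : ℝ} (hκ : κ = 1 ∨ κ = -1) {S : Set E4}
    (hS : IsCompactSurface κ S) (hconv : StrictlyConvex κ S) {p : E4} (hp : p ∈ S) :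
    ∃ ν f, IsLocalSurface κ S ν f p ∧
      ∀ᶠ x in 𝓝 p, x ∈ S → inwardNormal κ S x = ν x ∧ IsInwardNormal κ S x (ν x) := by
  -- The point `y ∈ S` fixes the sign: `⟨ν x, y⟩ > 0` persists for `x` near `p`, which makes `ν x`
  -- inward there and singles it out among the two unit normals, hence as the value chosen in
  -- `inwardNormal`.
  obtain ⟨ν, f, h, y, hyS, hy, -⟩ : ∃ ν f, IsLocalSurface κ S ν f p ∧
      ∃ y ∈ S, 0 < bil κ (ν p) y ∧ ∀ x ∈ S, 0 ≤ bil κ (ν p) x := by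
    obtain ⟨ν, f, h⟩ := hS.exists_isLocalSurface hκ hp
    obtain ⟨⟨y, hyS, hy⟩, hpos | hneg⟩ := h.one_side hκ hS hconv hp
    · exact ⟨ν, f, h, y, hyS, (hpos y hyS).lt_of_ne' hy, hpos⟩
    · refine ⟨_, _, h.neg, y, hyS, ?_, fun x hx => ?_⟩
      · rw [bil_neg_left, neg_pos]; exact (hneg y hyS).lt_of_ne hy
      · rw [bil_neg_left, neg_nonneg]; exact hneg x hx
  refine ⟨ν, f, h, ?_⟩
  have hev : ∀ᶠ x in 𝓝 p, 0 < bil κ (ν x) y :=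
    (ContDiffAt.bil h.smooth_normal.self_of_nhds contDiffAt_const).continuousAt.eventually
      (lt_mem_nhds hy)
  filter_upwards [h.eventually, hev] with x hx hxy hxS
  have hxM := hS.1 hxS
  obtain ⟨xn, nn, -⟩ := hx.normal.self_of_nhds hxM
  have hin : IsInwardNormal κ S x (ν x) := by
    refine ⟨xn, nn, fun w hw => ((hx.mem_tangentPlane_iff hκ hS.1 hxS w).1 hw).2, ?_⟩
    rcases (hx.one_side hκ hS hconv hxS).2 with h1 | h1
    · exact h1
    · exact absurd (h1 y hyS) (not_le.2 hxy)
  refine ⟨?_, hin⟩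
  have hex : ∃ m, IsInwardNormal κ S x m := ⟨_, hin⟩
  rw [inwardNormal, dif_pos hex]
  obtain ⟨h1, h2, h3, h4⟩ := hex.choose_spec
  set m := hex.choose
  obtain ⟨v, xv, nv, vv⟩ := exists_unit_orthogonal hκ hxM.1 (ν x)
  have F := isFrame_cross hκ hxM.1 xn xv nn nv vv
  have e : m = bil κ (ν x) m • ν x := by
    apply F.ext hκ
    · rw [bil_smul_right, h1, F.pn, mul_zero]
    · rw [bil_smul_right, F.nn, mul_one]
    · rw [bil_smul_right, F.vn, mul_zero, bil_comm]
      exact h3 _ ((hx.mem_tangentPlane_iff hκ hS.1 hxS _).2 ⟨F.pv, F.nv⟩)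
    · rw [bil_smul_right, F.wn, mul_zero, bil_comm]
      exact h3 _ ((hx.mem_tangentPlane_iff hκ hS.1 hxS _).2 ⟨F.pw, F.nw⟩)
  set a := bil κ (ν x) m
  have ha : a * a = 1 := by
    rw [e, bil_smul_left, bil_smul_right, nn, mul_one] at h2
    exact h2
  have ha0 : 0 ≤ a := by
    have := h4 y hyS
    rw [e, bil_smul_left] at this
    exact nonneg_of_mul_nonneg_left this hxy
  have : a = 1 := by nlinarith
  rw [e, this, one_smul]

/-! ### Jacobi fields -/

/-- The field `c_κ A + s_κ B`. -/
noncomputable def jac (κ : ℝ) (A B : E4) (r : ℝ) : E4 := cK κ r • A + sK κ r • B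

theorem jac_zero (κ : ℝ) (A B : E4) : jac κ A B 0 = A := by simp [jac, cK_zero, sK_zero]

theorem hasDerivAt_jac {κ : ℝ} (hκ : κ = 1 ∨ κ = -1) (A B : E4) (r : ℝ) :
    HasDerivAt (jac κ A B) (jac κ B (-κ • A) r) r := by
  refine (((hasDerivAt_cK hκ r).smul_const A).add
    ((hasDerivAt_sK hκ r).smul_const B)).congr_deriv ?_
  funext i
  simp [jac]; ring

theorem contDiff_jac (κ : ℝ) (A B : E4) : ContDiff ℝ ∞ (jac κ A B) :=
  ((contDiff_cK κ).smul contDiff_const).add ((contDiff_sK κ).smul contDiff_const)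

theorem jac_injective {κ : ℝ} (hκ : κ = 1 ∨ κ = -1) {A B A' B' : E4}
    (h : jac κ A B = jac κ A' B') : A = A' ∧ B = B' := by
  constructor
  · rw [← jac_zero κ A B, h, jac_zero]
  · have h1 := hasDerivAt_jac hκ A B 0
    rw [h] at h1
    have h2 := h1.unique (hasDerivAt_jac hκ A' B' 0)
    rwa [jac_zero, jac_zero] at h2

theorem smul_jac (κ a : ℝ) (A B : E4) : a • jac κ A B = jac κ (a • A) (a • B) := by
  funext r i; simp [jac]; ring

theorem covDeriv_jac_zero {κ : ℝ} (hκ : κ = 1 ∨ κ = -1) (u : unitTangentBundle κ) {A B : E4}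
    (hB : bil κ (u : E4 × E4).1 B = 0) : covDeriv κ (geod κ u) (jac κ A B) 0 = B := by
  rw [covDeriv, (hasDerivAt_jac hκ A B 0).deriv, jac_zero, geod_zero, bil_comm, hB]
  simp

theorem gK_jac {κ : ℝ} (hκ : κ = 1 ∨ κ = -1) (u : unitTangentBundle κ) {A B A' B' : E4}
    (hB : bil κ (u : E4 × E4).1 B = 0) (hB' : bil κ (u : E4 × E4).1 B' = 0) :
    gK u (jac κ A B) (jac κ A' B') = bil κ A A' + κ * bil κ B B' := by
  rw [gK, covDeriv_jac_zero hκ u hB, covDeriv_jac_zero hκ u hB', jac_zero, jac_zero]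

/-- The bivector `γ ∧ γ'` is constant along the geodesic, so `γ' ×` is one fixed linear map of `ℝ⁴`.
-/
theorem complexStructure_jac {κ : ℝ} (hκ : κ = 1 ∨ κ = -1) (u : unitTangentBundle κ) (A B : E4) :
    complexStructure u (jac κ A B) = jac κ (cross κ (u : E4 × E4).1 (u : E4 × E4).2 A)
      (cross κ (u : E4 × E4).1 (u : E4 × E4).2 B) := by
  funext r
  rw [complexStructure, geod, geodVel, cross_plane, jac, cross_add_right, cross_smul_right,
    cross_smul_right, jac]
  rw [show cK κ r * cK κ r - sK κ r * -(κ * sK κ r) = 1 by linear_combination cK_sq_add hκ r,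
    one_smul]

/-- The hypotheses are the linearized equations of the unit tangent bundle; they make `⟨J, γ'⟩`
constant, equal to its value `⟨v, A⟩` at `0`. -/
theorem normalPart_jac {κ : ℝ} (hκ : κ = 1 ∨ κ = -1) (u : unitTangentBundle κ) {A B : E4}
    (hA : bil κ (u : E4 × E4).1 A = 0) (hB : bil κ (u : E4 × E4).2 B = 0)
    (hAB : bil κ (u : E4 × E4).1 B + bil κ (u : E4 × E4).2 A = 0) :
    normalPart u (jac κ A B) = jac κ (A - bil κ (u : E4 × E4).2 A • (u : E4 × E4).2)
      (B + (κ * bil κ (u : E4 × E4).2 A) • (u : E4 × E4).1) := by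
  funext r
  have e : bil κ (jac κ A B r) (geodVel κ u r) = bil κ (u : E4 × E4).2 A := by
    simp only [jac, geodVel, bil_add_left, bil_add_right, bil_smul_left, bil_smul_right]
    rw [bil_comm κ A, bil_comm κ B, bil_comm κ A, bil_comm κ B, hA, hB]
    linear_combination bil κ (u : E4 × E4).2 A * cK_sq_add hκ r - κ * sK κ r ^ 2 * hAB
  rw [normalPart, e]
  funext i
  simp [jac, geodVel]; ring

theorem isNormalJacobi_jac {κ : ℝ} (hκ : κ = 1 ∨ κ = -1) (u : unitTangentBundle κ) {A B : E4}
    (hA : bil κ (u : E4 × E4).1 A = 0) (hA' : bil κ (u : E4 × E4).2 A = 0)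
    (hB : bil κ (u : E4 × E4).1 B = 0) (hB' : bil κ (u : E4 × E4).2 B = 0) :
    IsNormalJacobi κ u (jac κ A B) := by
  have horth : ∀ {A B : E4} (r : ℝ), bil κ (u : E4 × E4).1 A = 0 → bil κ (u : E4 × E4).2 A = 0 →
      bil κ (u : E4 × E4).1 B = 0 → bil κ (u : E4 × E4).2 B = 0 →
      bil κ (geod κ u r) (jac κ A B r) = 0 ∧ bil κ (geodVel κ u r) (jac κ A B r) = 0 := by
    intro A B r h1 h2 h3 h4
    simp [geod, geodVel, jac, bil_add_left, bil_add_right, bil_smul_left, bil_smul_right,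
      bil_neg_left, h1, h2, h3, h4]
  have hcov : ∀ {A B : E4}, bil κ (u : E4 × E4).1 A = 0 → bil κ (u : E4 × E4).2 A = 0 →
      bil κ (u : E4 × E4).1 B = 0 → bil κ (u : E4 × E4).2 B = 0 →
      covDeriv κ (geod κ u) (jac κ A B) = jac κ B (-κ • A) := by
    intro A B h1 h2 h3 h4
    funext r
    rw [covDeriv, (hasDerivAt_jac hκ A B r).deriv, bil_comm, (horth r h3 h4 _ _).1] <;>
      simp [bil_smul_right, bil_neg_right, h1, h2]
  refine ⟨contDiff_jac κ A B, fun r => ⟨(horth r hA hA' hB hB').1, (horth r hA hA' hB hB').2, ?_⟩⟩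
  rw [hcov hA hA' hB hB', hcov hB hB' (by rw [bil_smul_right, hA, mul_zero])
    (by rw [bil_smul_right, hA', mul_zero])]
  funext i
  simp [jac]; ring

/-- Differentiating `⟨γ, J⟩ = ⟨γ', J⟩ = 0` shows that both covariant derivatives are ordinary ones,
so the Jacobi equation is `J'' = -κ J` in `ℝ⁴`. -/
theorem IsNormalJacobi.exists_eq_jac {κ : ℝ} (hκ : κ = 1 ∨ κ = -1) {u : unitTangentBundle κ}
    {J : ℝ → E4} (h : IsNormalJacobi κ u J) : ∃ A B, J = jac κ A B ∧
      bil κ (u : E4 × E4).1 A = 0 ∧ bil κ (u : E4 × E4).2 A = 0 ∧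
      bil κ (u : E4 × E4).1 B = 0 ∧ bil κ (u : E4 × E4).2 B = 0 := by
  obtain ⟨hs, hJ⟩ := h
  have hs' : ContDiff ℝ ∞ (deriv J) := (contDiff_infty_iff_deriv.1 hs).2
  have hd : ∀ r, HasDerivAt J (deriv J r) r := fun r =>
    (hs.differentiable (by simp) r).hasDerivAt
  have hdd : ∀ r, HasDerivAt (deriv J) (deriv (deriv J) r) r := fun r =>
    (hs'.differentiable (by simp) r).hasDerivAt
  have hg := hasDerivAt_geod hκ (u : E4 × E4)
  have hgv := hasDerivAt_geodVel hκ (u : E4 × E4)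
  have hconst : ∀ {g : ℝ → ℝ} {g' r : ℝ}, HasDerivAt g g' r → (∀ t, g t = 0) → g' = 0 := by
    intro g g' r h1 h2
    have : g = fun _ => 0 := funext h2
    rw [this] at h1
    exact h1.unique (hasDerivAt_const r 0)
  have h1 : ∀ r, bil κ (geod κ u r) (deriv J r) = 0 := by
    intro r
    have := hconst (hasDerivAt_bil (κ := κ) (hg r) (hd r)) fun t => (hJ t).1
    rwa [(hJ r).2.1, zero_add] at this
  have h2 : ∀ r, bil κ (geodVel κ u r) (deriv J r) = 0 := by
    intro r
    have := hconst (hasDerivAt_bil (κ := κ) (hgv r) (hd r)) fun t => (hJ t).2.1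
    rwa [bil_smul_left, (hJ r).1, mul_zero, zero_add] at this
  have h3 : ∀ r, bil κ (geod κ u r) (deriv (deriv J) r) = 0 := by
    intro r
    have := hconst (hasDerivAt_bil (κ := κ) (hg r) (hdd r)) h1
    rwa [h2, zero_add] at this
  have hc : covDeriv κ (geod κ u) J = deriv J := by
    funext r
    rw [covDeriv, bil_comm, h1]; simp
  have hode : ∀ r, deriv (deriv J) r = -κ • J r := by
    intro r
    have := (hJ r).2.2
    rw [hc, covDeriv, bil_comm, h3, mul_zero, zero_smul, sub_zero] at this
    rw [neg_smul]; exact eq_neg_of_add_eq_zero_left this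
  -- `hA` and `hB` are two first integrals of `J'' = -κ J`; solving them for `J r` gives the formula
  -- without a uniqueness theorem for ODEs.
  have hA : ∀ r, cK κ r • J r - sK κ r • deriv J r = J 0 := by
    have hdA : ∀ r, HasDerivAt (fun r => cK κ r • J r - sK κ r • deriv J r) 0 r := by
      intro r
      refine (((hasDerivAt_cK hκ r).smul (hd r)).sub
        ((hasDerivAt_sK hκ r).smul (hdd r))).congr_deriv ?_
      rw [hode]; funext i; simp; ring
    intro r
    have := is_const_of_deriv_eq_zero (fun r => (hdA r).differentiableAt) (fun r => (hdA r).deriv)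
      r 0
    simpa [cK_zero, sK_zero] using this
  have hB : ∀ r, (κ * sK κ r) • J r + cK κ r • deriv J r = deriv J 0 := by
    have hdB : ∀ r, HasDerivAt (fun r => (κ * sK κ r) • J r + cK κ r • deriv J r) 0 r := by
      intro r
      refine ((((hasDerivAt_sK hκ r).const_mul κ).smul (hd r)).add
        ((hasDerivAt_cK hκ r).smul (hdd r))).congr_deriv ?_
      rw [hode]; funext i; simp; ring
    intro r
    have := is_const_of_deriv_eq_zero (fun r => (hdB r).differentiableAt) (fun r => (hdB r).deriv)
      r 0
    simpa [cK_zero, sK_zero] using this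
  refine ⟨J 0, deriv J 0, ?_, ?_, ?_, ?_, ?_⟩
  · funext r
    rw [jac, ← hA r, ← hB r]
    funext i
    have := cK_sq_add hκ r
    simp
    linear_combination -J r i * this
  · simpa [geod_zero] using (hJ 0).1
  · simpa [geodVel_zero] using (hJ 0).2.1
  · simpa [geod_zero] using h1 0
  · simpa [geodVel_zero] using h2 0

/-! ### Velocities of curves of geodesics -/

theorem exists_hasDerivAt_lift {κ : ℝ} {φ : ℝ → unitTangentBundle κ} {s₀ : ℝ}
    (h : ContDiffAt ℝ ∞ (fun s => (φ s : E4 × E4)) s₀) :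
    ∃ A B, HasDerivAt (fun s => (φ s : E4 × E4).1) A s₀ ∧
      HasDerivAt (fun s => (φ s : E4 × E4).2) B s₀ :=
  ⟨_, _, (h.fst.differentiableAt (by simp)).hasDerivAt,
    (h.snd.differentiableAt (by simp)).hasDerivAt⟩

theorem variationField_eq_jac {κ : ℝ} {φ : ℝ → unitTangentBundle κ} {s₀ : ℝ} {A B : E4}
    (hA : HasDerivAt (fun s => (φ s : E4 × E4).1) A s₀)
    (hB : HasDerivAt (fun s => (φ s : E4 × E4).2) B s₀) :
    variationField φ s₀ = jac κ A B := by
  funext r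
  exact ((hA.const_smul (cK κ r)).add (hB.const_smul (sK κ r))).deriv

/-- Derivatives of the three equations defining the unit tangent bundle. -/
theorem lift_relations {κ : ℝ} {φ : ℝ → unitTangentBundle κ} {s₀ : ℝ} {A B : E4}
    (hA : HasDerivAt (fun s => (φ s : E4 × E4).1) A s₀)
    (hB : HasDerivAt (fun s => (φ s : E4 × E4).2) B s₀) :
    bil κ (φ s₀ : E4 × E4).1 A = 0 ∧ bil κ (φ s₀ : E4 × E4).2 B = 0 ∧
      bil κ (φ s₀ : E4 × E4).1 B + bil κ (φ s₀ : E4 × E4).2 A = 0 := by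
  refine ⟨bil_deriv_eq_zero (Eventually.of_forall fun s => (φ s).2.1) hA, ?_, ?_⟩
  · have h1 := hasDerivAt_bil (κ := κ) hB hB
    simp only [fun s => (φ s).2.2.2] at h1
    have := h1.unique (hasDerivAt_const _ _)
    rw [bil_comm κ B] at this
    linarith
  · have h1 := hasDerivAt_bil (κ := κ) hA hB
    simp only [fun s => (φ s).2.2.1] at h1
    have := h1.unique (hasDerivAt_const _ _)
    rw [bil_comm κ A] at this
    linarith

theorem normalPart_variationField {κ : ℝ} (hκ : κ = 1 ∨ κ = -1) {φ : ℝ → unitTangentBundle κ}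
    {s₀ : ℝ} {A B : E4} (hA : HasDerivAt (fun s => (φ s : E4 × E4).1) A s₀)
    (hB : HasDerivAt (fun s => (φ s : E4 × E4).2) B s₀) :
    normalPart (φ s₀) (variationField φ s₀) =
      jac κ (A - bil κ (φ s₀ : E4 × E4).2 A • (φ s₀ : E4 × E4).2)
        (B + (κ * bil κ (φ s₀ : E4 × E4).2 A) • (φ s₀ : E4 × E4).1) := by
  obtain ⟨h1, h2, h3⟩ := lift_relations hA hB
  rw [variationField_eq_jac hA hB, normalPart_jac hκ _ h1 h2 h3]

/-! ### The tangent space of the hypersurface of tangent geodesics -/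

theorem isFrame_rotated {κ : ℝ} (hκ : κ = 1 ∨ κ = -1) {S : Set E4} (hS : IsCompactSurface κ S)
    (hconv : StrictlyConvex κ S) {u : unitTangentBundle κ} (hu : u ∈ unitTangentSurface κ S) :
    IsInwardNormal κ S (u : E4 × E4).1 (inwardNormal κ S (u : E4 × E4).1) ∧
    IsFrame κ (u : E4 × E4).1 (inwardNormal κ S (u : E4 × E4).1) (u : E4 × E4).2
      (rotated S u).2 := by
  obtain ⟨ν, f, h, hν⟩ := exists_inwardNormal hκ hS hconv hu.1
  obtain ⟨h1, h2⟩ := hν.self_of_nhds hu.1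
  rw [← h1] at h2
  exact ⟨h2, isFrame_cross hκ u.2.1.1 h2.1 u.2.2.1 h2.2.1 (h2.2.2.1 _ hu.2) u.2.2.2⟩

/-- The second fundamental form of `S` does not vanish on unit vectors. -/
theorem bil_deriv_normal_ne_zero {κ : ℝ} (hκ : κ = 1 ∨ κ = -1) {S : Set E4}
    (hS : IsCompactSurface κ S) (hquad : QuadraticallyConvex κ S) {ν : E4 → E4} {f : E4 → ℝ}
    {p v : E4} (hp : p ∈ S) (h : IsLocalSurface κ S ν f p)
    (hν : ∀ᶠ x in 𝓝 p, x ∈ S → inwardNormal κ S x = ν x) (pv : bil κ p v = 0)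
    (nv : bil κ (ν p) v = 0) (hv : v ≠ 0) : bil κ (fderiv ℝ ν p v) v ≠ 0 := by
  obtain ⟨σ, hσ, hd⟩ := h.exists_curve hκ hS.1 hp pv nv
  have hc : Tendsto σ (𝓝 0) (𝓝 p) := by
    have := hd.continuousAt.tendsto
    rwa [hσ.2] at this
  have hν' := (h.smooth_normal.self_of_nhds.differentiableAt (by simp)).hasFDerivAt
  rw [← hσ.2] at hν'
  have h1 : HasDerivAt (fun s => inwardNormal κ S (σ s)) (fderiv ℝ ν p v) 0 := by
    have h2 := hν'.comp_hasDerivAt (0 : ℝ) hd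
    rw [hσ.2] at h2
    refine h2.congr_of_eventuallyEq ?_
    filter_upwards [hσ.1, hc.eventually hν] with s hs hm using hm hs.2
  have h2 : shapeForm κ S σ ≠ 0 := by
    have hd0 : deriv σ 0 ≠ 0 := by rw [hd.deriv]; exact hv
    rcases hquad p hp with hq | hq
    · exact (hq σ hσ hd0).ne'
    · exact (hq σ hσ hd0).ne
  rw [shapeForm, covDeriv, h1.deriv, hd.deriv, bil_neg_left, bil_sub_left, bil_smul_left, hσ.2,
    pv, mul_zero, sub_zero, neg_ne_zero] at h2
  exact h2

/-- Only the germ at `s₀` matters; away from it the lift takes the arbitrary value `u`. -/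
theorem exists_unitTangentBundle_lift {κ : ℝ} (u : unitTangentBundle κ) {z : ℝ → E4 × E4} {s₀ : ℝ}
    (hz : ∀ᶠ s in 𝓝 s₀, z s ∈ unitTangentBundle κ) :
    ∃ w : ℝ → unitTangentBundle κ, ∀ᶠ s in 𝓝 s₀, (w s : E4 × E4) = z s := by
  classical
  refine ⟨fun s => if h : z s ∈ unitTangentBundle κ then ⟨z s, h⟩ else u, ?_⟩
  filter_upwards [hz] with s hs
  rw [dif_pos hs]

/-- The foot point moves in `T_pS`, so after removal of the `v` component only a multiple of `w` is
left in `A`. Conversely `a`, `b`, `d` can be prescribed independently; quadratic convexity enters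
only to reach every `d`. -/
theorem mem_tangentSpaceM_iff {κ : ℝ} (hκ : κ = 1 ∨ κ = -1) {S : Set E4}
    (hS : IsCompactSurface κ S) (hconv : StrictlyConvex κ S) (hquad : QuadraticallyConvex κ S)
    {u : unitTangentBundle κ} (hu : u ∈ unitTangentSurface κ S) (K : ℝ → E4) :
    K ∈ tangentSpaceM S u ↔ ∃ a b d : ℝ, K = jac κ (a • (rotated S u).2)
      (b • (rotated S u).2 + d • inwardNormal κ S (u : E4 × E4).1) := by
  have hk := kappa_sq hκ
  obtain ⟨-, F⟩ := isFrame_rotated hκ hS hconv hu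
  obtain ⟨ν, f, h, hν⟩ := exists_inwardNormal hκ hS hconv hu.1
  have hν0 := (hν.self_of_nhds hu.1).1
  have hT := h.mem_tangentPlane_iff hκ hS.1 hu.1
  rw [← hν0] at hT
  set w := (rotated S u).2 with hw
  set n := inwardNormal κ S (u : E4 × E4).1 with hn
  obtain ⟨⟨p, v⟩, hpv⟩ := u
  simp only at F hν0 hT h hν
  constructor
  · rintro ⟨z, hz, hz0, rfl⟩
    obtain ⟨A, B, hA, hB⟩ := exists_hasDerivAt_lift hz.self_of_nhds.1
    have hK := normalPart_variationField hκ hA hB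
    obtain ⟨h1, h2, h3⟩ := lift_relations hA hB
    rw [hz0] at hK h1 h2 h3
    rw [hK]
    simp only at h1 h2 h3 ⊢
    have hAT : A ∈ tangentPlane S p := by
      refine ⟨fun s => (z s : E4 × E4).1, ⟨?_, by simp only [hz0]⟩, hA.deriv⟩
      filter_upwards [hz] with s hs using ⟨hs.1.fst, hs.2.1⟩
    obtain ⟨-, hnA⟩ := (hT A).1 hAT
    refine ⟨bil κ w A, bil κ w B, bil κ n B, ?_⟩
    congr 1
    · apply F.ext hκ <;>
        simp only [bil_sub_right, bil_smul_right, F.pv, F.pw, F.nv, F.nw, F.vv, F.vw, F.wv, F.ww,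
          h1, hnA] <;> ring
    · apply F.ext hκ <;>
        simp only [bil_add_right, bil_smul_right, F.pp, F.pw, F.pn, F.np, F.nn, F.nw, F.vp, F.vw,
          F.vn, F.wp, F.wn, F.ww, h2]
      · linear_combination h3 + bil κ v A * hk
      · ring
      · ring
      · ring
  · rintro ⟨a, b, d, rfl⟩
    have hII : bil κ (fderiv ℝ ν p v) v ≠ 0 := by
      refine bil_deriv_normal_ne_zero hκ hS hquad hu.1 h (hν.mono fun x hx hxS => (hx hxS).1)
        F.pv (hν0 ▸ F.nv) ?_
      rintro rfl
      have := F.vv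
      rw [bil_zero_left] at this
      exact zero_ne_one this
    -- Sliding the foot point along `v` does not change `a`, but it changes the `n` component `d` at
    -- the nonzero rate `-⟨dν(v), v⟩`; the speed `c` is chosen to match `d`.
    obtain ⟨c, hc⟩ : ∃ c, -bil κ (fderiv ℝ ν p (c • v + a • w)) v = d := by
      refine ⟨-(d + a * bil κ (fderiv ℝ ν p w) v) / bil κ (fderiv ℝ ν p v) v, ?_⟩
      rw [map_add, map_smul, map_smul, bil_add_left, bil_smul_left, bil_smul_left]
      field_simp
      ring
    set A := c • v + a • w with hA
    have pA : bil κ p A = 0 := by simp [hA, bil_add_right, bil_smul_right, F.pv, F.pw]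
    have nA : bil κ n A = 0 := by simp [hA, bil_add_right, bil_smul_right, F.nv, F.nw]
    have vA : bil κ v A = c := by simp [hA, bil_add_right, bil_smul_right, F.vv, F.vw]
    obtain ⟨σ, hσ, hd⟩ := h.exists_curve hκ hS.1 hu.1 pA (hν0 ▸ nA)
    have hσc : Tendsto σ (𝓝 0) (𝓝 p) := by
      have := hd.continuousAt.tendsto
      rwa [hσ.2] at this
    have hνd : HasDerivAt (fun s => ν (σ s)) (fderiv ℝ ν p A) 0 := by
      have hν' := (h.smooth_normal.self_of_nhds.differentiableAt (by simp)).hasFDerivAt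
      rw [← hσ.2] at hν'
      have h2 := hν'.comp_hasDerivAt (0 : ℝ) hd
      rwa [hσ.2] at h2
    let y : ℝ → E4 := fun s => v + s • (b • w)
    have hy : HasDerivAt y (b • w) 0 := by
      have := ((hasDerivAt_id (0 : ℝ)).smul_const (b • w)).const_add v
      rwa [one_smul] at this
    have hyc : ContDiff ℝ ∞ y := by fun_prop
    have hy0 : y 0 = v := by simp [y]
    -- Project `v + s b w` to the tangent plane at `σ s`, then normalize. Normalizing does not
    -- affect the derivative at `0`, because that derivative is orthogonal to `v`.
    let x : ℝ → E4 := fun s => y s - (κ * bil κ (σ s) (y s)) • σ s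
      - bil κ (ν (σ s)) (y s) • ν (σ s)
    have hx0 : x 0 = v := by
      simp only [x, hy0, hσ.2, ← hν0, F.pv, F.nv]; simp
    set X := b • w + (-κ * c) • p + d • n with hX
    have hxd : HasDerivAt x X 0 := by
      have h1 := ((hasDerivAt_bil (κ := κ) hd hy).const_mul κ).smul hd
      have h2 := (hasDerivAt_bil (κ := κ) hνd hy).smul hνd
      refine ((hy.sub h1).sub h2).congr_deriv ?_
      simp only [hy0, hσ.2, ← hν0, F.pv, F.nv, bil_smul_right, F.pw, F.nw]
      rw [bil_comm κ A, vA, hX, ← hc]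
      funext i
      simp
      ring
    have hσs : ∀ᶠ s in 𝓝 0, ContDiffAt ℝ ∞ σ s := hσ.1.mono fun s hs => hs.1
    have hνs : ∀ᶠ s in 𝓝 0, ContDiffAt ℝ ∞ (fun s => ν (σ s)) s := by
      filter_upwards [hσs, hσc.eventually h.smooth_normal] with s h1 h2 using h2.comp s h1
    have hxs : ∀ᶠ s in 𝓝 0, ContDiffAt ℝ ∞ x s := by
      filter_upwards [hσs, hνs] with s h1 h2
      exact (hyc.contDiffAt.sub ((contDiffAt_const.mul (ContDiffAt.bil h1 hyc.contDiffAt)).smul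
        h1)).sub ((ContDiffAt.bil h2 hyc.contDiffAt).smul h2)
    have hpos : ∀ᶠ s in 𝓝 0, 0 < bil κ (x s) (x s) := by
      refine (ContDiffAt.bil hxs.self_of_nhds hxs.self_of_nhds).continuousAt.eventually
        (lt_mem_nhds ?_)
      simp only [hx0, F.vv]; exact one_pos
    let X1 : ℝ → E4 := fun s => (√(bil κ (x s) (x s)))⁻¹ • x s
    have hX1s : ∀ᶠ s in 𝓝 0, ContDiffAt ℝ ∞ X1 s := by
      filter_upwards [hxs, hpos] with s h1 h2
      exact (((ContDiffAt.bil h1 h1).sqrt h2.ne').inv (Real.sqrt_pos.2 h2).ne').smul h1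
    have hX1d : HasDerivAt X1 X 0 := by
      have e1 : bil κ X v = 0 := by
        simp [hX, bil_add_left, bil_smul_left, F.wv, F.pv, F.nv, bil_neg_left]
      have h1 := hasDerivAt_bil (κ := κ) hxd hxd
      rw [hx0, bil_comm κ v, e1, add_zero] at h1
      have h2 := h1.sqrt (by rw [hx0, F.vv]; exact one_ne_zero)
      have h3 := (h2.fun_inv (by rw [hx0, F.vv]; simp)).smul hxd
      refine h3.congr_deriv ?_
      rw [hx0, F.vv]
      simp
    have hmem : ∀ᶠ s in 𝓝 0, σ s ∈ S ∧ (σ s, X1 s) ∈ unitTangentBundle κ ∧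
        X1 s ∈ tangentPlane S (σ s) := by
      filter_upwards [hσ.1, hpos, hσc.eventually h.eventually] with s hs h2 h3
      have hsM := hS.1 hs.2
      obtain ⟨n1, n2, -⟩ := h3.normal.self_of_nhds hsM
      have e1 : bil κ (σ s) (x s) = 0 := by
        simp only [x, bil_sub_right, bil_smul_right, n1, hsM.1]
        linear_combination -bil κ (σ s) (y s) * hk
      have e2 : bil κ (ν (σ s)) (x s) = 0 := by
        simp only [x, bil_sub_right, bil_smul_right, n2, bil_comm κ (ν (σ s)) (σ s), n1]
        ring
      refine ⟨hs.2, ⟨hsM, ?_, ?_⟩, (h3.mem_tangentPlane_iff hκ hS.1 hs.2 _).2 ⟨?_, ?_⟩⟩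
      · simp only [X1, bil_smul_right, e1, mul_zero]
      · simp only [X1]
        rw [bil_smul_left, bil_smul_right, ← mul_assoc, ← mul_inv, Real.mul_self_sqrt h2.le,
          inv_mul_cancel₀ h2.ne']
      · simp only [X1, bil_smul_right, e1, mul_zero]
      · simp only [X1, bil_smul_right, e2, mul_zero]
    obtain ⟨z, hz⟩ := exists_unitTangentBundle_lift ⟨(p, v), hpv⟩ (z := fun s => (σ s, X1 s))
      (hmem.mono fun s hs => hs.2.1)
    have hX10 : X1 0 = v := by simp [X1, hx0, F.vv]
    have hz0 : z 0 = ⟨(p, v), hpv⟩ := by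
      apply Subtype.ext
      rw [hz.self_of_nhds, hσ.2, hX10]
    have hz1 : HasDerivAt (fun s => (z s : E4 × E4).1) A 0 :=
      hd.congr_of_eventuallyEq (hz.mono fun s hs => by simp only [hs])
    have hz2 : HasDerivAt (fun s => (z s : E4 × E4).2) X 0 :=
      hX1d.congr_of_eventuallyEq (hz.mono fun s hs => by simp only [hs])
    refine ⟨z, ?_, hz0, ?_⟩
    · filter_upwards [hσs, hX1s, hmem, hz.eventually_nhds] with s h1 h2 h3 h4
      refine ⟨(h1.prodMk h2).congr_of_eventuallyEq h4, ?_, ?_⟩ <;> rw [h4.self_of_nhds]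
      · exact h3.1
      · exact h3.2.2
    · have := normalPart_variationField hκ hz1 hz2
      rw [hz0] at this
      rw [this]
      simp only [vA]
      congr 1
      · simp [hA]
      · rw [hX]; funext i; simp; ring

/-! ### The outward unit normal -/

/-- The bound `3 < π` serves both signs of `κ`. -/
theorem sK_pos {κ r : ℝ} (hκ : κ = 1 ∨ κ = -1) (h0 : 0 < r) (h3 : r < 3) : 0 < sK κ r := by
  rcases hκ with rfl | rfl
  · rw [sK_one]; exact Real.sin_pos_of_pos_of_lt_pi h0 (h3.trans Real.pi_gt_three)
  · rw [sK_neg_one]; exact Real.sinh_pos_iff.2 h0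

theorem eventually_pos_of_hasDerivAt {g : ℝ → ℝ} {g' : ℝ} (h : HasDerivAt g g' 0) (h0 : g 0 = 0)
    (hg : 0 < g') : ∀ᶠ s in 𝓝[>] (0 : ℝ), 0 < g s := by
  have h1 := (hasDerivWithinAt_iff_tendsto_slope' (s := Ioi (0 : ℝ)) (by simp)).1
    h.hasDerivWithinAt
  filter_upwards [h1.eventually (lt_mem_nhds hg), self_mem_nhdsWithin] with s hs hs0
  rw [slope_def_field, h0, sub_zero, sub_zero] at hs
  exact (div_pos_iff_of_pos_right hs0).1 hs

/-- A tangent geodesic runs, near the point of tangency, on the outer side of the surface. -/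
theorem IsLocalSurface.eventually_neg_of_tangent {κ : ℝ} (hκ : κ = 1 ∨ κ = -1) {S : Set E4}
    (hS : S ⊆ spaceForm κ) (hconv : StrictlyConvex κ S) {ν : E4 → E4} {f : E4 → ℝ} {p v : E4}
    (hp : p ∈ S) (h : IsLocalSurface κ S ν f p) (hν : IsInwardNormal κ S p (ν p))
    (hv : v ∈ tangentPlane S p) (pv : bil κ p v = 0) (vv : bil κ v v = 1) :
    ∀ᶠ r in 𝓝[>] (0 : ℝ), f (cK κ r • p + sK κ r • v) < 0 := by
  have hpM := hS hp
  obtain ⟨pn, nn, nT, hnS⟩ := hν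
  obtain ⟨-, -, l, hl, hdf⟩ := h.normal.self_of_nhds hpM
  have nv := nT v hv
  set n := ν p with hn
  have np : bil κ n p = 0 := by rw [bil_comm, pn]
  let γ : ℝ → E4 := fun r => cK κ r • p + sK κ r • v
  -- `x (a, r)` is the point `γ r` of the tangent geodesic pushed outwards by `a`. For small `a > 0`
  -- it satisfies `⟨n, x⟩ < 0`, so it is not in `S`.
  let x : ℝ × ℝ → E4 := fun q => cK κ q.1 • γ q.2 + sK κ q.1 • (-n)
  have hcc := (contDiff_cK κ).continuous
  have hsc := (contDiff_sK κ).continuous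
  have hγc : Continuous γ := by fun_prop
  have hxc : Continuous x := by fun_prop
  have hγM : ∀ r, γ r ∈ spaceForm κ := geod_mem_spaceForm hκ hpM pv vv
  have hγn : ∀ r, bil κ n (γ r) = 0 := by
    intro r; simp [γ, bil_add_right, bil_smul_right, np, nv]
  have hxM : ∀ q, x q ∈ spaceForm κ := by
    intro q
    refine geod_mem_spaceForm hκ (hγM q.2) ?_ ?_ q.1
    · rw [bil_neg_right, bil_comm, hγn, neg_zero]
    · rw [bil_neg_left, bil_neg_right, nn, neg_neg]
  have hx0 : x (0, 0) = p := by simp [x, γ, cK_zero, sK_zero]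
  have hnx : ∀ q, bil κ n (x q) = -sK κ q.1 := by
    intro q
    simp only [x, bil_add_right, bil_smul_right, bil_neg_right, hγn, nn]
    ring
  have hx0t : Tendsto x (𝓝 (0, 0)) (𝓝 p) := hx0 ▸ hxc.tendsto (0, 0)
  obtain ⟨η, hη, hball⟩ := Metric.eventually_nhds_iff.1
    (hx0t.eventually (h.mem_iff.and (h.smooth.mono fun x hx => hx.continuousAt)))
  have hsmall : ∀ a b : ℝ, 0 ≤ a → a < η → 0 ≤ b → b < η →
      (x (a, b) ∈ S ↔ x (a, b) ∈ spaceForm κ ∧ f (x (a, b)) = 0) ∧ ContinuousAt f (x (a, b)) := by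
    intro a b ha ha' hb hb'
    apply hball
    rw [Prod.dist_eq, max_lt_iff, Real.dist_0_eq_abs, Real.dist_0_eq_abs, abs_of_nonneg ha,
      abs_of_nonneg hb]
    exact ⟨ha', hb'⟩
  have hlt : ∀ {a : ℝ}, 0 < a → ∀ᶠ s in 𝓝[>] (0 : ℝ), s < a := fun ha =>
    nhdsWithin_le_nhds (gt_mem_nhds ha)
  obtain ⟨τ, hτ, hτη, hτ3, hτ0⟩ : ∃ τ, f (x (τ, 0)) < 0 ∧ τ < η ∧ τ < 3 ∧ 0 < τ := by
    have hd : HasDerivAt (fun τ : ℝ => -f (x (τ, 0))) l 0 := by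
      have h1 : HasDerivAt (fun τ : ℝ => x (τ, 0)) (-n) 0 := by
        have := hasDerivAt_jac hκ (γ 0) (-n) 0
        rwa [jac_zero] at this
      have hf := (h.smooth.self_of_nhds.differentiableAt (by simp)).hasFDerivAt
      have h2 : HasFDerivAt f (fderiv ℝ f p) (x (0, 0)) := by rw [hx0]; exact hf
      have h3 := (h2.comp_hasDerivAt (0 : ℝ) h1).neg
      rw [hdf (-n) (by rw [bil_neg_right, pn, neg_zero]), bil_neg_right, nn] at h3
      rw [mul_neg_one, neg_neg] at h3
      exact h3
    have hf0 : f p = 0 := (h.mem_iff.self_of_nhds.1 hp).2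
    have := eventually_pos_of_hasDerivAt hd (by simp only [hx0, hf0, neg_zero]) hl
    obtain ⟨τ, h1, h2, h3, h4⟩ := (this.and ((hlt hη).and
      ((hlt (by norm_num : (0 : ℝ) < 3)).and self_mem_nhdsWithin))).exists
    exact ⟨τ, by linarith, h2, h3, h4⟩
  have hev : ∀ᶠ r in 𝓝 (0 : ℝ), f (x (τ, r)) < 0 := by
    have hc : ContinuousAt (fun r => f (x (τ, r))) 0 :=
      ContinuousAt.comp (f := fun r => x (τ, r)) (g := f)
        (hsmall τ 0 hτ0.le hτη le_rfl hη).2 (by fun_prop)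
    exact hc.eventually (gt_mem_nhds hτ)
  filter_upwards [nhdsWithin_le_nhds hev, hlt hη, hlt (by norm_num : (0 : ℝ) < 3),
    self_mem_nhdsWithin] with r hr hrη hr3 hr0
  have hr0 : 0 < r := hr0
  have hγx : x (0, r) = γ r := by simp [x, cK_zero, sK_zero]
  have hne : f (γ r) ≠ 0 := by
    intro h0
    have hmem := (hsmall 0 r le_rfl hη hr0.le hrη).1.2 ⟨hxM _, by rw [hγx]; exact h0⟩
    rw [hγx] at hmem
    have : γ r ∈ ({p} : Set E4) := hconv p hp ▸ ⟨hmem, v, hv, vv, r, rfl⟩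
    have e : bil κ v (γ r) = bil κ v p := by rw [this]
    rw [bil_comm κ v p, pv] at e
    simp only [γ, bil_add_right, bil_smul_right, bil_comm κ v p, pv, vv, mul_zero, zero_add,
      mul_one] at e
    exact (sK_pos hκ hr0 hr3).ne' e
  rcases lt_or_gt_of_ne hne with hneg | hpos
  · exact hneg
  · exfalso
    have hcont : ContinuousOn (fun a => f (x (a, r))) (Icc 0 τ) := by
      intro a ha
      refine ContinuousAt.continuousWithinAt ?_
      exact ContinuousAt.comp (f := fun a => x (a, r)) (g := f)
        (hsmall a r ha.1 (ha.2.trans_lt hτη) hr0.le hrη).2 (by fun_prop)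
    -- If `f (γ r)` were positive, `f` would vanish somewhere on the push from `γ r` to `x (τ, r)`,
    -- giving a point of `S` on the wrong side of the tangent surface.
    obtain ⟨a, ha, ha0⟩ := intermediate_value_Icc' hτ0.le hcont
      (show (0 : ℝ) ∈ Icc _ _ from ⟨hr.le, by rw [hγx]; exact hpos.le⟩)
    have hmem := (hsmall a r ha.1 (ha.2.trans_lt hτη) hr0.le hrη).1.2 ⟨hxM _, ha0⟩
    have h1 := hnS _ hmem
    rw [hnx] at h1
    rcases ha.1.eq_or_lt with h2 | h2
    · simp only [← h2, hγx] at ha0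
      exact hne ha0
    · have := sK_pos hκ h2 (ha.2.trans_lt hτ3)
      simp only at h1
      linarith

theorem not_mem_of_mem_billiardTable {κ : ℝ} {S : Set E4} {q : unitTangentBundle κ}
    (h : toGeodesic q ∈ billiardTable κ S) (t : ℝ) : geod κ q t ∉ S := by
  obtain ⟨q', hq, hq', -⟩ := h
  obtain ⟨τ, hτ⟩ := Quotient.exact hq
  rw [hτ]
  exact hq' _

/-- Moving a tangent geodesic inwards makes it intersect the surface. -/
theorem not_velocity_inward {κ : ℝ} (hκ : κ = 1 ∨ κ = -1) {S : Set E4}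
    (hS : IsCompactSurface κ S) (hconv : StrictlyConvex κ S) {u : unitTangentBundle κ}
    (hu : u ∈ unitTangentSurface κ S) {c : ℝ → OrientedGeodesic κ}
    (hc : HasVelocity c 0 u (jac κ (inwardNormal κ S (u : E4 × E4).1) 0)) :
    ¬ ∀ᶠ s in 𝓝[>] (0 : ℝ), c s ∈ billiardTable κ S := by
  intro hct
  obtain ⟨φ, hφ, hcφ, hφ0, hJ⟩ := hc
  obtain ⟨-, F⟩ := isFrame_rotated hκ hS hconv hu
  obtain ⟨ν, f, h, hν⟩ := exists_inwardNormal hκ hS hconv hu.1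
  obtain ⟨hν0, hin⟩ := hν.self_of_nhds hu.1
  obtain ⟨A, B, hA, hB⟩ := exists_hasDerivAt_lift hφ.self_of_nhds
  have hK := normalPart_variationField hκ hA hB
  obtain ⟨pA, -, -⟩ := lift_relations hA hB
  rw [hφ0] at hK pA
  rw [hK] at hJ
  have hAn := (jac_injective hκ hJ).1
  have hneg := h.eventually_neg_of_tangent hκ hS.1 hconv hu.1 hin hu.2 F.pv F.vv
  obtain ⟨-, -, l, hl, hdf⟩ := h.normal.self_of_nhds (hS.1 hu.1)
  rw [← hν0] at hdf
  -- The foot point of an inward moving geodesic enters `f > 0`, while at a fixed small parameter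
  -- `r` the geodesic still has `f < 0`; between them it must meet `S`.
  have hpos : ∀ᶠ s in 𝓝[>] (0 : ℝ), 0 < f (φ s : E4 × E4).1 := by
    have h2 : HasFDerivAt f (fderiv ℝ f (u : E4 × E4).1) (φ 0 : E4 × E4).1 := by
      rw [hφ0]; exact (h.smooth.self_of_nhds.differentiableAt (by simp)).hasFDerivAt
    have h3 := h2.comp_hasDerivAt (0 : ℝ) hA
    refine eventually_pos_of_hasDerivAt h3 ?_ ?_
    · rw [hφ0]
      exact (h.mem_iff.self_of_nhds.1 hu.1).2
    · have e : bil κ (inwardNormal κ S (u : E4 × E4).1) A = 1 := by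
        have := congrArg (bil κ (inwardNormal κ S (u : E4 × E4).1)) hAn
        rw [F.nn, bil_sub_right, bil_smul_right, F.nv] at this
        linarith
      rw [hdf A pA, e, mul_one]
      exact hl
  have hcc := (contDiff_cK κ).continuous
  have hsc := (contDiff_sK κ).continuous
  have hφc : ContinuousAt (fun s => (φ s : E4 × E4)) 0 := hφ.self_of_nhds.continuousAt
  have hgc : ContinuousAt (fun q : ℝ × ℝ => geod κ (φ q.1) q.2) (0, 0) := by
    have h1 : ContinuousAt (fun q : ℝ × ℝ => (φ q.1 : E4 × E4)) (0, 0) :=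
      ContinuousAt.comp (f := Prod.fst) (g := fun s => (φ s : E4 × E4)) hφc continuousAt_fst
    have h2 : ContinuousAt (fun q : ℝ × ℝ => q.2) (0, 0) := continuousAt_snd
    exact ((hcc.continuousAt.comp h2).smul h1.fst).add ((hsc.continuousAt.comp h2).smul h1.snd)
  have hg0 : geod κ (φ 0) 0 = (u : E4 × E4).1 := by rw [geod_zero, hφ0]
  have hgt : Tendsto (fun q : ℝ × ℝ => geod κ (φ q.1) q.2) (𝓝 (0, 0)) (𝓝 (u : E4 × E4).1) := by
    have := hgc.tendsto
    rwa [hg0] at this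
  obtain ⟨η, hη, hball⟩ := Metric.eventually_nhds_iff.1
    (hgt.eventually (h.mem_iff.and (h.smooth.mono fun x hx => hx.continuousAt)))
  have hsmall : ∀ a b : ℝ, 0 ≤ a → a < η → 0 ≤ b → b < η →
      (geod κ (φ a) b ∈ S ↔ geod κ (φ a) b ∈ spaceForm κ ∧ f (geod κ (φ a) b) = 0) ∧
        ContinuousAt f (geod κ (φ a) b) := by
    intro a b ha ha' hb hb'
    apply hball (y := (a, b))
    rw [Prod.dist_eq, max_lt_iff, Real.dist_0_eq_abs, Real.dist_0_eq_abs, abs_of_nonneg ha,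
      abs_of_nonneg hb]
    exact ⟨ha', hb'⟩
  have hlt : ∀ᶠ s in 𝓝[>] (0 : ℝ), s < η := nhdsWithin_le_nhds (gt_mem_nhds hη)
  obtain ⟨r, hr, hrη, hr0⟩ := (hneg.and (hlt.and self_mem_nhdsWithin)).exists
  have hr0 : 0 < r := hr0
  have hev : ∀ᶠ s in 𝓝 (0 : ℝ), f (geod κ (φ s) r) < 0 := by
    have h1 : ContinuousAt (fun s => geod κ (φ s) r) 0 :=
      (hφc.fst.const_smul (cK κ r)).add (hφc.snd.const_smul (sK κ r))
    have h2 : ContinuousAt (fun s => f (geod κ (φ s) r)) 0 :=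
      ContinuousAt.comp (f := fun s => geod κ (φ s) r) (g := f)
        (hsmall 0 r le_rfl hη hr0.le hrη).2 h1
    exact h2.eventually (gt_mem_nhds (by simp only [hφ0]; exact hr))
  obtain ⟨s, h1, h2, h3, h4, h5, hs0⟩ := (hpos.and ((hev.filter_mono nhdsWithin_le_nhds).and
    (hlt.and (hct.and ((hcφ.filter_mono nhdsWithin_le_nhds).and self_mem_nhdsWithin))))).exists
  have hs0 : 0 < s := hs0
  rw [h5] at h4
  have hcont : ContinuousOn (fun b => f (geod κ (φ s) b)) (Icc 0 r) := by
    intro b hb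
    refine ContinuousAt.continuousWithinAt ?_
    exact ContinuousAt.comp (f := fun b => geod κ (φ s) b) (g := f)
      (hsmall s b hs0.le h3 hb.1 (hb.2.trans_lt hrη)).2 (hasDerivAt_geod hκ _ _).continuousAt
  obtain ⟨b, hb, hb0⟩ := intermediate_value_Icc' hr0.le hcont
    (show (0 : ℝ) ∈ Icc _ _ from ⟨h2.le, by rw [geod_zero]; exact h1.le⟩)
  exact not_mem_of_mem_billiardTable h4 b
    ((hsmall s b hs0.le h3 hb.1 (hb.2.trans_lt hrη)).1.2
      ⟨geod_mem_spaceForm hκ (φ s).2.1 (φ s).2.2.1 (φ s).2.2.2 b, hb0⟩)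

theorem bil_one_le {x y : E4} (hx : bil 1 x x = 1) (hy : bil 1 y y = 1) : bil 1 x y ≤ 1 := by
  simp only [bil] at *
  nlinarith [sq_nonneg (x 0 - y 0), sq_nonneg (x 1 - y 1), sq_nonneg (x 2 - y 2),
    sq_nonneg (x 3 - y 3)]

theorem continuousOn_inwardNormal {κ : ℝ} (hκ : κ = 1 ∨ κ = -1) {S : Set E4}
    (hS : IsCompactSurface κ S) (hconv : StrictlyConvex κ S) :
    ContinuousOn (inwardNormal κ S) S := by
  intro p hp
  obtain ⟨ν, f, h, hν⟩ := exists_inwardNormal hκ hS hconv hp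
  refine h.smooth_normal.self_of_nhds.continuousAt.continuousWithinAt.congr_of_eventuallyEq ?_
    (hν.self_of_nhds hp).1
  filter_upwards [nhdsWithin_le_nhds hν, self_mem_nhdsWithin] with x hx hxS using (hx hxS).1

theorem isInwardNormal_inwardNormal {κ : ℝ} (hκ : κ = 1 ∨ κ = -1) {S : Set E4}
    (hS : IsCompactSurface κ S) (hconv : StrictlyConvex κ S) {p : E4} (hp : p ∈ S) :
    IsInwardNormal κ S p (inwardNormal κ S p) := by
  obtain ⟨ν, f, h, hν⟩ := exists_inwardNormal hκ hS hconv hp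
  obtain ⟨h1, h2⟩ := hν.self_of_nhds hp
  rwa [h1]

theorem bil_inwardNormal_pos {κ : ℝ} (hκ : κ = 1 ∨ κ = -1) {S : Set E4}
    (hS : IsCompactSurface κ S) (hconv : StrictlyConvex κ S) {p x : E4} (hp : p ∈ S) (hx : x ∈ S)
    (hxp : x ≠ p) : 0 < bil κ (inwardNormal κ S p) x := by
  obtain ⟨ν, f, h, hν⟩ := exists_inwardNormal hκ hS hconv hp
  obtain ⟨h1, h2⟩ := hν.self_of_nhds hp
  rw [h1]
  refine (h2.2.2.2 x hx).lt_of_ne' fun h0 => hxp ?_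
  exact hconv.eq_of_bil_eq_zero hκ hS.1 hp h2.1
    (fun w h3 h4 => (h.mem_tangentPlane_iff hκ hS.1 hp w).2 ⟨h3, h4⟩) hx h0

/-- Moving a tangent geodesic outwards makes it leave the surface. -/
theorem eventually_mem_billiardTable {κ : ℝ} (hκ : κ = 1 ∨ κ = -1) {S : Set E4}
    (hS : IsCompactSurface κ S) (hconv : StrictlyConvex κ S) {p v w : E4} (hp : p ∈ S)
    (F : IsFrame κ p (inwardNormal κ S p) v w) (φ : ℝ → unitTangentBundle κ)
    (hφ : ∀ s, (φ s : E4 × E4) = (cK κ s • p + sK κ s • (-inwardNormal κ S p), v)) :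
    ∀ᶠ s in 𝓝[>] (0 : ℝ), toGeodesic (φ s) ∈ billiardTable κ S := by
  have hin := fun {y} => isInwardNormal_inwardNormal hκ hS hconv (p := y)
  have hpos := fun {y x} => bil_inwardNormal_pos hκ hS hconv (p := y) (x := x)
  have hpM := hS.1 hp
  have hbn : ∀ s t, bil κ (inwardNormal κ S p) (geod κ (φ s) t) = -(cK κ t * sK κ s) := by
    intro s t
    simp only [geod, hφ, bil_add_right, bil_smul_right, bil_neg_right, F.np, F.nn, F.nv]
    ring
  have hlt : ∀ {a : ℝ}, 0 < a → ∀ᶠ s in 𝓝[>] (0 : ℝ), s < a := fun ha =>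
    nhdsWithin_le_nhds (gt_mem_nhds ha)
  have hcont := continuousOn_inwardNormal hκ hS hconv
  set n := inwardNormal κ S p with hn
  rcases hκ with rfl | rfl
  -- Spherical case. Since `⟨n, ·⟩ = -cos t sin s` along the pushed great circle, it can meet `S`
  -- only where `cos t ≤ 0`, hence `⟨p, ·⟩ ≤ 0`. On that compact part of `S`, `⟨n, ·⟩ ≥ δ`, which
  -- `sin s < δ` rules out.
  · obtain ⟨δ, hδ, hδS⟩ := (hS.2.1.inter_right (isClosed_le (continuous_bil 1 p)
      continuous_const : IsClosed {x | bil 1 p x ≤ 0})).exists_forall_le' (a := 0)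
      (continuous_bil 1 n).continuousOn (fun x hx => hpos hp hx.1 (by
        rintro rfl
        have : bil 1 x x ≤ 0 := hx.2
        rw [F.pp] at this
        linarith))
    -- This excludes the Gauss image. If `q = cos s p - sin s n` lies in `T_yS`, then `⟨y, q⟩ = 0`
    -- forces `⟨p, y⟩ ≤ 1/2`, so `⟨p, n(y)⟩ ≥ ε` by compactness and continuity of the normal,
    -- contradicting `⟨n(y), q⟩ = 0` when `sin s < ε / 2` and `cos s > 1/2`.
    obtain ⟨ε, hε, hεS⟩ := (hS.2.1.inter_right (isClosed_le (continuous_bil 1 p)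
      continuous_const : IsClosed {x | bil 1 p x ≤ 1 / 2})).exists_forall_le' (a := 0)
      (f := fun x => bil 1 p (inwardNormal 1 S x))
      ((continuous_bil 1 p).comp_continuousOn (hcont.mono inter_subset_left)) (fun x hx => by
        rw [bil_comm]
        refine hpos hx.1 hp ?_
        rintro rfl
        have : bil 1 p p ≤ 1 / 2 := hx.2
        rw [F.pp] at this
        linarith)
    have hsin : ∀ {a : ℝ}, 0 < a → ∀ᶠ s in 𝓝[>] (0 : ℝ), Real.sin s < a := fun ha =>
      ((Real.continuous_sin.tendsto 0).eventually
        (gt_mem_nhds (by rwa [Real.sin_zero]))).filter_mono nhdsWithin_le_nhds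
    have hcos : ∀ᶠ s in 𝓝[>] (0 : ℝ), 1 / 2 < Real.cos s :=
      ((Real.continuous_cos.tendsto 0).eventually
        (lt_mem_nhds (by rw [Real.cos_zero]; norm_num))).filter_mono nhdsWithin_le_nhds
    filter_upwards [hlt (by norm_num : (0 : ℝ) < 3), self_mem_nhdsWithin, hsin hδ,
      hsin (half_pos hε), hsin (by norm_num : (0 : ℝ) < 1 / 4), hcos]
      with s hs3 hs0 h1 h2 h3 h4
    have hs : 0 < Real.sin s := by rw [← sK_one]; exact sK_pos (Or.inl rfl) hs0 hs3
    refine ⟨φ s, rfl, fun t hmem => ?_, fun _ => ?_⟩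
    · have h5 := (hin hp).2.2.2 _ hmem
      rw [← hn, hbn, cK_one, sK_one] at h5
      have h6 : Real.cos t ≤ 0 := by
        by_contra hcon
        push Not at hcon
        nlinarith [mul_pos hcon hs]
      have h7 : bil 1 p (geod 1 (φ s) t) = Real.cos t * Real.cos s := by
        simp only [geod, hφ, bil_add_right, bil_smul_right, bil_neg_right, F.pp, F.pn, F.pv,
          cK_one]
        ring
      have h8 := hδS _ ⟨hmem, show bil 1 p (geod 1 (φ s) t) ≤ 0 by rw [h7]; nlinarith⟩
      rw [hbn, cK_one, sK_one] at h8
      nlinarith [Real.neg_one_le_cos t]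
    · rintro ⟨y, hy, hyT⟩
      have h5 := hyT 0
      rw [geod_zero, hφ, cK_one, sK_one] at h5
      have hyM := hS.1 hy
      have h6 : bil 1 y (Real.cos s • p + Real.sin s • -n) = 0 := by
        obtain ⟨σ, hσ, hd⟩ := h5
        have := bil_deriv_eq_zero (κ := 1) (hσ.1.mono fun r hr => hS.1 hr.2) hσ.hasDerivAt
        rwa [hd, hσ.2] at this
      have h7 := (hin hy).2.2.1 _ h5
      rw [bil_add_right, bil_smul_right, bil_smul_right, bil_neg_right, bil_comm 1 _ p] at h6 h7
      have h8 := bil_one_le hyM.1 F.nn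
      have h9 := bil_one_le (hin hy).2.1 F.nn
      have h10 : bil 1 p y ≤ 1 / 2 := by nlinarith
      have h11 := hεS y ⟨hy, h10⟩
      nlinarith
  -- Hyperbolic case: `⟨n, ·⟩ = -cosh t sinh s < 0` along the whole geodesic, while `S` lies in `⟨n,
  -- ·⟩ ≥ 0`.
  · filter_upwards [hlt (by norm_num : (0 : ℝ) < 3), self_mem_nhdsWithin] with s hs3 hs0
    refine ⟨φ s, rfl, fun t hmem => ?_, fun h => absurd h (by norm_num)⟩
    have h1 := (hin hp).2.2.2 _ hmem
    rw [← hn, hbn, cK_neg_one] at h1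
    have := mul_pos (Real.cosh_pos t) (sK_pos (Or.inr rfl) hs0 hs3)
    linarith

/-- Orthogonality to `Tℳ` kills `B` and the `w` component of `A`, the unit condition leaves `A =
±n`, and the position of `𝒰` selects the minus sign. -/
theorem isOutwardUnitNormal_iff {κ : ℝ} (hκ : κ = 1 ∨ κ = -1) {S : Set E4}
    (hS : IsCompactSurface κ S) (hconv : StrictlyConvex κ S) (hquad : QuadraticallyConvex κ S)
    {u : unitTangentBundle κ} (hu : u ∈ unitTangentSurface κ S) (ξ : ℝ → E4) :
    IsOutwardUnitNormal S u ξ ↔ ξ = jac κ (-inwardNormal κ S (u : E4 × E4).1) 0 := by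
  have hTM := mem_tangentSpaceM_iff hκ hS hconv hquad hu
  obtain ⟨hin, F⟩ := isFrame_rotated hκ hS hconv hu
  have hk0 : κ ≠ 0 := by rcases hκ with rfl | rfl <;> norm_num
  constructor
  · rintro ⟨hJ, h1, h2, c, hc, hct⟩
    obtain ⟨A, B, rfl, pA, vA, pB, vB⟩ := hJ.exists_eq_jac hκ
    have h3 : ∀ a b d : ℝ, a * bil κ (rotated S u).2 A + κ * (b * bil κ (rotated S u).2 B +
        d * bil κ (inwardNormal κ S (u : E4 × E4).1) B) = 0 := by
      intro a b d
      have := h2 _ ((hTM _).2 ⟨a, b, d, rfl⟩)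
      rw [gK_jac hκ u pB (by simp [bil_add_right, bil_smul_right, F.pw, F.pn])] at this
      rw [bil_smul_right, bil_add_right, bil_smul_right, bil_smul_right] at this
      rw [bil_comm κ _ A, bil_comm κ _ B, bil_comm κ _ B]
      exact this
    have wA : bil κ (rotated S u).2 A = 0 := by simpa using h3 1 0 0
    have wB : bil κ (rotated S u).2 B = 0 := by simpa [hk0] using h3 0 1 0
    have nB : bil κ (inwardNormal κ S (u : E4 × E4).1) B = 0 := by simpa [hk0] using h3 0 0 1
    have hB : B = 0 := F.eq_zero hκ pB nB vB wB
    have hA : A = bil κ (inwardNormal κ S (u : E4 × E4).1) A •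
        inwardNormal κ S (u : E4 × E4).1 := by
      apply F.ext hκ <;> simp [bil_smul_right, pA, vA, wA, F.pn, F.nn, F.vn, F.wn]
    set a := bil κ (inwardNormal κ S (u : E4 × E4).1) A
    have ha : a * a = 1 := by
      rw [gK_jac hκ u pB pB, hB, bil_zero_left, hA, bil_smul_left, bil_smul_right, F.nn] at h1
      linarith
    rcases mul_self_eq_one_iff.1 ha with h4 | h4
    · rw [hA, hB, h4, one_smul] at hc
      exact absurd hct (not_velocity_inward hκ hS hconv hu hc)
    · rw [hA, hB, h4, neg_one_smul]
  · rintro rfl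
    refine ⟨isNormalJacobi_jac hκ u ?_ ?_ ?_ ?_, ?_, ?_, ?_⟩
    · rw [bil_neg_right, F.pn, neg_zero]
    · rw [bil_neg_right, F.vn, neg_zero]
    · rw [bil_zero_right]
    · rw [bil_zero_right]
    · rw [gK_jac hκ u (bil_zero_right _ _) (bil_zero_right _ _), bil_zero_left, bil_neg_left,
        bil_neg_right, F.nn]
      ring
    · intro K hK
      obtain ⟨a, b, d, rfl⟩ := (hTM K).1 hK
      rw [gK_jac hκ u (bil_zero_right _ _)
        (by simp [bil_add_right, bil_smul_right, F.pw, F.pn]), bil_zero_left, bil_neg_left,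
        bil_smul_right, F.nw]
      ring
    · have hmem : ∀ s, (cK κ s • (u : E4 × E4).1 + sK κ s • (-inwardNormal κ S (u : E4 × E4).1),
          (u : E4 × E4).2) ∈ unitTangentBundle κ := by
        intro s
        refine ⟨geod_mem_spaceForm hκ u.2.1 ?_ ?_ s, ?_, F.vv⟩
        · rw [bil_neg_right, F.pn, neg_zero]
        · rw [bil_neg_left, bil_neg_right, F.nn, neg_neg]
        · simp [bil_add_left, bil_smul_left, bil_neg_left, F.pv, F.nv]
      let φ : ℝ → unitTangentBundle κ := fun s => ⟨_, hmem s⟩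
      have hφ0 : φ 0 = u := by
        apply Subtype.ext
        simp [φ, cK_zero, sK_zero]
      have hA : HasDerivAt (fun s => (φ s : E4 × E4).1)
          (-inwardNormal κ S (u : E4 × E4).1) 0 := by
        have := hasDerivAt_jac hκ (u : E4 × E4).1 (-inwardNormal κ S (u : E4 × E4).1) 0
        rwa [jac_zero] at this
      have hB : HasDerivAt (fun s => (φ s : E4 × E4).2) 0 0 := hasDerivAt_const _ _
      refine ⟨fun s => toGeodesic (φ s), ⟨φ, ?_, Eventually.of_forall fun s => rfl, hφ0, ?_⟩,
        eventually_mem_billiardTable hκ hS hconv hu.1 F φ fun s => rfl⟩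
      · exact Eventually.of_forall fun s =>
          ((contDiff_jac κ _ _).prodMk contDiff_const).contDiffAt
      · have := normalPart_variationField hκ hA hB
        rw [hφ0] at this
        rw [this, bil_neg_right, F.vn]
        simp

/-! ### A local parametrization of the space of geodesics -/

/-- Lets `rotate`, which moves along the last vector, be used for motion along `n`. -/
theorem IsFrame.swap {κ : ℝ} {p n v w : E4} (F : IsFrame κ p n v w) : IsFrame κ p w v n :=
  ⟨F.pp, F.pw, F.pv, F.pn, F.ww, F.wv, F.wn, F.vv, F.vn, F.nn⟩

theorem IsFrame.rotate {κ : ℝ} (hκ : κ = 1 ∨ κ = -1) {p n v w : E4} (F : IsFrame κ p n v w)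
    (t : ℝ) : IsFrame κ (geod κ (p, w) t) n v (geodVel κ (p, w) t) := by
  have hk := kappa_sq hκ
  have hc := cK_sq_add hκ t
  constructor <;> simp only [geod, geodVel, bil_add_left, bil_add_right, bil_smul_left,
    bil_smul_right, F.pp, F.pn, F.pv, F.pw, F.nn, F.nv, F.nw, F.vv, F.vw, F.ww, F.np, F.vp, F.wp,
    F.wn, F.wv]
  · linear_combination κ * hc - sK κ t ^ 2 * hk
  · ring
  · ring
  · linear_combination -cK κ t * sK κ t * hk
  · ring
  · ring
  · linear_combination hc + κ * sK κ t ^ 2 * hk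

/-- Foot points of the geodesics of the chart: the geodesic orthogonal to `n` and `v` with
parameter `y 0`, pushed by `y 1` in the direction `n`. -/
noncomputable def chartFoot (κ : ℝ) (p n w : E4) (y : Fin 4 → ℝ) : E4 :=
  geod κ (geod κ (p, w) (y 0), n) (y 1)

/-- The velocity of `y 1 ↦ chartFoot κ p n w y`. -/
noncomputable def chartNormal (κ : ℝ) (p n w : E4) (y : Fin 4 → ℝ) : E4 :=
  geodVel κ (geod κ (p, w) (y 0), n) (y 1)

/-- Initial velocities of the geodesics of the chart: the vector `v`, rotated by the angle `y 2`
towards `chartNormal` and by the angle `y 3` towards the velocity of the base geodesic. -/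
noncomputable def chartDir (κ : ℝ) (p n v w : E4) (y : Fin 4 → ℝ) : E4 :=
  Real.cos (y 3) • (Real.cos (y 2) • v + Real.sin (y 2) • chartNormal κ p n w y)
    + Real.sin (y 3) • geodVel κ (p, w) (y 0)

/-- Coordinates of the derivative of `chartFoot` in the direction `h` in the moving frame. -/
noncomputable def footCoord (κ : ℝ) (y h : Fin 4 → ℝ) : E4 := ![0, h 1, 0, cK κ (y 1) * h 0]

/-- Coordinates of the derivative of `chartDir` in the direction `h` in the moving frame. -/
noncomputable def dirCoord (κ : ℝ) (y h : Fin 4 → ℝ) : E4 :=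
  ![-κ * (Real.cos (y 3) * Real.sin (y 2) * h 1 + Real.sin (y 3) * cK κ (y 1) * h 0),
    -(Real.sin (y 3) * Real.sin (y 2) * h 3) + Real.cos (y 3) * Real.cos (y 2) * h 2
      + κ * Real.sin (y 3) * sK κ (y 1) * h 0,
    -(Real.sin (y 3) * Real.cos (y 2) * h 3) - Real.cos (y 3) * Real.sin (y 2) * h 2,
    Real.cos (y 3) * h 3 - κ * Real.cos (y 3) * Real.sin (y 2) * sK κ (y 1) * h 0]

/-- The vector with the given coordinates in a frame. -/
def ofCoord (p n v w x : E4) : E4 := x 0 • p + x 1 • n + x 2 • v + x 3 • w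

theorem IsFrame.bil_ofCoord {κ : ℝ} {p n v w : E4} (F : IsFrame κ p n v w) (x y : E4) :
    bil κ (ofCoord p n v w x) (ofCoord p n v w y) = bil κ x y := by
  simp only [ofCoord, bil_add_left, bil_add_right, bil_smul_left,
    bil_smul_right, F.pp, F.pn, F.pv, F.pw, F.nn, F.nv, F.nw, F.vv, F.vw, F.ww, F.np, F.vp, F.wp,
    F.vn, F.wn, F.wv]
  simp only [bil]; ring

theorem IsFrame.ofCoord_eq_zero {κ : ℝ} (hκ : κ = 1 ∨ κ = -1) {p n v w x : E4}
    (F : IsFrame κ p n v w) (h : ofCoord p n v w x = 0) : x = 0 := by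
  have hk0 : κ ≠ 0 := by rcases hκ with rfl | rfl <;> norm_num
  have h1 : ∀ y, bil κ x y = 0 := fun y => by rw [← F.bil_ofCoord, h, bil_zero_left]
  apply E4_ext
  · simpa [bil, hk0] using h1 ![1, 0, 0, 0]
  · simpa [bil] using h1 ![0, 1, 0, 0]
  · simpa [bil] using h1 ![0, 0, 1, 0]
  · simpa [bil] using h1 ![0, 0, 0, 1]

section Chart

variable {κ : ℝ} {p n v w : E4}

theorem isFrame_chart (hκ : κ = 1 ∨ κ = -1) (F : IsFrame κ p n v w) (y : Fin 4 → ℝ) :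
    IsFrame κ (chartFoot κ p n w y) (chartNormal κ p n w y) v (geodVel κ (p, w) (y 0)) :=
  ((F.rotate hκ (y 0)).swap.rotate hκ (y 1)).swap

theorem chartDir_eq_ofCoord (y : Fin 4 → ℝ) : chartDir κ p n v w y =
    ofCoord (chartFoot κ p n w y) (chartNormal κ p n w y) v (geodVel κ (p, w) (y 0))
      ![0, Real.cos (y 3) * Real.sin (y 2), Real.cos (y 3) * Real.cos (y 2), Real.sin (y 3)] := by
  funext i
  simp [chartDir, ofCoord]; ring

/-- The local parametrization `y ↦ (chartFoot y, chartDir y)`. -/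
noncomputable def chart (hκ : κ = 1 ∨ κ = -1) (hp : p ∈ spaceForm κ) (F : IsFrame κ p n v w)
    (y : Fin 4 → ℝ) : unitTangentBundle κ :=
  ⟨(chartFoot κ p n w y, chartDir κ p n v w y), by
    have G := isFrame_chart hκ F y
    have G1 := F.rotate hκ (y 0)
    refine ⟨geod_mem_spaceForm hκ (geod_mem_spaceForm hκ hp F.pw F.ww (y 0)) G1.pn G1.nn (y 1),
      ?_, ?_⟩
    · simp [chartDir, bil_add_right, bil_smul_right, G.pn, G.pv, G.pw]
    · simp only [chartDir_eq_ofCoord, G.bil_ofCoord]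
      simp [bil]
      linear_combination Real.cos (y 3) ^ 2 * Real.sin_sq_add_cos_sq (y 2)
        + Real.sin_sq_add_cos_sq (y 3)⟩

theorem contDiff_chart (hκ : κ = 1 ∨ κ = -1) (hp : p ∈ spaceForm κ) (F : IsFrame κ p n v w) :
    ContDiff ℝ ∞ (fun y => (chart hκ hp F y : E4 × E4)) := by
  have hc := contDiff_cK κ
  have hs := contDiff_sK κ
  have hy : ∀ i : Fin 4, ContDiff ℝ ∞ (fun y : Fin 4 → ℝ => y i) := fun i => contDiff_apply ℝ ℝ i
  have hci := fun i => hc.comp (hy i)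
  have hsi := fun i => hs.comp (hy i)
  simp only [Function.comp_def] at hci hsi
  have hP : ContDiff ℝ ∞ (fun y : Fin 4 → ℝ => geod κ (p, w) (y 0)) :=
    ((hci 0).smul contDiff_const).add ((hsi 0).smul contDiff_const)
  have hT : ContDiff ℝ ∞ (fun y : Fin 4 → ℝ => geodVel κ (p, w) (y 0)) :=
    ((contDiff_const.mul (hsi 0)).neg.smul contDiff_const).add ((hci 0).smul contDiff_const)
  have hX : ContDiff ℝ ∞ (fun y : Fin 4 → ℝ => chartFoot κ p n w y) :=
    ((hci 1).smul hP).add ((hsi 1).smul contDiff_const)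
  have hN : ContDiff ℝ ∞ (fun y : Fin 4 → ℝ => chartNormal κ p n w y) :=
    ((contDiff_const.mul (hsi 1)).neg.smul hP).add ((hci 1).smul contDiff_const)
  refine hX.prodMk ?_
  exact ((hy 3).cos.smul (((hy 2).cos.smul contDiff_const).add ((hy 2).sin.smul hN))).add
    ((hy 3).sin.smul hT)

/-- The derivatives are written in the moving frame of `isFrame_chart`, so that all inner products
depend only on the coordinates `footCoord` and `dirCoord`. -/
theorem hasDerivAt_chart (hκ : κ = 1 ∨ κ = -1) (y h : Fin 4 → ℝ) :
    HasDerivAt (fun s : ℝ => chartFoot κ p n w (y + s • h))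
      (ofCoord (chartFoot κ p n w y) (chartNormal κ p n w y) v (geodVel κ (p, w) (y 0))
        (footCoord κ y h)) 0 ∧
    HasDerivAt (fun s : ℝ => chartDir κ p n v w (y + s • h))
      (ofCoord (chartFoot κ p n w y) (chartNormal κ p n w y) v (geodVel κ (p, w) (y 0))
        (dirCoord κ y h)) 0 := by
  have hy : ∀ i, HasDerivAt (fun s : ℝ => (y + s • h) i) (h i) 0 := by
    intro i
    simpa using ((hasDerivAt_id (0 : ℝ)).mul_const (h i)).const_add (y i)
  have h0 : ∀ i, (y + (0 : ℝ) • h) i = y i := by intro i; simp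
  have comp : ∀ {E : Type} [NormedAddCommGroup E] [NormedSpace ℝ E] {g : ℝ → E} {g' : E} {i},
      HasDerivAt g g' (y i) → HasDerivAt (fun s : ℝ => g ((y + s • h) i)) (h i • g') 0 := by
    intro E _ _ g g' i hg
    rw [← h0 i] at hg
    exact hg.scomp (0 : ℝ) (hy i)
  have hP := comp (hasDerivAt_geod hκ (p, w) (y 0))
  have hT := comp (hasDerivAt_geodVel hκ (p, w) (y 0))
  have hc := comp (hasDerivAt_cK hκ (y 1))
  have hs := comp (hasDerivAt_sK hκ (y 1))
  have hX := (hc.fun_smul hP).fun_add (hs.smul_const n)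
  have hN := (((hs.const_mul κ).fun_neg).fun_smul hP).fun_add (hc.smul_const n)
  have hcb := comp (Real.hasDerivAt_cos (y 2))
  have hsb := comp (Real.hasDerivAt_sin (y 2))
  have hcd := comp (Real.hasDerivAt_cos (y 3))
  have hsd := comp (Real.hasDerivAt_sin (y 3))
  have hD := (hcd.fun_smul ((hcb.smul_const v).fun_add (hsb.fun_smul hN))).fun_add
    (hsd.fun_smul hT)
  have hk := cK_sq_add hκ (y 1)
  constructor
  · refine hX.congr_deriv ?_
    funext i
    simp only [h0, ofCoord, footCoord, chartNormal, geodVel, Pi.add_apply, Pi.smul_apply,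
      smul_eq_mul, Matrix.cons_val]
    ring
  · refine hD.congr_deriv ?_
    funext i
    have e1 : chartFoot κ p n w y i = cK κ (y 1) * geod κ (p, w) (y 0) i + sK κ (y 1) * n i := rfl
    have e2 : chartNormal κ p n w y i =
        -(κ * sK κ (y 1)) * geod κ (p, w) (y 0) i + cK κ (y 1) * n i := rfl
    simp only [h0, ofCoord, dirCoord, e1, e2, Pi.add_apply, Pi.smul_apply, smul_eq_mul,
      Matrix.cons_val]
    linear_combination κ * Real.sin (y 3) * h 0 * geod κ (p, w) (y 0) i * hk

theorem paramDeriv_chart (hκ : κ = 1 ∨ κ = -1) (hp : p ∈ spaceForm κ) (F : IsFrame κ p n v w)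
    (y h : Fin 4 → ℝ) (A B : E4)
    (hA : A = ofCoord (chartFoot κ p n w y) (chartNormal κ p n w y) v (geodVel κ (p, w) (y 0))
        (footCoord κ y h))
    (hB : B = ofCoord (chartFoot κ p n w y) (chartNormal κ p n w y) v (geodVel κ (p, w) (y 0))
        (dirCoord κ y h)) :
    paramDeriv (chart hκ hp F) y h =
      jac κ (A - bil κ (chartDir κ p n v w y) A • chartDir κ p n v w y)
        (B + (κ * bil κ (chartDir κ p n v w y) A) • chartFoot κ p n w y) ∧
    bil κ (chartFoot κ p n w y) A = 0 ∧ bil κ (chartDir κ p n v w y) B = 0 ∧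
      bil κ (chartFoot κ p n w y) B + bil κ (chartDir κ p n v w y) A = 0 := by
  obtain ⟨h1, h2⟩ := hasDerivAt_chart (p := p) (n := n) (v := v) (w := w) hκ y h
  rw [← hA] at h1
  rw [← hB] at h2
  have h3 := normalPart_variationField (φ := fun s : ℝ => chart hκ hp F (y + s • h)) hκ h1 h2
  have h4 := lift_relations (φ := fun s : ℝ => chart hκ hp F (y + s • h)) h1 h2
  have e : y + (0 : ℝ) • h = y := by simp
  simp only [e] at h3 h4
  exact ⟨h3, h4⟩

/-- The metric `g_K` in the coordinates of `chart`; it does not depend on `y 0`. -/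
noncomputable def chartMetric (κ : ℝ) (y h k : Fin 4 → ℝ) : ℝ :=
  bil κ (footCoord κ y h) (footCoord κ y k) + κ * bil κ (dirCoord κ y h) (dirCoord κ y k)
    - 2 * (Real.cos (y 3) * Real.sin (y 2) * h 1 + Real.sin (y 3) * (cK κ (y 1) * h 0))
      * (Real.cos (y 3) * Real.sin (y 2) * k 1 + Real.sin (y 3) * (cK κ (y 1) * k 0))

/-- With `m`, `m'` the components of the foot velocities along the geodesic, passing to normal parts
subtracts `m m'` once from the value term and once from the derivative term; hence the factor `2` in
`chartMetric`. -/
theorem gK_chart (hκ : κ = 1 ∨ κ = -1) (hp : p ∈ spaceForm κ) (F : IsFrame κ p n v w)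
    (y h k : Fin 4 → ℝ) :
    gK (chart hκ hp F y) (paramDeriv (chart hκ hp F) y h) (paramDeriv (chart hκ hp F) y k) =
      chartMetric κ y h k := by
  have hk := kappa_sq hκ
  have G := isFrame_chart hκ F y
  obtain ⟨e1, a1, a2, a3⟩ := paramDeriv_chart hκ hp F y h _ _ rfl rfl
  obtain ⟨e2, b1, b2, b3⟩ := paramDeriv_chart hκ hp F y k _ _ rfl rfl
  have d1 : ∀ x : E4, bil κ (chartDir κ p n v w y) (ofCoord (chartFoot κ p n w y)
      (chartNormal κ p n w y) v (geodVel κ (p, w) (y 0)) x) =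
      Real.cos (y 3) * Real.sin (y 2) * x 1 + Real.cos (y 3) * Real.cos (y 2) * x 2
        + Real.sin (y 3) * x 3 := by
    intro x
    rw [chartDir_eq_ofCoord, G.bil_ofCoord]
    simp [bil]
  have m1 := d1 (footCoord κ y h)
  have m2 := d1 (footCoord κ y k)
  have i1 := G.bil_ofCoord (footCoord κ y h) (footCoord κ y k)
  have i2 := G.bil_ofCoord (dirCoord κ y h) (dirCoord κ y k)
  have yy : bil κ (chartDir κ p n v w y) (chartDir κ p n v w y) = 1 := (chart hκ hp F y).2.2.2
  have xx := G.pp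
  rw [e1, e2]
  generalize ofCoord (chartFoot κ p n w y) (chartNormal κ p n w y) v (geodVel κ (p, w) (y 0))
    (footCoord κ y h) = A at *
  generalize ofCoord (chartFoot κ p n w y) (chartNormal κ p n w y) v (geodVel κ (p, w) (y 0))
    (dirCoord κ y h) = B at *
  generalize ofCoord (chartFoot κ p n w y) (chartNormal κ p n w y) v (geodVel κ (p, w) (y 0))
    (footCoord κ y k) = A' at *
  generalize ofCoord (chartFoot κ p n w y) (chartNormal κ p n w y) v (geodVel κ (p, w) (y 0))
    (dirCoord κ y k) = B' at *
  have c1 : bil κ (chartFoot κ p n w y)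
      (B + (κ * bil κ (chartDir κ p n v w y) A) • chartFoot κ p n w y) = 0 := by
    rw [bil_add_right, bil_smul_right, xx]
    linear_combination a3 + bil κ (chartDir κ p n v w y) A * hk
  have c2 : bil κ (chartFoot κ p n w y)
      (B' + (κ * bil κ (chartDir κ p n v w y) A') • chartFoot κ p n w y) = 0 := by
    rw [bil_add_right, bil_smul_right, xx]
    linear_combination b3 + bil κ (chartDir κ p n v w y) A' * hk
  rw [gK_jac hκ _ c1 c2, bil_add_left, bil_smul_left, c2, bil_add_right, bil_smul_right,
    bil_comm κ B (chartFoot κ p n w y), bil_sub_left, bil_sub_right, bil_sub_right, bil_smul_left,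
    bil_smul_left, bil_smul_right, bil_smul_right, yy, bil_comm κ A (chartDir κ p n v w y),
    i1, i2, chartMetric]
  simp only [footCoord, Matrix.cons_val, mul_zero, add_zero] at m1 m2
  rw [← m1, ← m2]
  linear_combination bil κ (chartDir κ p n v w y) A' * κ * κ * a3
    - bil κ (chartDir κ p n v w y) A' * bil κ (chartDir κ p n v w y) A * hk

theorem cK_pos {r : ℝ} (hκ : κ = 1 ∨ κ = -1) (h : |r| < 1) : 0 < cK κ r := by
  rcases hκ with rfl | rfl
  · rw [cK_one]
    have := Real.pi_gt_three
    exact Real.cos_pos_of_mem_Ioo ⟨by linarith [(abs_lt.1 h).1], by linarith [(abs_lt.1 h).2]⟩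
  · rw [cK_neg_one]; exact Real.cosh_pos r

theorem eq_of_cK_sK {s t : ℝ} (hκ : κ = 1 ∨ κ = -1) (hc : cK κ s = cK κ t) (hs : sK κ s = sK κ t)
    (h : |s - t| < 3) : s = t := by
  have h0 : sK κ (s - t) = 0 := by
    rcases hκ with rfl | rfl
    · simp only [sK_one, cK_one] at *
      rw [Real.sin_sub, hc, hs]; ring
    · simp only [sK_neg_one, cK_neg_one] at *
      rw [Real.sinh_sub, hc, hs]; ring
  have hodd : ∀ r, sK κ (-r) = -sK κ r := by
    intro r
    rcases hκ with rfl | rfl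
    · simp only [sK_one, Real.sin_neg]
    · simp only [sK_neg_one, Real.sinh_neg]
  rcases lt_trichotomy (s - t) 0 with h1 | h1 | h1
  · have := sK_pos hκ (neg_pos.2 h1) (by linarith [(abs_lt.1 h).1])
    rw [hodd, h0] at this
    linarith
  · linarith
  · have := sK_pos hκ h1 (abs_lt.1 h).2
    linarith

/-- The domain of the chart around the parameter value `t₀`. -/
def chartDomain (t₀ : ℝ) : Set (Fin 4 → ℝ) :=
  {y | |y 0 - t₀| < 1 ∧ |y 1| < 1 ∧ |y 2| < 1 ∧ |y 3| < 1}

theorem sin_injective_of_abs {a b : ℝ} (ha : |a| < 1) (hb : |b| < 1)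
    (h : Real.sin a = Real.sin b) : a = b := by
  have := Real.pi_gt_three
  exact Real.injOn_sin ⟨by linarith [(abs_lt.1 ha).1], by linarith [(abs_lt.1 ha).2]⟩
    ⟨by linarith [(abs_lt.1 hb).1], by linarith [(abs_lt.1 hb).2]⟩ h

theorem cos_pos_of_abs {a : ℝ} (ha : |a| < 1) : 0 < Real.cos a := by
  rw [← cK_one]; exact cK_pos (Or.inl rfl) ha

/-- Foot points are orthogonal to `v`, while directions have the positive `v` component `cos y₃ cos
y₂`. So a parameter shift `τ` between two chart geodesics has `s_κ τ = 0` and `c_κ τ = 1`: foot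
points and directions agree, and the coordinates can be read off. -/
theorem chart_injOn (hκ : κ = 1 ∨ κ = -1) (hp : p ∈ spaceForm κ) (F : IsFrame κ p n v w)
    (t₀ : ℝ) : InjOn (fun y => toGeodesic (chart hκ hp F y)) (chartDomain t₀) := by
  rintro x ⟨x0, x1, x2, x3⟩ y ⟨y0, y1, y2, y3⟩ hxy
  have hk0 : κ ≠ 0 := by rcases hκ with rfl | rfl <;> norm_num
  obtain ⟨τ, hτ⟩ := Quotient.exact hxy
  have Gx := isFrame_chart hκ F x
  have Gy := isFrame_chart hκ F y
  have vdir : ∀ z, bil κ v (chartDir κ p n v w z) = Real.cos (z 3) * Real.cos (z 2) := by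
    intro z
    have G := isFrame_chart hκ F z
    simp [chartDir, bil_add_right, bil_smul_right, G.vv, G.vn, G.vw]
  have hfoot : chartFoot κ p n w y =
      cK κ τ • chartFoot κ p n w x + sK κ τ • chartDir κ p n v w x := by
    have := hτ 0
    rwa [geod_zero, zero_add] at this
  have hdir : chartDir κ p n v w y =
      (-(κ * sK κ τ)) • chartFoot κ p n w x + cK κ τ • chartDir κ p n v w x := by
    have h1 := hasDerivAt_geod hκ (chart hκ hp F y : E4 × E4) 0
    have h2 := (hasDerivAt_geod hκ (chart hκ hp F x : E4 × E4) (0 + τ)).comp_add_const 0 τ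
    have h3 : geod κ (chart hκ hp F y : E4 × E4) =
        fun t => geod κ (chart hκ hp F x : E4 × E4) (t + τ) := funext hτ
    rw [h3] at h1
    have := h1.unique h2
    rwa [geodVel_zero, zero_add] at this
  have cx := mul_pos (cos_pos_of_abs x3) (cos_pos_of_abs x2)
  have cy := mul_pos (cos_pos_of_abs y3) (cos_pos_of_abs y2)
  have hs : sK κ τ = 0 := by
    have := congrArg (bil κ v) hfoot
    rw [bil_add_right, bil_smul_right, bil_smul_right, Gx.vp, Gy.vp, vdir] at this
    have : sK κ τ * (Real.cos (x 3) * Real.cos (x 2)) = 0 := by linarith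
    exact (mul_eq_zero.1 this).resolve_right cx.ne'
  have hc : cK κ τ = 1 := by
    have h1 := cK_sq_add hκ τ
    rw [hs] at h1
    have := congrArg (bil κ v) hdir
    rw [bil_add_right, bil_smul_right, bil_smul_right, Gx.vp, vdir, vdir] at this
    have h2 : 0 < cK κ τ := by
      by_contra hcon
      push Not at hcon
      nlinarith
    nlinarith
  rw [hs, hc] at hfoot hdir
  simp only [one_smul, zero_smul, add_zero, mul_zero, neg_zero, zero_add] at hfoot hdir
  have cx1 := cK_pos hκ x1
  have cy1 := cK_pos hκ y1
  have s1 : sK κ (y 1) = sK κ (x 1) := by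
    have := congrArg (bil κ n) hfoot
    simpa [chartFoot, geod, bil_add_right, bil_smul_right, F.np, F.nw, F.nn] using this
  have c1 : cK κ (y 1) = cK κ (x 1) := by
    have h1 := cK_sq_add hκ (y 1)
    have h2 := cK_sq_add hκ (x 1)
    rw [s1] at h1
    nlinarith
  have e1 : y 1 = x 1 := eq_of_cK_sK hκ c1 s1 (by
    rw [abs_lt] at *; constructor <;> linarith)
  have c0 : cK κ (y 0) = cK κ (x 0) := by
    have := congrArg (bil κ p) hfoot
    simp only [chartFoot, geod, bil_add_right, bil_smul_right, F.pp, F.pw, F.pn, c1, mul_zero,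
      add_zero] at this
    exact mul_right_cancel₀ hk0 (mul_left_cancel₀ cx1.ne' this)
  have s0 : sK κ (y 0) = sK κ (x 0) := by
    have := congrArg (bil κ w) hfoot
    simp only [chartFoot, geod, bil_add_right, bil_smul_right, F.wp, F.ww, F.wn, c1, mul_zero,
      add_zero, zero_add, mul_one] at this
    exact mul_left_cancel₀ cx1.ne' this
  have e0 : y 0 = x 0 := eq_of_cK_sK hκ c0 s0 (by
    rw [abs_lt] at *; constructor <;> linarith)
  have hN : chartNormal κ p n w y = chartNormal κ p n w x := by
    simp only [chartNormal, e0, e1]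
  have e3 : y 3 = x 3 := by
    have := congrArg (bil κ (geodVel κ (p, w) (y 0))) hdir
    rw [chartDir, chartDir, hN, e0] at this
    simp only [bil_add_right, bil_smul_right, Gx.wv, Gx.wn, Gx.ww, mul_zero, add_zero, zero_add,
      mul_one] at this
    exact sin_injective_of_abs y3 x3 this
  have e2 : y 2 = x 2 := by
    have := congrArg (bil κ (chartNormal κ p n w x)) hdir
    rw [chartDir, chartDir, hN, e0, e3] at this
    simp only [bil_add_right, bil_smul_right, Gx.nv, Gx.nw, Gx.nn, mul_zero, add_zero, zero_add,
      mul_one] at this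
    exact sin_injective_of_abs y2 x2 (mul_left_cancel₀ (cos_pos_of_abs x3).ne' this)
  funext i
  fin_cases i
  exacts [e0.symm, e1.symm, e2.symm, e3.symm]

/-- The foot velocity has no `v` component but the direction has one, so if the normal part vanishes
then so does the tangential component, and all frame coordinates of both derivatives are zero. -/
theorem paramDeriv_chart_ne_zero (hκ : κ = 1 ∨ κ = -1) (hp : p ∈ spaceForm κ)
    (F : IsFrame κ p n v w) {t₀ : ℝ} {y : Fin 4 → ℝ} (hy : y ∈ chartDomain t₀) {h : Fin 4 → ℝ}
    (hh : h ≠ 0) : paramDeriv (chart hκ hp F) y h ≠ 0 := by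
  intro h0
  apply hh
  obtain ⟨y0, y1, y2, y3⟩ := hy
  have G := isFrame_chart hκ F y
  obtain ⟨e, -, -, -⟩ := paramDeriv_chart hκ hp F y h _ _ rfl rfl
  rw [h0, show (0 : ℝ → E4) = jac κ 0 0 by funext r; simp [jac]] at e
  obtain ⟨hA, hB⟩ := jac_injective hκ e
  have c2 := cos_pos_of_abs y2
  have c3 := cos_pos_of_abs y3
  set A := ofCoord (chartFoot κ p n w y) (chartNormal κ p n w y) v (geodVel κ (p, w) (y 0))
    (footCoord κ y h) with hAdef
  have hm : bil κ (chartDir κ p n v w y) A = 0 := by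
    have h1 := congrArg (bil κ v) hA
    have h2 : bil κ v A = 0 := by
      simp [hAdef, ofCoord, footCoord, bil_add_right, bil_smul_right, G.vn, G.vw]
    have h3 : bil κ v (chartDir κ p n v w y) = Real.cos (y 3) * Real.cos (y 2) := by
      simp [chartDir, bil_add_right, bil_smul_right, G.vv, G.vn, G.vw]
    rw [bil_zero_right, bil_sub_right, bil_smul_right, h2, h3] at h1
    have h4 : bil κ (chartDir κ p n v w y) A * (Real.cos (y 3) * Real.cos (y 2)) = 0 := by
      linarith
    exact (mul_eq_zero.1 h4).resolve_right (mul_pos c3 c2).ne'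
  rw [hm, zero_smul, sub_zero, hAdef] at hA
  rw [hm, mul_zero, zero_smul, add_zero] at hB
  have hA' := G.ofCoord_eq_zero hκ hA.symm
  have hB' := G.ofCoord_eq_zero hκ hB.symm
  have a1 : h 1 = 0 := congrFun hA' 1
  have a0 : h 0 = 0 := (mul_eq_zero.1 (congrFun hA' 3)).resolve_left (cK_pos hκ y1).ne'
  have b3 := congrFun hB' 3
  have b1 := congrFun hB' 1
  simp only [dirCoord, a0, a1, Matrix.cons_val, Pi.zero_apply, mul_zero, sub_zero, add_zero,
    mul_eq_zero, c3.ne', false_or] at b3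
  simp only [dirCoord, a0, a1, b3, Matrix.cons_val, Pi.zero_apply, mul_zero, neg_zero, zero_add,
    add_zero, mul_eq_zero, c3.ne', c2.ne', false_or] at b1
  funext i
  fin_cases i
  exacts [a0, a1, b1, b3]

theorem isLocalParam_chart (hκ : κ = 1 ∨ κ = -1) (hp : p ∈ spaceForm κ)
    (F : IsFrame κ p n v w) (t₀ : ℝ) : IsLocalParam (chartDomain t₀) (chart hκ hp F) := by
  refine ⟨?_, (contDiff_chart hκ hp F).contDiffOn, chart_injOn hκ hp F t₀,
    fun y hy h hh => paramDeriv_chart_ne_zero hκ hp F hy hh⟩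
  have hc : ∀ i : Fin 4, Continuous (fun y : Fin 4 → ℝ => y i) := continuous_apply
  exact (isOpen_lt ((hc 0).sub continuous_const).abs continuous_const).inter
    ((isOpen_lt (hc 1).abs continuous_const).inter
      ((isOpen_lt (hc 2).abs continuous_const).inter (isOpen_lt (hc 3).abs continuous_const)))

/-! ### The geodesic equation -/

theorem differentiable_chartMetric (h k : Fin 4 → ℝ) :
    Differentiable ℝ (fun y => chartMetric κ y h k) := by
  have hc : Differentiable ℝ (cK κ) := (contDiff_cK κ).differentiable (by simp)
  have hs : Differentiable ℝ (sK κ) := (contDiff_sK κ).differentiable (by simp)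
  have hc1 : Differentiable ℝ (fun y : Fin 4 → ℝ => cK κ (y 1)) :=
    hc.comp (differentiable_apply 1)
  have hs1 : Differentiable ℝ (fun y : Fin 4 → ℝ => sK κ (y 1)) :=
    hs.comp (differentiable_apply 1)
  simp only [chartMetric, footCoord, dirCoord, bil, Matrix.cons_val]
  fun_prop

theorem metricPartial_chart (hκ : κ = 1 ∨ κ = -1) (hp : p ∈ spaceForm κ)
    (F : IsFrame κ p n v w) (y : Fin 4 → ℝ) (m i j : Fin 4) :
    metricPartial (chart hκ hp F) y m i j = deriv (fun s : ℝ =>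
      chartMetric κ (y + s • Pi.single m 1) (Pi.single i 1) (Pi.single j 1)) 0 := by
  have e : (fun y => metricMatrix (chart hκ hp F) y i j) =
      fun y => chartMetric κ y (Pi.single i 1) (Pi.single j 1) := by
    funext y
    simp only [metricMatrix, Matrix.of_apply, gK_chart]
  rw [metricPartial, e]
  exact ((differentiable_chartMetric _ _ y).lineDeriv_eq_fderiv).symm

/-- A shift of `y 0` comes from the isometries of `M_κ` translating along `γ_w`. -/
theorem metricPartial_chart_zero (hκ : κ = 1 ∨ κ = -1) (hp : p ∈ spaceForm κ)
    (F : IsFrame κ p n v w) (y : Fin 4 → ℝ) (i j : Fin 4) :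
    metricPartial (chart hκ hp F) y 0 i j = 0 := by
  rw [metricPartial_chart]
  have : (fun s : ℝ => chartMetric κ (y + s • Pi.single 0 1) (Pi.single i 1) (Pi.single j 1)) =
      fun _ => chartMetric κ y (Pi.single i 1) (Pi.single j 1) := by
    funext s
    simp [chartMetric, footCoord, dirCoord]
  rw [this, deriv_const]

/-- On the lines leaving the axis in the directions `1, 2, 3`, `g_00` equals `c_κ(s)²`, `1` and `1 -
sin² s`, each critical at `s = 0`. -/
theorem metricPartial_chart_of_base (hκ : κ = 1 ∨ κ = -1) (hp : p ∈ spaceForm κ)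
    (F : IsFrame κ p n v w) (t : ℝ) (l : Fin 4) :
    metricPartial (chart hκ hp F) (Pi.single 0 t) l 0 0 = 0 := by
  by_cases hl : l = 0
  · rw [hl, metricPartial_chart_zero]
  rw [metricPartial_chart]
  have hk := kappa_sq hκ
  fin_cases l
  · exact absurd rfl hl
  · have : (fun s : ℝ => chartMetric κ (Pi.single 0 t + s • Pi.single 1 1) (Pi.single 0 1)
        (Pi.single 0 1)) = fun s => cK κ s * cK κ s := by
      funext s
      simp [chartMetric, footCoord, dirCoord, bil]
    simp only [Fin.mk_one, this]
    rw [((hasDerivAt_cK hκ 0).fun_mul (hasDerivAt_cK hκ 0)).deriv]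
    simp [sK_zero]
  · have : (fun s : ℝ => chartMetric κ (Pi.single 0 t + s • Pi.single 2 1) (Pi.single 0 1)
        (Pi.single 0 1)) = fun s => 1 := by
      funext s
      simp [chartMetric, footCoord, dirCoord, bil, cK_zero, sK_zero]
    exact (congrArg (fun g => deriv g 0) this).trans (deriv_const _ _)
  · have : (fun s : ℝ => chartMetric κ (Pi.single 0 t + s • Pi.single 3 1) (Pi.single 0 1)
        (Pi.single 0 1)) = fun s => 1 - Real.sin s * Real.sin s := by
      funext s
      simp [chartMetric, footCoord, dirCoord, bil, cK_zero, sK_zero]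
      linear_combination (Real.sin s * Real.sin s * (κ * κ + 1)) * hk
    refine (congrArg (fun g => deriv g 0) this).trans ?_
    rw [(((Real.hasDerivAt_sin 0).fun_mul (Real.hasDerivAt_sin 0)).const_sub 1).deriv]
    simp

/-- Lowered, this symbol is `∂_0 g_0l - ½ ∂_l g_00`, and both terms vanish; the inverse metric need
not be computed. -/
theorem christoffel_chart (hκ : κ = 1 ∨ κ = -1) (hp : p ∈ spaceForm κ)
    (F : IsFrame κ p n v w) (t : ℝ) (k : Fin 4) :
    christoffel (chart hκ hp F) (Pi.single 0 t) k 0 0 = 0 := by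
  simp [christoffel, metricPartial_chart_zero, metricPartial_chart_of_base]

theorem isGeodesicGK_of_chart (hκ : κ = 1 ∨ κ = -1) (hp : p ∈ spaceForm κ)
    (F : IsFrame κ p n v w) {c : ℝ → OrientedGeodesic κ}
    (hc : ∀ t, c t = toGeodesic (chart hκ hp F (Pi.single 0 t))) : IsGeodesicGK c := by
  intro t₀
  refine ⟨chartDomain t₀, chart hκ hp F, fun t => Pi.single 0 t, isLocalParam_chart hκ hp F t₀, ?_⟩
  have hd : ∀ t : ℝ, HasDerivAt (fun t : ℝ => (Pi.single 0 t : Fin 4 → ℝ)) (Pi.single 0 1) t := by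
    intro t
    refine hasDerivAt_pi.2 fun i => ?_
    by_cases hi : i = 0
    · subst hi; simpa using hasDerivAt_id' t
    · simpa [Pi.single_apply, hi] using hasDerivAt_const t (0 : ℝ)
  have hd' : deriv (fun t : ℝ => (Pi.single 0 t : Fin 4 → ℝ)) = fun _ => Pi.single 0 1 :=
    funext fun t => (hd t).deriv
  filter_upwards [Metric.ball_mem_nhds t₀ one_pos] with t ht
  refine ⟨⟨?_, ?_, ?_, ?_⟩, ?_, hc t, fun k => ?_⟩
  · rw [Metric.mem_ball, Real.dist_eq] at ht
    simpa using ht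
  · simp
  · simp
  · simp
  · refine contDiffAt_pi.2 fun i => ?_
    by_cases hi : i = 0
    · subst hi; simpa using contDiffAt_fun_id
    · simpa [Pi.single_apply, hi] using contDiffAt_const
  · rw [hd', deriv_const]
    have : ∀ i j, christoffel (chart hκ hp F) (Pi.single 0 t) k i j *
        (Pi.single 0 1 : Fin 4 → ℝ) i * (Pi.single 0 1 : Fin 4 → ℝ) j = 0 := by
      intro i j
      by_cases hi : i = 0
      · by_cases hj : j = 0
        · rw [hi, hj, christoffel_chart]; ring
        · simp [Pi.single_apply, hj]
      · simp [Pi.single_apply, hi]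
    simp [this]

end Chart

/-! ### The outer billiard -/

theorem cross_eq_normal {κ : ℝ} (hκ : κ = 1 ∨ κ = -1) {S : Set E4} {u : unitTangentBundle κ}
    (F : IsFrame κ (u : E4 × E4).1 (inwardNormal κ S (u : E4 × E4).1) (u : E4 × E4).2
      (rotated S u).2) :
    cross κ (u : E4 × E4).1 (u : E4 × E4).2 (rotated S u).2 =
      inwardNormal κ S (u : E4 × E4).1 := by
  rw [rotated, cross_cross κ hκ F.pp F.pn F.pv, F.vv, F.nv, one_smul, zero_smul, sub_zero]

theorem cross_normal {κ : ℝ} {S : Set E4} {u : unitTangentBundle κ} :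
    cross κ (u : E4 × E4).1 (u : E4 × E4).2 (inwardNormal κ S (u : E4 × E4).1) =
      -(rotated S u).2 :=
  cross_swap κ _ _ _

/-- `v × (-n) = n × v = iu`: rotating the outward normal gives the initial velocity of the billiard
curve. -/
theorem complexStructure_normal {κ : ℝ} (hκ : κ = 1 ∨ κ = -1) {S : Set E4}
    {u : unitTangentBundle κ} :
    complexStructure u (jac κ (-inwardNormal κ S (u : E4 × E4).1) 0) =
      jac κ (rotated S u).2 0 := by
  have h0 : cross κ (u : E4 × E4).1 (u : E4 × E4).2 0 = 0 := by
    have := cross_smul_right κ 0 (u : E4 × E4).1 (u : E4 × E4).2 0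
    rwa [zero_smul, zero_smul] at this
  rw [complexStructure_jac hκ, h0, ← neg_one_smul ℝ, cross_smul_right, cross_normal,
    neg_one_smul, neg_neg]

/-- As `u ⊥ iu`, the transported vector is constant in `ℝ⁴`; only the foot point moves. -/
theorem transported_eq {κ : ℝ} {S : Set E4} {u : unitTangentBundle κ}
    (F : IsFrame κ (u : E4 × E4).1 (inwardNormal κ S (u : E4 × E4).1) (u : E4 × E4).2
      (rotated S u).2) (t : ℝ) :
    transported S u t = (jac κ (u : E4 × E4).1 (rotated S u).2 t, (u : E4 × E4).2) := by
  rw [transported, parallelTransport, F.vw, zero_smul, add_zero]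
  rfl

theorem transported_mem {κ : ℝ} (hκ : κ = 1 ∨ κ = -1) {S : Set E4} {u : unitTangentBundle κ}
    (F : IsFrame κ (u : E4 × E4).1 (inwardNormal κ S (u : E4 × E4).1) (u : E4 × E4).2
      (rotated S u).2) (t : ℝ) : transported S u t ∈ unitTangentBundle κ := by
  rw [transported_eq F]
  refine ⟨geod_mem_spaceForm hκ u.2.1 F.pw F.ww t, ?_, F.vv⟩
  simp [jac, bil_add_left, bil_smul_left, F.pv, F.wv]

theorem isGeodesicGK_billiardF {κ : ℝ} (hκ : κ = 1 ∨ κ = -1) {S : Set E4}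
    {u : unitTangentBundle κ}
    (F : IsFrame κ (u : E4 × E4).1 (inwardNormal κ S (u : E4 × E4).1) (u : E4 × E4).2
      (rotated S u).2) : IsGeodesicGK (billiardF S u) := by
  refine isGeodesicGK_of_chart hκ u.2.1 F fun t => ?_
  rw [billiardF, dif_pos (transported_mem hκ F t)]
  congr 1
  apply Subtype.ext
  refine (transported_eq F t).trans ?_
  simp [chart, chartFoot, chartDir, geod, jac, cK_zero, sK_zero]

theorem hasVelocity_billiardF {κ : ℝ} (hκ : κ = 1 ∨ κ = -1) {S : Set E4}
    {u : unitTangentBundle κ}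
    (F : IsFrame κ (u : E4 × E4).1 (inwardNormal κ S (u : E4 × E4).1) (u : E4 × E4).2
      (rotated S u).2) : HasVelocity (billiardF S u) 0 u (jac κ (rotated S u).2 0) := by
  let φ : ℝ → unitTangentBundle κ := fun t => ⟨transported S u t, transported_mem hκ F t⟩
  have hφ0 : φ 0 = u := by
    apply Subtype.ext
    simp only [φ, transported_eq F, jac_zero]
  have hA : HasDerivAt (fun s => (φ s : E4 × E4).1) (rotated S u).2 0 := by
    have := hasDerivAt_jac hκ (u : E4 × E4).1 (rotated S u).2 0
    rw [jac_zero] at this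
    simpa only [φ, transported_eq F] using this
  have hB : HasDerivAt (fun s => (φ s : E4 × E4).2) 0 0 := by
    simpa only [φ, transported_eq F] using hasDerivAt_const (0 : ℝ) (u : E4 × E4).2
  refine ⟨φ, Eventually.of_forall fun s => ?_, Eventually.of_forall fun s => ?_, hφ0, ?_⟩
  · simp only [φ, transported_eq F]
    exact ((contDiff_jac κ _ _).prodMk contDiff_const).contDiffAt
  · rw [billiardF, dif_pos (transported_mem hκ F s)]
  · have := normalPart_variationField hκ hA hB
    rw [hφ0] at this
    rw [this, F.vw]
    simp

/-- The characteristic line of the hypersurface of tangent geodesics. -/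
theorem characteristic_line {κ : ℝ} (hκ : κ = 1 ∨ κ = -1) {S : Set E4}
    (hS : IsCompactSurface κ S) (hconv : StrictlyConvex κ S) (hquad : QuadraticallyConvex κ S)
    {u : unitTangentBundle κ} (hu : u ∈ unitTangentSurface κ S) :
    {X ∈ tangentSpaceM S u | ∀ Y ∈ tangentSpaceM S u, omegaK u X Y = 0} =
      {X | ∃ a : ℝ, X = a • jac κ (rotated S u).2 0} := by
  have hTM := mem_tangentSpaceM_iff hκ hS hconv hquad hu
  obtain ⟨-, F⟩ := isFrame_rotated hκ hS hconv hu
  have hk0 : κ ≠ 0 := by rcases hκ with rfl | rfl <;> norm_num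
  -- On `Tℳ` the form does not see `a`, and it is nondegenerate in `(b, d)`.
  have hω : ∀ a b d a' b' d' : ℝ,
      omegaK u (jac κ (a • (rotated S u).2)
          (b • (rotated S u).2 + d • inwardNormal κ S (u : E4 × E4).1))
        (jac κ (a' • (rotated S u).2)
          (b' • (rotated S u).2 + d' • inwardNormal κ S (u : E4 × E4).1)) =
        κ * (b * d' - d * b') := by
    intro a b d a' b' d'
    rw [omegaK, complexStructure_jac hκ, cross_add_right, cross_smul_right, cross_smul_right,
      cross_smul_right, cross_eq_normal hκ F, cross_normal, gK_jac hκ]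
    · simp only [bil_add_left, bil_add_right, bil_smul_left, bil_smul_right, bil_neg_left, F.nw,
        F.nn, F.ww, F.wn]
      ring
    · simp [bil_add_right, bil_smul_right, bil_neg_right, F.pn, F.pw]
    · simp [bil_add_right, bil_smul_right, F.pn, F.pw]
  ext X
  simp only [mem_ofPred_eq, hTM]
  constructor
  · rintro ⟨⟨a, b, d, rfl⟩, h⟩
    have h1 := h _ ⟨0, 0, 1, rfl⟩
    have h2 := h _ ⟨0, 1, 0, rfl⟩
    rw [hω] at h1 h2
    have hb : b = 0 := by simpa [hk0] using h1
    have hd : d = 0 := by simpa [hk0] using h2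
    refine ⟨a, ?_⟩
    rw [smul_jac, hb, hd]
    simp
  · rintro ⟨a, rfl⟩
    have e : a • jac κ (rotated S u).2 0 = jac κ (a • (rotated S u).2)
        ((0 : ℝ) • (rotated S u).2 + (0 : ℝ) • inwardNormal κ S (u : E4 × E4).1) := by
      rw [smul_jac]; simp
    refine ⟨⟨a, 0, 0, e⟩, ?_⟩
    rintro Y ⟨a', b', d', rfl⟩
    rw [e, hω]
    ring

end GeodesicBilliard

theorem mainTheorem3 (κ : ℝ) (hκ : κ = 1 ∨ κ = -1) (S : Set GeodesicBilliard.E4)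
    (hS : GeodesicBilliard.IsCompactSurface κ S)
    (hconv : GeodesicBilliard.StrictlyConvex κ S)
    (hquad : GeodesicBilliard.QuadraticallyConvex κ S) :
    ∃ N : GeodesicBilliard.unitTangentBundle κ → ℝ → GeodesicBilliard.E4,
      ∀ u ∈ GeodesicBilliard.unitTangentSurface κ S,
        (∀ ξ, GeodesicBilliard.IsOutwardUnitNormal S u ξ ↔ ξ = N u) ∧
        (∀ t, GeodesicBilliard.transported S u t ∈ GeodesicBilliard.unitTangentBundle κ) ∧
        GeodesicBilliard.IsGeodesicGK (GeodesicBilliard.billiardF S u) ∧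
        GeodesicBilliard.HasVelocity (GeodesicBilliard.billiardF S u) 0 u
          (GeodesicBilliard.complexStructure u (N u)) ∧
        {X ∈ GeodesicBilliard.tangentSpaceM S u |
            ∀ Y ∈ GeodesicBilliard.tangentSpaceM S u, GeodesicBilliard.omegaK u X Y = 0} =
          {X | ∃ a : ℝ, X = a • GeodesicBilliard.complexStructure u (N u)} := by
  -- `N(u)` is the Jacobi field with initial value `-n` and initial covariant derivative `0`.
  refine ⟨fun u => GeodesicBilliard.jac κ
    (-GeodesicBilliard.inwardNormal κ S (u : GeodesicBilliard.E4 × GeodesicBilliard.E4).1) 0,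
    fun u hu => ?_⟩
  obtain ⟨-, F⟩ := GeodesicBilliard.isFrame_rotated hκ hS hconv hu
  refine ⟨GeodesicBilliard.isOutwardUnitNormal_iff hκ hS hconv hquad hu,
    GeodesicBilliard.transported_mem hκ F, GeodesicBilliard.isGeodesicGK_billiardF hκ F, ?_, ?_⟩
  · rw [GeodesicBilliard.complexStructure_normal hκ]
    exact GeodesicBilliard.hasVelocity_billiardF hκ F
  · rw [GeodesicBilliard.complexStructure_normal hκ]
    exact GeodesicBilliard.characteristic_line hκ hS hconv hquad hu
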